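/- Let $(\xi_{ij})_{i,j\ge 1}$ be i.i.d. centred sub-Gaussian real random variables with $E[\xi_{ij}^2]=1$ on a probability space $(\Omega,P)$, and let $\beta,R,\theta>0$ and $\alpha\in(0,1)$. For $N_1,N_2\ge1$, $x\in\mathbb R^{N_1}$, $y\in\mathbb R^{N_2}$ put $$H_{N_1,N_2}(x,y):=-\frac1{\sqrt{N_1+N_2}}\sum_{j=1}^{N_2}\sum_{i=1}^{N_1}\xi_{ij}x_iy_j .$$ Let $\sigma_{N,R}$ be the uniform probability measure on the sphere of radius $R\sqrt N$ centred at the origin of $\mathbb R^N$ and $\gamma_{N,\theta}$ the centred Gaussian measure on $\mathbb R^N$ with covariance $\theta\,\mathbb I$. The free energy of the restricted Boltzmann machine $RBM_{\sigma,\gamma}$, with one spherical and one Gaussian layer, is $$A_{N_1,N_2}:=\frac1{N_1+N_2}\log\int_{\mathbb R^{N_1}\times\mathbb R^{N_2}}\sigma_{N_1,R}(dx)\,\gamma_{N_2,\theta}(dy)\,e^{-\beta H_{N_1,N_2}(x,y)} .$$ Then there is a real number $A=A_{\sigma,\gamma}(R,\theta,\alpha,\beta)$, depending only on $R,\theta,\alpha,\beta$,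 such that for every choice of the weights as above and all sequences $N_1=N_1(n)$, $N_2=N_2(n)$ of natural numbers tending to infinity with $N_1/(N_1+N_2)\to\alpha$, $$\lim_{n\to\infty}A_{N_1(n),N_2(n)}=A\qquad P\text{-a.s.}$$ -/

import Mathlib

open MeasureTheory ProbabilityTheory Filter Topology

noncomputable section

/-- The uniform probability measure on the sphere of radius `R * √N` centred at `0` in `ℝ^N`:
the surface measure of the unit sphere, normalised to total mass one and pushed forward by
`u ↦ (R * √N) • u`. -/
def sphericalPrior (N : ℕ) (R : ℝ) : Measure (EuclideanSpace ℝ (Fin N)) :=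
  ((volume : Measure (EuclideanSpace ℝ (Fin N))).toSphere[|Set.univ]).map
    (fun u : Metric.sphere (0 : EuclideanSpace ℝ (Fin N)) 1 =>
      (R * √(N : ℝ)) • (u : EuclideanSpace ℝ (Fin N)))

/-- The centred Gaussian measure on `ℝ^N` with covariance matrix `θ I`. -/
def gaussianPrior (N : ℕ) (θ : ℝ) : Measure (EuclideanSpace ℝ (Fin N)) :=
  multivariateGaussian 0 (θ • (1 : Matrix (Fin N) (Fin N) ℝ))

/-- The energy of the restricted Boltzmann machine with layers of `N₁` and `N₂` units and
weight matrix `Ξ`. -/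
def rbmEnergy {N₁ N₂ : ℕ} (Ξ : Matrix (Fin N₁) (Fin N₂) ℝ)
    (x : EuclideanSpace ℝ (Fin N₁)) (y : EuclideanSpace ℝ (Fin N₂)) : ℝ :=
  -(1 / √((N₁ : ℝ) + (N₂ : ℝ))) * ∑ j, ∑ i, Ξ i j * x i * y j

/-- The partition function of the restricted Boltzmann machine with the spherical prior of
radius parameter `R` on the first layer, the Gaussian prior of variance `θ` on the second layer,
and inverse temperature `β`. -/
def rbmPartitionFunction {N₁ N₂ : ℕ} (R θ β : ℝ) (Ξ : Matrix (Fin N₁) (Fin N₂) ℝ) : ℝ :=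
  ∫ p, Real.exp (-β * rbmEnergy Ξ p.1 p.2) ∂((sphericalPrior N₁ R).prod (gaussianPrior N₂ θ))

/-- The free energy per unit of the restricted Boltzmann machine. -/
def rbmFreeEnergy {N₁ N₂ : ℕ} (R θ β : ℝ) (Ξ : Matrix (Fin N₁) (Fin N₂) ℝ) : ℝ :=
  1 / ((N₁ : ℝ) + (N₂ : ℝ)) * Real.log (rbmPartitionFunction R θ β Ξ)

/-! The priors are probability measures and the partition function is the integral of an
integrable function, so it is a positive real number. -/

instance (N : ℕ) (θ : ℝ) : IsProbabilityMeasure (gaussianPrior N θ) := by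
  unfold gaussianPrior; infer_instance

theorem isProbabilityMeasure_sphericalPrior {N : ℕ} (hN : 0 < N) (R : ℝ) :
    IsProbabilityMeasure (sphericalPrior N R) := by
  have : Nonempty (Fin N) := ⟨⟨0, hN⟩⟩
  have h : (volume : Measure (EuclideanSpace ℝ (Fin N))).toSphere Set.univ ≠ 0 :=
    Measure.measure_univ_ne_zero.2 (Measure.toSphere_ne_zero _)
  have := cond_isProbabilityMeasure h
  exact Measure.isProbabilityMeasure_map (by fun_prop)

theorem sphericalPrior_norm (N : ℕ) (R : ℝ) :
    ∀ᵐ x ∂(sphericalPrior N R), ‖x‖ = |R| * √(N : ℝ) := by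
  unfold sphericalPrior
  rw [ae_map_iff (by fun_prop) (measurableSet_eq_fun (by fun_prop) (by fun_prop))]
  refine Filter.Eventually.of_forall fun u => ?_
  rw [norm_smul, norm_eq_of_mem_sphere, mul_one, norm_mul, Real.norm_eq_abs,
    Real.norm_of_nonneg (Real.sqrt_nonneg _)]

theorem integrable_exp_rbmEnergy {N₁ N₂ : ℕ} (R θ β : ℝ) (Ξ : Matrix (Fin N₁) (Fin N₂) ℝ) :
    Integrable (fun p : EuclideanSpace ℝ (Fin N₁) × EuclideanSpace ℝ (Fin N₂) =>
        Real.exp (-β * rbmEnergy Ξ p.1 p.2))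
      ((sphericalPrior N₁ R).prod (gaussianPrior N₂ θ)) := by
  have hfin : IsFiniteMeasure (sphericalPrior N₁ R) := by
    unfold sphericalPrior; infer_instance
  have hg : IsGaussian (gaussianPrior N₂ θ) := by unfold gaussianPrior; infer_instance
  obtain ⟨C, hC, hint⟩ := IsGaussian.exists_integrable_exp_sq (gaussianPrior N₂ θ)
  set K : ℝ := |β| * (1 / √((N₁ : ℝ) + (N₂ : ℝ)) *
    ∑ j : Fin N₂, ∑ i : Fin N₁, |Ξ i j| * (|R| * √(N₁ : ℝ))) with hK
  have hdom : Integrable (fun p : EuclideanSpace ℝ (Fin N₁) × EuclideanSpace ℝ (Fin N₂) =>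
      Real.exp (K ^ 2 / (4 * C)) * Real.exp (C * ‖p.2‖ ^ 2))
      ((sphericalPrior N₁ R).prod (gaussianPrior N₂ θ)) :=
    (hint.comp_snd (sphericalPrior N₁ R)).const_mul _
  refine hdom.mono' ?_ ?_
  · refine Continuous.aestronglyMeasurable ?_
    unfold rbmEnergy; fun_prop
  · have hx : ∀ᵐ p ∂((sphericalPrior N₁ R).prod (gaussianPrior N₂ θ)),
        ‖p.1‖ = |R| * √(N₁ : ℝ) :=
      Measure.quasiMeasurePreserving_fst.ae (sphericalPrior_norm N₁ R)
    filter_upwards [hx] with p hp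
    rw [Real.norm_of_nonneg (Real.exp_pos _).le, ← Real.exp_add, Real.exp_le_exp]
    have h1 : -β * rbmEnergy Ξ p.1 p.2 ≤ K * ‖p.2‖ := by
      refine (le_abs_self _).trans ?_
      rw [rbmEnergy, abs_mul, abs_mul, abs_neg, abs_neg, hK, mul_assoc, mul_assoc,
        abs_of_nonneg (by positivity : (0 : ℝ) ≤ 1 / √((N₁ : ℝ) + (N₂ : ℝ)))]
      gcongr
      rw [Finset.sum_mul]
      refine (Finset.abs_sum_le_sum_abs _ _).trans (Finset.sum_le_sum fun j _ => ?_)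
      rw [Finset.sum_mul]
      refine (Finset.abs_sum_le_sum_abs _ _).trans (Finset.sum_le_sum fun i _ => ?_)
      rw [abs_mul, abs_mul, ← hp]
      have ha : |p.1 i| ≤ ‖p.1‖ := PiLp.norm_apply_le p.1 i
      have hb : |p.2 j| ≤ ‖p.2‖ := PiLp.norm_apply_le p.2 j
      gcongr
    have h2 : K * ‖p.2‖ ≤ K ^ 2 / (4 * C) + C * ‖p.2‖ ^ 2 := by
      have : K ^ 2 / (4 * C) + C * ‖p.2‖ ^ 2 - K * ‖p.2‖
          = (K - 2 * C * ‖p.2‖) ^ 2 / (4 * C) := by field_simp; ring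
      have : 0 ≤ (K - 2 * C * ‖p.2‖) ^ 2 / (4 * C) := by positivity
      linarith
    linarith

theorem rbmPartitionFunction_pos {N₁ N₂ : ℕ} (hN : 0 < N₁) (R θ β : ℝ)
    (Ξ : Matrix (Fin N₁) (Fin N₂) ℝ) : 0 < rbmPartitionFunction R θ β Ξ := by
  have := isProbabilityMeasure_sphericalPrior hN R
  exact integral_exp_pos (integrable_exp_rbmEnergy R θ β Ξ)

end

/-! ### Elementary inequalities for even moments -/

section QuadraticForms

/-! Write N = N₁ + N₂, κ = θβ², K = κR² and A = ΞΞᵀ/N. Integrating out the Gaussian layer leaves the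
average of exp(κ⟨x, Ax⟩/2) over the sphere (`ofReal_rbmPartitionFunction`), so only the spectrum of
the sample covariance matrix A matters.

Spherical average. Let s lie above the eigenvalues lᵢ of A. Representing the uniform direction by a
Gaussian vector with variances 1/(s - lᵢ) in the eigenbasis turns the average into det(s - A)^(-1/2)
times a Gaussian integral of a function homogeneous of degree zero, which is at most exp(N₁(Ks - 1 -
log K)/2). This upper bound holds for every s (`log_le_of_ofReal_eq_lintegral`). It is sharp on the
exponential scale at the saddle point tr (s - A)⁻¹ / N₁ = K. If K exceeds the limit of this trace at
the spectral edge, there is no saddle point: s is placed just above the edge and the missing mass r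
= K - tr (s - A)⁻¹ / N₁ is put on an eigenvector whose eigenvalue is within Δ of s, at a cost
proportional to Δr (`le_log_of_ofReal_eq_lintegral`).

Spectrum. A is a sum of N₂ independent rank one matrices vvᵀ. Put R = (u - A)⁻¹ and m = tr R / N.
Adding vvᵀ raises m by (1 - vᵀRv)⁻¹ vᵀR²v / N, which by concentration is close to (1 - m)⁻¹ (tr R² /
N) / N. To first order this is what m loses when u moves up by (1 - m)⁻¹/N. Hence m is almost
conserved along the characteristic with that speed, and log det grows at a constant rate
(`characteristic_step`). For A = 0 and u = α + w one has m ≈ α/(α + w); after N₂ steps the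
characteristic is at `specPoint α w` = 1 + w + α(1-α)/w, which is increasing for w > √(α(1-α)),
where the spectral edge sits.

The argument needs the eigenvalues to stay away from u. A lower barrier, moving slightly faster than
its own characteristic, has a Stieltjes transform that does not increase; this keeps vᵀRv < 1.
Concentration there needs a gap N^(-1/8) between spectrum and barrier. It is enforced by a Lyapunov
function, tr R⁴⁸ times an exponential in m: its mean does not increase, while a gap violation makes
it at least N⁶ (`BarrierData.Valid.controlled_succ`, `walkStep_iterate_indicator_le`). The failure
probability is O(N⁻⁴), summable over all pairs of sizes, and Borel–Cantelli gives almost sure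
convergence of m and of the logarithmic determinant.

The limit is `rateFun` at w = max(√(α(1-α)), 1/K - α): the saddle point if it lies above the edge,
and the edge otherwise. -/

theorem ProbabilityTheory.HasSubgaussianMGF.integral_pow_even_le {Ω : Type*} [MeasurableSpace Ω]
    {μ : Measure Ω} {L : Ω → ℝ} {c s : NNReal}
    (h : HasSubgaussianMGF L (c * s) μ) {r : ℕ} (hr : r ≠ 0) :
    ∫ ω, L ω ^ (2 * r) ∂μ ≤ (2 * r).factorial * (2 * Real.exp (c / 2)) * (s : ℝ) ^ r := by
  rcases eq_or_ne s 0 with rfl | hs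
  · have h0 : L =ᵐ[μ] 0 := by
      apply HasSubgaussianMGF.ae_eq_zero_of_hasSubgaussianMGF_zero; simpa using h
    have : ∫ ω, L ω ^ (2 * r) ∂μ = 0 := by
      rw [integral_eq_zero_of_ae]
      filter_upwards [h0] with ω hω
      simp [hω, hr]
    rw [this]; positivity
  have hs' : (0 : ℝ) < s := by positivity
  -- At this scale the sub-Gaussian bound on the exponential moment is e^(c/2), free of s.
  set t : ℝ := (√(s : ℝ))⁻¹ with ht
  have ht2 : t ^ 2 = (s : ℝ)⁻¹ := by rw [ht, inv_pow, Real.sq_sqrt hs'.le]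
  have hb : ∀ x : ℝ, x ^ (2 * r) ≤
      (2 * r).factorial * (s : ℝ) ^ r * (Real.exp (t * x) + Real.exp (-t * x)) := by
    intro x
    have h1 : ∀ y : ℝ, 0 ≤ y → y ^ (2 * r) / (2 * r).factorial ≤ Real.exp y := fun y hy =>
      (Real.pow_div_factorial_le_exp y hy (2 * r))
    have h2 : (t * x) ^ (2 * r) / (2 * r).factorial ≤ Real.exp (t * x) + Real.exp (-t * x) := by
      rcases le_total 0 (t * x) with h | h
      · exact (h1 _ h).trans (le_add_of_nonneg_right (Real.exp_pos _).le)
      · have := h1 (-(t * x)) (by linarith)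
        rw [(even_two_mul r).neg_pow] at this
        refine this.trans ?_
        rw [neg_mul]
        exact le_add_of_nonneg_left (Real.exp_pos _).le
    have h3 : (t * x) ^ (2 * r) = ((s : ℝ) ^ r)⁻¹ * x ^ (2 * r) := by
      rw [mul_pow, pow_mul t, ht2, inv_pow]
    rw [h3, div_le_iff₀ (by positivity)] at h2
    have h4 : x ^ (2 * r) = (s : ℝ) ^ r * (((s : ℝ) ^ r)⁻¹ * x ^ (2 * r)) := by
      field_simp
    rw [h4]
    calc _ ≤ (s : ℝ) ^ r * ((Real.exp (t * x) + Real.exp (-t * x)) * (2 * r).factorial) := by gcongr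
      _ = _ := by ring
  have hm : ∀ a : ℝ, a ^ 2 = (s : ℝ)⁻¹ → ∫ ω, Real.exp (a * L ω) ∂μ ≤ Real.exp (c / 2) := by
    intro a ha
    refine (h.mgf_le a).trans_eq ?_
    rw [ha]; push_cast; congr 1; field_simp
  calc ∫ ω, L ω ^ (2 * r) ∂μ
      ≤ ∫ ω, (2 * r).factorial * (s : ℝ) ^ r * (Real.exp (t * L ω) + Real.exp (-t * L ω)) ∂μ := by
        refine integral_mono_of_nonneg (ae_of_all _ fun ω => (even_two_mul r).pow_nonneg _) ?_
          (ae_of_all _ fun ω => hb _)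
        exact ((h.integrable_exp_mul t).add (h.integrable_exp_mul (-t))).const_mul _
    _ = (2 * r).factorial * (s : ℝ) ^ r *
        (∫ ω, Real.exp (t * L ω) ∂μ + ∫ ω, Real.exp (-t * L ω) ∂μ) := by
        rw [integral_const_mul, integral_add (h.integrable_exp_mul t) (h.integrable_exp_mul (-t))]
    _ ≤ (2 * r).factorial * (s : ℝ) ^ r * (Real.exp (c / 2) + Real.exp (c / 2)) := by
        gcongr
        · exact hm t ht2
        · exact hm (-t) (by rw [neg_sq, ht2])
    _ = _ := by ring

/-- The linear term is kept exact because it averages to zero when y is a centred increment. Every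
later binomial monomial is dominated by x^(2r-2) y² or by y^(2r), according to which of |x|, |y| is
larger, and the coefficients sum to at most 2^(2r). -/
theorem add_pow_even_le (x y : ℝ) {r : ℕ} (hr : r ≠ 0) :
    (x + y) ^ (2 * r) ≤ x ^ (2 * r) + 2 * r * (x ^ (2 * r - 1) * y)
      + 4 ^ r * (x ^ (2 * r - 2) * y ^ 2 + y ^ (2 * r)) := by
  obtain ⟨k, rfl⟩ := Nat.exists_eq_succ_of_ne_zero hr
  have e : 2 * k.succ = 2 * k + 1 + 1 := by omega
  rw [e, add_comm x y, add_pow, Finset.sum_range_succ', Finset.sum_range_succ']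
  have key : ∀ j ∈ Finset.range (2 * k + 1),
      y ^ (j + 1 + 1) * x ^ (2 * k + 1 + 1 - (j + 1 + 1)) * ((2 * k + 1 + 1).choose (j + 1 + 1) : ℝ)
      ≤ (x ^ (2 * k) * y ^ 2 + y ^ (2 * k + 1 + 1)) * ((2 * k + 1 + 1).choose (j + 1 + 1) : ℝ) := by
    intro j hj
    have hj' : j ≤ 2 * k := by simpa [Nat.lt_succ_iff] using hj
    gcongr
    have e2 : 2 * k + 1 + 1 - (j + 1 + 1) = 2 * k - j := by omega
    rw [e2]
    refine (le_abs_self _).trans ?_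
    rw [abs_mul, abs_pow, abs_pow]
    have p1 : x ^ (2 * k) = |x| ^ (2 * k) := ((even_two_mul k).pow_abs x).symm
    have p2 : y ^ (2 * k + 1 + 1) = |y| ^ (2 * k + 1 + 1) :=
      (Even.pow_abs (by rw [← e]; exact even_two_mul _) y).symm
    have p3 : y ^ 2 = |y| ^ 2 := (sq_abs y).symm
    rw [p1, p2, p3]
    have hx := abs_nonneg x
    have hy := abs_nonneg y
    rcases le_total |x| |y| with h | h
    · refine le_add_of_nonneg_of_le (by positivity) ?_
      calc |y| ^ (j + 1 + 1) * |x| ^ (2 * k - j) ≤ |y| ^ (j + 1 + 1) * |y| ^ (2 * k - j) := by gcongr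
        _ = |y| ^ (2 * k + 1 + 1) := by rw [← pow_add]; congr 1; omega
    · refine le_add_of_le_of_nonneg ?_ (by positivity)
      calc |y| ^ (j + 1 + 1) * |x| ^ (2 * k - j) = |x| ^ (2 * k - j) * |y| ^ j * |y| ^ 2 := by ring
        _ ≤ |x| ^ (2 * k - j) * |x| ^ j * |y| ^ 2 := by gcongr
        _ = |x| ^ (2 * k) * |y| ^ 2 := by rw [← pow_add]; congr 3; omega
  have hsum : (∑ j ∈ Finset.range (2 * k + 1), ((2 * k + 1 + 1).choose (j + 1 + 1) : ℝ)) ≤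
      4 ^ (k + 1) := by
    have h1 := Nat.sum_range_choose (2 * k + 1 + 1)
    rw [Finset.sum_range_succ', Finset.sum_range_succ'] at h1
    have h2 : (2 : ℕ) ^ (2 * k + 1 + 1) = 4 ^ (k + 1) := by
      rw [show 2 * k + 1 + 1 = 2 * (k + 1) by ring, pow_mul]; norm_num
    have : ∑ j ∈ Finset.range (2 * k + 1), (2 * k + 1 + 1).choose (j + 1 + 1) ≤ 4 ^ (k + 1) := by
      omega
    exact_mod_cast this
  have hS := (Finset.sum_le_sum key).trans_eq (Finset.mul_sum _ _ _).symm
  have hnn : 0 ≤ x ^ (2 * k) * y ^ 2 + y ^ (2 * k + 1 + 1) := by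
    have := (even_two_mul k).pow_nonneg x
    have := Even.pow_nonneg (n := 2 * k + 1 + 1) (by rw [← e]; exact even_two_mul _) y
    positivity
  have hS2 := hS.trans (mul_le_mul_of_nonneg_left hsum hnn)
  have e3 : 2 * k + 1 + 1 - 1 = 2 * k + 1 := by omega
  have e4 : 2 * k + 1 + 1 - 2 = 2 * k := by omega
  simp only [e3, e4, zero_add, Nat.choose_one_right, Nat.choose_zero_right, pow_one, pow_zero,
    Nat.sub_zero, Nat.cast_one, Nat.succ_eq_add_one]
  push_cast at hS2 ⊢
  nlinarith [hS2]

/-- Young's inequality by comparing y² with x² b/a. The weights are such that both terms integrate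
to multiples of a^(r-1) b when the 2r-th moments of x and y have size a^r and b^r. -/
theorem young_pow (x y a b : ℝ) (ha : 0 < a) (hb : 0 < b) {r : ℕ} (hr : r ≠ 0) :
    x ^ (2 * r - 2) * y ^ 2 ≤ x ^ (2 * r) * (b / a) + y ^ (2 * r) * (a / b) ^ (r - 1) := by
  obtain ⟨k, rfl⟩ := Nat.exists_eq_succ_of_ne_zero hr
  have e4 : 2 * k.succ - 2 = 2 * k := by omega
  have e5 : 2 * k.succ = 2 * k + 2 := by omega
  rw [e4, e5, Nat.succ_sub_one, pow_add, pow_add, pow_mul, pow_mul]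
  have hx : 0 ≤ x ^ 2 := sq_nonneg x
  have hy : 0 ≤ y ^ 2 := sq_nonneg y
  generalize x ^ 2 = X at *
  generalize y ^ 2 = Y at *
  rcases le_total Y (X * (b / a)) with h | h
  · refine le_add_of_le_of_nonneg ?_ (by positivity)
    calc X ^ k * Y ≤ X ^ k * (X * (b / a)) := by gcongr
      _ = _ := by ring
  · refine le_add_of_nonneg_of_le (by positivity) ?_
    have hXY : X ≤ Y * (a / b) := by
      calc X = X * (b / a) * (a / b) := by field_simp
        _ ≤ _ := by gcongr
    calc X ^ k * Y ≤ (Y * (a / b)) ^ k * Y := by gcongr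
      _ = _ := by rw [mul_pow]; ring

end QuadraticForms

/-! ### Variables with all moments -/

section AllMoments

variable {Ω : Type*} [MeasurableSpace Ω] {μ : Measure Ω} [IsProbabilityMeasure μ]

/-- All absolute moments of `f` are finite. -/
def HasAllMoments (f : Ω → ℝ) (μ : Measure Ω) : Prop := ∀ p : ℕ, MemLp f p μ

omit [IsProbabilityMeasure μ] in
theorem HasAllMoments.add {f g : Ω → ℝ} (hf : HasAllMoments f μ) (hg : HasAllMoments g μ) :
    HasAllMoments (fun ω => f ω + g ω) μ := fun p => (hf p).add (hg p)

omit [IsProbabilityMeasure μ] in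
theorem HasAllMoments.mul {f g : Ω → ℝ} (hf : HasAllMoments f μ) (hg : HasAllMoments g μ) :
    HasAllMoments (fun ω => f ω * g ω) μ := fun p => by
  have : ENNReal.HolderTriple ((2 * p : ℕ) : ENNReal) ((2 * p : ℕ) : ENNReal) (p : ENNReal) := by
    refine ⟨?_⟩
    push_cast
    rw [ENNReal.mul_inv (by simp) (by simp), ← add_mul, ENNReal.inv_two_add_inv_two, one_mul]
  exact (hg (2 * p)).mul (hf (2 * p))

theorem HasAllMoments.const (c : ℝ) : HasAllMoments (fun _ : Ω => c) μ := fun _ => memLp_const c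

theorem HasAllMoments.pow {f : Ω → ℝ} (hf : HasAllMoments f μ) (n : ℕ) :
    HasAllMoments (fun ω => f ω ^ n) μ := by
  induction n with
  | zero => simpa using HasAllMoments.const 1
  | succ n ih => simpa [pow_succ] using ih.mul hf

theorem HasAllMoments.sum {ι : Type*} (s : Finset ι) {f : ι → Ω → ℝ}
    (hf : ∀ i, HasAllMoments (f i) μ) : HasAllMoments (fun ω => ∑ i ∈ s, f i ω) μ := by
  classical
  induction s using Finset.induction_on with
  | empty => simpa using HasAllMoments.const 0
  | insert a s ha ih => simpa [Finset.sum_insert ha] using (hf a).add ih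

omit [IsProbabilityMeasure μ] in
theorem HasAllMoments.integrable {f : Ω → ℝ} (hf : HasAllMoments f μ) : Integrable f μ := by
  simpa using memLp_one_iff_integrable.1 (by simpa using hf 1)

omit [IsProbabilityMeasure μ] in
theorem ProbabilityTheory.HasSubgaussianMGF.hasAllMoments {f : Ω → ℝ} {c : NNReal}
    (hf : HasSubgaussianMGF f c μ) : HasAllMoments f μ := fun p => by
  simpa using hf.memLp (p : NNReal)

end AllMoments

/-! ### Moments of quadratic forms in independent sub-Gaussian variables -/

section QuadraticForms

/-- Both a^(r-1) z and z^r are at most (a+z)^(r-1) z, hence so is their mean. The left side is the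
shape that one step of the moment induction produces. -/
theorem half_add_pow_le (a z : ℝ) (ha : 0 ≤ a) (hz : 0 ≤ z) {r : ℕ} (hr : r ≠ 0) :
    a ^ r + (a ^ (r - 1) * z + z ^ r) / 2 ≤ (a + z) ^ r := by
  obtain ⟨k, rfl⟩ := Nat.exists_eq_succ_of_ne_zero hr
  simp only [Nat.succ_eq_add_one, Nat.add_sub_cancel]
  have h1 : a ^ k ≤ (a + z) ^ k := by gcongr; linarith
  have h2 : z ^ k ≤ (a + z) ^ k := by gcongr; linarith
  have h3 := mul_le_mul_of_nonneg_right h1 ha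
  have h4 := mul_le_mul_of_nonneg_right h1 hz
  have h5 := mul_le_mul_of_nonneg_right h2 hz
  rw [pow_succ, pow_succ, pow_succ]
  nlinarith

/-- Moment constant of a sub-Gaussian variable. -/
noncomputable def subgMomentConst (c : NNReal) (r : ℕ) : ℝ :=
  (2 * r).factorial * (2 * Real.exp (c / 2))

theorem subgMomentConst_nonneg (c : NNReal) (r : ℕ) : 0 ≤ subgMomentConst c r := by
  unfold subgMomentConst; positivity

/-- Moment constant of an increment of a quadratic form in sub-Gaussian variables. -/
noncomputable def quadIncrConst (c : NNReal) (r : ℕ) : ℝ :=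
  4 ^ r * (4 ^ r * (subgMomentConst c r * subgMomentConst c r)
    + 4 ^ r * (subgMomentConst c (2 * r) + 1))

/-- Moment constant of a quadratic form in sub-Gaussian variables. -/
noncomputable def quadConst (c : NNReal) (r : ℕ) : ℝ := 2 * 4 ^ r * (1 + quadIncrConst c r)

theorem quadIncrConst_nonneg (c : NNReal) (r : ℕ) : 0 ≤ quadIncrConst c r := by
  have := subgMomentConst_nonneg c r
  have := subgMomentConst_nonneg c (2 * r)
  unfold quadIncrConst; positivity

theorem quadConst_nonneg (c : NNReal) (r : ℕ) : 0 ≤ quadConst c r := by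
  have := quadIncrConst_nonneg c r
  unfold quadConst; positivity

theorem add_pow_even_le_four_pow (x y : ℝ) (r : ℕ) :
    (x + y) ^ (2 * r) ≤ 4 ^ r * (x ^ (2 * r) + y ^ (2 * r)) := by
  have h := Even.add_pow_le (a := x) (b := y) (even_two_mul r)
  have h0 : 0 ≤ x ^ (2 * r) + y ^ (2 * r) :=
    add_nonneg ((even_two_mul r).pow_nonneg _) ((even_two_mul r).pow_nonneg _)
  refine h.trans ?_
  gcongr
  calc (2 : ℝ) ^ (2 * r - 1) ≤ 2 ^ (2 * r) := pow_le_pow_right₀ (by norm_num) (by omega)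
    _ = 4 ^ r := by rw [pow_mul]; norm_num

variable {Ω : Type*} [MeasurableSpace Ω] {μ : Measure Ω} [IsProbabilityMeasure μ]
  {ι : Type*} [DecidableEq ι] {X : ι → Ω → ℝ} {c : NNReal}

/-- The integrand is what a new index adds to a centred quadratic form: η is the new variable, L the
linear form in the earlier ones, β the diagonal entry. Independence factorises the moment of ηL. -/
theorem integral_pow_quadIncr_le {η L : Ω → ℝ} (hη : HasSubgaussianMGF η c μ)
    {s : NNReal} (hL : HasSubgaussianMGF L (c * s) μ) (hind : IndepFun L η μ) (β : ℝ)
    {r : ℕ} (hr : r ≠ 0) :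
    ∫ ω, (2 * (η ω * L ω) + β * (η ω ^ 2 - 1)) ^ (2 * r) ∂μ
      ≤ quadIncrConst c r * (s + β ^ 2) ^ r := by
  have mη := hη.hasAllMoments
  have mL := hL.hasAllMoments
  have e1 := hL.integral_pow_even_le hr
  have hη1 : HasSubgaussianMGF η (c * 1) μ := by simpa using hη
  have e2 := hη1.integral_pow_even_le hr
  have e3 := hη1.integral_pow_even_le (r := 2 * r) (by omega)
  simp only [NNReal.coe_one, one_pow, mul_one] at e2 e3
  have hi : ∫ ω, η ω ^ (2 * r) * L ω ^ (2 * r) ∂μ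
      = (∫ ω, η ω ^ (2 * r) ∂μ) * ∫ ω, L ω ^ (2 * r) ∂μ := by
    have : IndepFun (fun ω => η ω ^ (2 * r)) (fun ω => L ω ^ (2 * r)) μ :=
      hind.symm.comp (φ := fun x => x ^ (2 * r)) (ψ := fun x => x ^ (2 * r))
        (by fun_prop) (by fun_prop)
    exact this.integral_fun_mul_eq_mul_integral (mη.pow _).integrable.1 (mL.pow _).integrable.1
  have pt : ∀ ω, (2 * (η ω * L ω) + β * (η ω ^ 2 - 1)) ^ (2 * r) ≤
      4 ^ r * (4 ^ r * (η ω ^ (2 * r) * L ω ^ (2 * r))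
        + β ^ (2 * r) * (4 ^ r * (η ω ^ (2 * (2 * r)) + 1))) := by
    intro ω
    refine (add_pow_even_le_four_pow _ _ r).trans ?_
    have hβ : 0 ≤ β ^ (2 * r) := (even_two_mul r).pow_nonneg _
    have h1 : (2 * (η ω * L ω)) ^ (2 * r) = 4 ^ r * (η ω ^ (2 * r) * L ω ^ (2 * r)) := by
      rw [mul_pow, mul_pow, pow_mul 2]; norm_num
    have h2 : (η ω ^ 2 - 1) ^ (2 * r) ≤ 4 ^ r * (η ω ^ (2 * (2 * r)) + 1) := by
      have := add_pow_even_le_four_pow (η ω ^ 2) (-1) r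
      rw [(even_two_mul r).neg_pow, one_pow, ← pow_mul] at this
      simpa [sub_eq_add_neg] using this
    rw [h1, mul_pow]
    gcongr
  have hI : Integrable (fun ω => 4 ^ r * (4 ^ r * (η ω ^ (2 * r) * L ω ^ (2 * r))
        + β ^ (2 * r) * (4 ^ r * (η ω ^ (2 * (2 * r)) + 1)))) μ :=
    (((((mη.pow _).mul (mL.pow _)).integrable).const_mul _).add
      ((((mη.pow _).add (HasAllMoments.const 1)).integrable.const_mul _).const_mul _)).const_mul _
  refine (integral_mono_of_nonneg (ae_of_all _ fun ω => (even_two_mul r).pow_nonneg _) hI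
    (ae_of_all _ pt)).trans ?_
  rw [integral_const_mul, integral_add, integral_const_mul, integral_const_mul, integral_const_mul,
    integral_add, integral_const, hi]
  rotate_left
  · exact (mη.pow _).integrable
  · exact integrable_const _
  · exact ((mη.pow _).mul (mL.pow _)).integrable.const_mul _
  · exact (((mη.pow _).add (HasAllMoments.const 1)).integrable.const_mul _).const_mul _
  simp only [probReal_univ, smul_eq_mul, mul_one]
  have hs : (s : ℝ) ^ r ≤ (s + β ^ 2) ^ r := by gcongr; nlinarith [sq_nonneg β]
  have hβ : β ^ (2 * r) ≤ (s + β ^ 2) ^ r := by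
    rw [pow_mul]; gcongr; nlinarith [s.coe_nonneg]
  have G1 := subgMomentConst_nonneg c r
  have G2 := subgMomentConst_nonneg c (2 * r)
  change _ ≤ subgMomentConst c r * _ at e1
  change _ ≤ subgMomentConst c r at e2
  change _ ≤ subgMomentConst c (2 * r) at e3
  have hβ0 : 0 ≤ β ^ (2 * r) := (even_two_mul r).pow_nonneg _
  have hL0 : 0 ≤ ∫ ω, L ω ^ (2 * r) ∂μ := integral_nonneg fun ω => (even_two_mul r).pow_nonneg _
  calc _ ≤ 4 ^ r * (4 ^ r * (subgMomentConst c r * (subgMomentConst c r * (s + β ^ 2) ^ r))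
        + (s + β ^ 2) ^ r * (4 ^ r * (subgMomentConst c (2 * r) + 1))) := by
        have hE : 0 ≤ ∫ ω, η ω ^ (2 * (2 * r)) ∂μ :=
          integral_nonneg fun ω => (even_two_mul (2 * r)).pow_nonneg _
        gcongr
        exact e1.trans (by gcongr)
    _ = _ := by unfold quadIncrConst; ring

/-- The centred quadratic form with kernel `B` over the index set `s`. -/
def centredQuad (B : ι → ι → ℝ) (X : ι → Ω → ℝ) (s : Finset ι) (ω : Ω) : ℝ :=
  ∑ i ∈ s, ∑ j ∈ s, B i j * (X i ω * X j ω) - ∑ i ∈ s, B i i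

omit [MeasurableSpace Ω] in
theorem centredQuad_insert {B : ι → ι → ℝ} (hB : ∀ i j, B i j = B j i) {s : Finset ι} {k : ι}
    (hk : k ∉ s) (ω : Ω) :
    centredQuad B X (insert k s) ω = centredQuad B X s ω +
      (2 * (X k ω * ∑ i ∈ s, B k i * X i ω) + B k k * (X k ω ^ 2 - 1)) := by
  have h1 : ∑ i ∈ s, ∑ j ∈ insert k s, B i j * (X i ω * X j ω) =
      X k ω * ∑ i ∈ s, B k i * X i ω + ∑ i ∈ s, ∑ j ∈ s, B i j * (X i ω * X j ω) := by
    rw [Finset.mul_sum, ← Finset.sum_add_distrib]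
    refine Finset.sum_congr rfl fun i _ => ?_
    rw [Finset.sum_insert hk, hB i k]; ring
  have h2 : ∑ j ∈ s, B k j * (X k ω * X j ω) = X k ω * ∑ i ∈ s, B k i * X i ω := by
    rw [Finset.mul_sum]
    exact Finset.sum_congr rfl fun i _ => by ring
  unfold centredQuad
  rw [Finset.sum_insert hk, h1, Finset.sum_insert hk, Finset.sum_insert hk, h2]
  ring

omit [DecidableEq ι] in
theorem hasAllMoments_centredQuad (B : ι → ι → ℝ) (hs : ∀ i, HasSubgaussianMGF (X i) c μ)
    (s : Finset ι) : HasAllMoments (centredQuad B X s) μ := by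
  unfold centredQuad
  simp only [sub_eq_add_neg]
  exact (HasAllMoments.sum _ fun i => HasAllMoments.sum _ fun j =>
    (HasAllMoments.const _).mul ((hs i).hasAllMoments.mul (hs j).hasAllMoments)).add
      (HasAllMoments.const _)

/-- Moments of centred quadratic forms in independent sub-Gaussian variables. -/
theorem integral_pow_centredQuad_le {B : ι → ι → ℝ} (hB : ∀ i j, B i j = B j i)
    (hX : ∀ i, Measurable (X i)) (hind : iIndepFun X μ) (hs : ∀ i, HasSubgaussianMGF (X i) c μ)
    (h0 : ∀ i, ∫ ω, X i ω ∂μ = 0) (h1 : ∀ i, ∫ ω, X i ω ^ 2 ∂μ = 1) {r : ℕ} (hr : r ≠ 0)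
    (s : Finset ι) :
    ∫ ω, centredQuad B X s ω ^ (2 * r) ∂μ ≤
      (quadConst c r * ∑ i ∈ s, ∑ j ∈ s, B i j ^ 2) ^ r := by
  induction s using Finset.induction_on with
  | empty => simp [centredQuad, hr]
  | insert k s hk ih =>
    set L : Ω → ℝ := fun ω => ∑ i ∈ s, B k i * X i ω with hL
    set σ : NNReal := ∑ i ∈ s, (B k i ^ 2).toNNReal with hσ
    have hσ' : (σ : ℝ) = ∑ i ∈ s, B k i ^ 2 := by
      rw [hσ, NNReal.coe_sum]
      exact Finset.sum_congr rfl fun i _ => Real.coe_toNNReal _ (sq_nonneg _)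
    have hLs : HasSubgaussianMGF L (c * σ) μ := by
      have := HasSubgaussianMGF.sum_of_iIndepFun (X := fun i ω => B k i * X i ω)
        (c := fun i => (B k i ^ 2).toNNReal * c) (s := s) (μ := μ)
        (hind.comp (fun i x => B k i * x) (fun i => by fun_prop))
        (fun i _ => by
          have := (hs i).const_mul (B k i)
          convert this using 1
          exact congrArg (· * c) (Real.toNNReal_of_nonneg (sq_nonneg (B k i))))
      rw [← Finset.sum_mul, mul_comm, ← hσ] at this
      exact this
    have hpair : IndepFun (fun ω (i : s) => X i ω) (X k) μ := by
      have := hind.indepFun_finset s {k} (by simpa using hk) hX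
      exact this.comp (φ := id) (ψ := fun f : ({k} : Finset ι) → ℝ => f ⟨k, by simp⟩)
        measurable_id (measurable_pi_apply _)
    have hQ : centredQuad B X s = (fun f : s → ℝ => ∑ i : s, ∑ j : s, B i j * (f i * f j)
        - ∑ i ∈ s, B i i) ∘ (fun ω (i : s) => X i ω) := by
      ext ω
      simp only [centredQuad, Function.comp]
      rw [← Finset.sum_coe_sort s]
      congr 1
      refine Finset.sum_congr rfl fun i _ => ?_
      rw [← Finset.sum_coe_sort s]
    have hLe : L = (fun f : s → ℝ => ∑ i : s, B k i * f i) ∘ (fun ω (i : s) => X i ω) := by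
      ext ω
      simp only [hL, Function.comp]
      rw [← Finset.sum_coe_sort s]
    have hLk : IndepFun L (X k) μ := by
      rw [hLe]; exact hpair.comp (by fun_prop) measurable_id
    set Q := centredQuad B X s with hQdef
    set Y : Ω → ℝ := fun ω => 2 * (X k ω * L ω) + B k k * (X k ω ^ 2 - 1) with hY
    have mη := (hs k).hasAllMoments
    have mL := hLs.hasAllMoments
    have mQ : HasAllMoments Q μ := hasAllMoments_centredQuad B hs s
    have mη1 : HasAllMoments (fun ω => X k ω ^ 2 - 1) μ := by
      simpa [sub_eq_add_neg] using (mη.pow 2).add (HasAllMoments.const (-1))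
    have mY : HasAllMoments Y μ :=
      ((HasAllMoments.const 2).mul (mη.mul mL)).add ((HasAllMoments.const _).mul mη1)
    have hYm := integral_pow_quadIncr_le (hs k) hLs hLk (B k k) hr
    set b : ℝ := σ + B k k ^ 2 with hb
    have hb0 : 0 ≤ b := by positivity
    set F : ℝ := ∑ i ∈ s, ∑ j ∈ s, B i j ^ 2 with hF
    have hF0 : 0 ≤ F := Finset.sum_nonneg fun i _ => Finset.sum_nonneg fun j _ => sq_nonneg _
    have hFins : F + b ≤ ∑ i ∈ insert k s, ∑ j ∈ insert k s, B i j ^ 2 := by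
      have e1 : ∑ i ∈ s, ∑ j ∈ insert k s, B i j ^ 2 = (∑ i ∈ s, B k i ^ 2) + F := by
        rw [hF, ← Finset.sum_add_distrib]
        refine Finset.sum_congr rfl fun i _ => ?_
        rw [Finset.sum_insert hk, hB i k]
      rw [Finset.sum_insert hk, e1, Finset.sum_insert hk, hb, hσ']
      have : 0 ≤ ∑ i ∈ s, B k i ^ 2 := Finset.sum_nonneg fun i _ => sq_nonneg _
      linarith
    have hD := quadIncrConst_nonneg c r
    have hC := quadConst_nonneg c r
    refine le_trans ?_ (pow_le_pow_left₀ (by positivity)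
      (mul_le_mul_of_nonneg_left hFins hC) r)
    have hcq : ∀ ω, centredQuad B X (insert k s) ω = Q ω + Y ω :=
      fun ω => centredQuad_insert hB hk ω
    simp_rw [hcq]
    have hDC : quadIncrConst c r * b ^ r ≤ (quadConst c r * b) ^ r := by
      rw [mul_pow]
      gcongr
      have h4 : (1 : ℝ) ≤ 4 ^ r := one_le_pow₀ (by norm_num)
      have hq1 : quadIncrConst c r ≤ quadConst c r := by
        unfold quadConst; nlinarith
      have hq2 : 1 ≤ quadConst c r := by unfold quadConst; nlinarith
      exact hq1.trans (le_self_pow₀ hq2 hr)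
    -- Young's inequality below divides by F and by b, so vanishing values are treated separately.
    rcases eq_or_lt_of_le hF0 with hF0' | hFpos
    · have hz : ∀ i ∈ s, ∀ j ∈ s, B i j = 0 := by
        intro i hi j hj
        have h2 := (Finset.sum_eq_zero_iff_of_nonneg
          (fun i _ => Finset.sum_nonneg fun j _ => sq_nonneg (B i j))).1 hF0'.symm i hi
        have h3 := (Finset.sum_eq_zero_iff_of_nonneg (fun j _ => sq_nonneg (B i j))).1 h2 j hj
        exact pow_eq_zero_iff (two_ne_zero) |>.1 h3
      have hQ0 : ∀ ω, Q ω = 0 := by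
        intro ω
        simp only [hQdef, centredQuad]
        rw [Finset.sum_eq_zero fun i hi => Finset.sum_eq_zero fun j hj => by rw [hz i hi j hj, zero_mul],
          Finset.sum_eq_zero fun i hi => hz i hi i hi, sub_zero]
      simp_rw [hQ0, zero_add, ← hF0', zero_add]
      exact hYm.trans hDC
    · rcases eq_or_lt_of_le hb0 with hb0' | hbpos
      · have hY0 : ∫ ω, Y ω ^ (2 * r) ∂μ = 0 := by
          refine le_antisymm (hYm.trans_eq ?_)
            (integral_nonneg fun ω => (even_two_mul r).pow_nonneg _)
          rw [← hb0', zero_pow hr, mul_zero]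
        have hYae : Y =ᵐ[μ] 0 := by
          have := (integral_eq_zero_iff_of_nonneg (fun ω => (even_two_mul r).pow_nonneg (Y ω))
            (mY.pow _).integrable).1 hY0
          filter_upwards [this] with ω hω
          exact (pow_eq_zero_iff (by omega)).1 hω
        have : ∫ ω, (Q ω + Y ω) ^ (2 * r) ∂μ = ∫ ω, Q ω ^ (2 * r) ∂μ := by
          refine integral_congr_ae ?_
          filter_upwards [hYae] with ω hω
          simp [hω]
        rw [this, ← hb0', add_zero]
        exact ih
      · have hCpos : 0 < quadConst c r := by unfold quadConst; positivity
        set a : ℝ := quadConst c r * F with ha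
        have hapos : 0 < a := by positivity
        have pt : ∀ ω, (Q ω + Y ω) ^ (2 * r) ≤ Q ω ^ (2 * r)
            + 2 * r * (Q ω ^ (2 * r - 1) * Y ω)
            + 4 ^ r * ((Q ω ^ (2 * r) * (b / a) + Y ω ^ (2 * r) * (a / b) ^ (r - 1))
              + Y ω ^ (2 * r)) := fun ω => by
          refine (add_pow_even_le (Q ω) (Y ω) hr).trans ?_
          gcongr
          exact young_pow (Q ω) (Y ω) a b hapos hbpos hr
        -- Martingale structure: given the earlier variables, the increment is a combination of `X
        -- k` and `X k ^ 2 - 1`, both of mean zero, so the first-order term disappears.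
        have hcross : ∫ ω, Q ω ^ (2 * r - 1) * Y ω ∂μ = 0 := by
          have i1 : IndepFun (fun ω => Q ω ^ (2 * r - 1) * L ω) (X k) μ := by
            rw [hQ, hLe]
            exact hpair.comp (φ := fun f : s → ℝ =>
              (∑ i : s, ∑ j : s, B i j * (f i * f j) - ∑ i ∈ s, B i i) ^ (2 * r - 1)
                * ∑ i : s, B k i * f i) (by fun_prop) measurable_id
          have i2 : IndepFun (fun ω => Q ω ^ (2 * r - 1)) (fun ω => X k ω ^ 2 - 1) μ := by
            rw [hQ]
            exact hpair.comp (φ := fun f : s → ℝ =>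
              (∑ i : s, ∑ j : s, B i j * (f i * f j) - ∑ i ∈ s, B i i) ^ (2 * r - 1))
              (ψ := fun x => x ^ 2 - 1) (by fun_prop) (by fun_prop)
          have j1 := i1.integral_fun_mul_eq_mul_integral ((mQ.pow _).mul mL).integrable.1
            mη.integrable.1
          have j2 := i2.integral_fun_mul_eq_mul_integral (mQ.pow _).integrable.1 mη1.integrable.1
          have hz : ∫ ω, (X k ω ^ 2 - 1) ∂μ = 0 := by
            rw [integral_sub (mη.pow 2).integrable (integrable_const _), h1]; simp
          rw [h0, mul_zero] at j1
          rw [hz, mul_zero] at j2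
          have : ∀ ω, Q ω ^ (2 * r - 1) * Y ω = 2 * (Q ω ^ (2 * r - 1) * L ω * X k ω)
              + B k k * (Q ω ^ (2 * r - 1) * (X k ω ^ 2 - 1)) := fun ω => by
            simp only [hY]; ring
          simp_rw [this]
          rw [integral_add ((((mQ.pow _).mul mL).mul mη).integrable.const_mul _)
            (((mQ.pow _).mul mη1).integrable.const_mul _), integral_const_mul, integral_const_mul,
            j1, j2]
          simp
        have I1 := (mQ.pow (2 * r)).integrable
        have I2 := ((mQ.pow (2 * r - 1)).mul mY).integrable
        have I3 := (mY.pow (2 * r)).integrable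
        have J1 : Integrable (fun ω => Q ω ^ (2 * r) * (b / a)) μ := I1.mul_const _
        have J2 : Integrable (fun ω => Y ω ^ (2 * r) * (a / b) ^ (r - 1)) μ := I3.mul_const _
        have J3 : Integrable (fun ω => 2 * r * (Q ω ^ (2 * r - 1) * Y ω)) μ := I2.const_mul _
        have J4 : Integrable (fun ω => Q ω ^ (2 * r) * (b / a) + Y ω ^ (2 * r) * (a / b) ^ (r - 1)) μ :=
          J1.add J2
        have J5 : Integrable (fun ω => Q ω ^ (2 * r) * (b / a) + Y ω ^ (2 * r) * (a / b) ^ (r - 1)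
          + Y ω ^ (2 * r)) μ := J4.add I3
        have J6 : Integrable (fun ω => 4 ^ r * (Q ω ^ (2 * r) * (b / a)
          + Y ω ^ (2 * r) * (a / b) ^ (r - 1) + Y ω ^ (2 * r))) μ := J5.const_mul _
        have J7 : Integrable (fun ω => Q ω ^ (2 * r) + 2 * r * (Q ω ^ (2 * r - 1) * Y ω)) μ :=
          I1.add J3
        refine (integral_mono_of_nonneg (ae_of_all _ fun ω => (even_two_mul r).pow_nonneg _)
          (J7.add J6) (ae_of_all _ pt)).trans ?_
        simp only [Pi.add_apply]
        rw [integral_add J7 J6, integral_add I1 J3, integral_const_mul, hcross, integral_const_mul,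
          integral_add J4 I3, integral_add J1 J2, integral_mul_const, integral_mul_const,
          mul_zero, add_zero]
        have hYm' : ∫ ω, Y ω ^ (2 * r) ∂μ ≤ quadIncrConst c r * b ^ r := hYm
        rw [mul_add (quadConst c r), ← ha]
        have hfin := half_add_pow_le a (quadConst c r * b) hapos.le (by positivity) hr
        refine le_trans ?_ hfin
        have hp : a ^ r = a ^ (r - 1) * a := by
          rw [← pow_succ]; congr 1; omega
        have hpb : b ^ r = b ^ (r - 1) * b := by
          rw [← pow_succ]; congr 1; omega
        have q1 : (∫ ω, Q ω ^ (2 * r) ∂μ) * (b / a) ≤ a ^ (r - 1) * b := by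
          calc (∫ ω, Q ω ^ (2 * r) ∂μ) * (b / a) ≤ a ^ r * (b / a) := by gcongr
            _ = a ^ (r - 1) * b := by rw [hp]; field_simp
        have q2 : (∫ ω, Y ω ^ (2 * r) ∂μ) * (a / b) ^ (r - 1)
            ≤ quadIncrConst c r * (a ^ (r - 1) * b) := by
          calc _ ≤ quadIncrConst c r * b ^ r * (a / b) ^ (r - 1) := by gcongr
            _ = _ := by rw [hpb, div_pow]; field_simp
        have q3 : 2 * (4 ^ r * (quadIncrConst c r * b ^ r)) ≤ (quadConst c r * b) ^ r := by
          rw [mul_pow, ← mul_assoc, ← mul_assoc]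
          gcongr
          have hq0 : 2 * 4 ^ r * quadIncrConst c r ≤ quadConst c r := by
            unfold quadConst
            have : (0 : ℝ) < 4 ^ r := by positivity
            nlinarith
          have hq2 : 1 ≤ quadConst c r := by
            unfold quadConst
            have h4 : (1 : ℝ) ≤ 4 ^ r := one_le_pow₀ (by norm_num)
            nlinarith
          exact hq0.trans (le_self_pow₀ hq2 hr)
        -- The factor 2 · 4^r (1 + `quadIncrConst`) in `quadConst` is chosen for this identity.
        have q4 : 4 ^ r * (a ^ (r - 1) * b + quadIncrConst c r * (a ^ (r - 1) * b))
            = a ^ (r - 1) * (quadConst c r * b) / 2 := by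
          unfold quadConst; ring
        have h4 : (0 : ℝ) < 4 ^ r := by positivity
        have q5 := mul_le_mul_of_nonneg_left (add_le_add (add_le_add q1 q2) hYm') h4.le
        rw [mul_add (4 ^ r : ℝ) (_ + _) (quadIncrConst c r * b ^ r), q4] at q5
        linarith [ih]

end QuadraticForms

/-! ### Exit probabilities of random walks by backward induction -/

section Chain

variable {V E : Type*} [MeasurableSpace V] [MeasurableSpace E] [AddCommMonoid E]

/-- One backward step of the random walk with increments `φ v`, `v ∼ ρ`. -/
noncomputable def walkStep (ρ : Measure V) (φ : V → E) (F : E → ENNReal) (a : E) : ENNReal :=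
  ∫⁻ v, F (a + φ v) ∂ρ

theorem measurable_walkStep [MeasurableAdd₂ E] (ρ : Measure V) [SFinite ρ] {φ : V → E}
    (hφ : Measurable φ) {F : E → ENNReal} (hF : Measurable F) : Measurable (walkStep ρ φ F) := by
  unfold walkStep
  exact Measurable.lintegral_prod_right' (f := fun p : E × V => F (p.1 + φ p.2)) (by fun_prop)

/-- The last increment is independent of the earlier sum, so integrating it out peels off one
operator. Exit probabilities can then be bounded without filtrations or conditional expectations. -/
theorem lintegral_sum_range_eq_walkStep_iterate [MeasurableAdd₂ E] {Ω : Type*} [MeasurableSpace Ω]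
    {P : Measure Ω} [IsProbabilityMeasure P] {ρ : Measure V} [IsProbabilityMeasure ρ] {φ : V → E}
    (hφ : Measurable φ)
    {X : ℕ → Ω → V} (hX : ∀ j, Measurable (X j)) (hind : iIndepFun X P)
    (hlaw : ∀ j, P.map (X j) = ρ) {F : E → ENNReal} (hF : Measurable F) (n : ℕ) :
    ∫⁻ ω, F (∑ j ∈ Finset.range n, φ (X j ω)) ∂P = (walkStep ρ φ)^[n] F 0 := by
  induction n generalizing F with
  | zero => simp
  | succ n ih =>
    rw [Function.iterate_succ_apply, ← ih (measurable_walkStep ρ hφ hF)]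
    have hY : iIndepFun (fun j ω => φ (X j ω)) P := hind.comp (fun _ => φ) (fun _ => hφ)
    have hS : Measurable (fun ω => ∑ j ∈ Finset.range n, φ (X j ω)) :=
      Finset.measurable_fun_sum _ fun j _ => hφ.comp (hX j)
    have hm : Measurable (fun ω => φ (X n ω)) := hφ.comp (hX n)
    have hi : IndepFun (fun ω => ∑ j ∈ Finset.range n, φ (X j ω)) (fun ω => φ (X n ω)) P := by
      have := hY.indepFun_sum_range_succ (fun j => hφ.comp (hX j)) n
      convert this using 1
      ext ω; simp
    have hp := (indepFun_iff_map_prod_eq_prod_map_map hS.aemeasurable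
      hm.aemeasurable).1 hi
    simp_rw [Finset.sum_range_succ]
    have e1 : ∫⁻ ω, F (∑ j ∈ Finset.range n, φ (X j ω) + φ (X n ω)) ∂P
        = ∫⁻ p : E × E, F (p.1 + p.2) ∂(P.map
          (fun ω => (∑ j ∈ Finset.range n, φ (X j ω), φ (X n ω)))) := by
      rw [lintegral_map (by fun_prop) (hS.prodMk hm)]
    have hφX : P.map (fun ω => φ (X n ω)) = ρ.map φ := by
      rw [← hlaw n, Measure.map_map hφ (hX n)]; rfl
    have : SFinite (P.map (fun ω => φ (X n ω))) := by
      have := Measure.isProbabilityMeasure_map (μ := P) hm.aemeasurable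
      infer_instance
    rw [e1, hp, lintegral_prod _ (by fun_prop), lintegral_map _ hS]
    · refine lintegral_congr fun ω => ?_
      rw [hφX, lintegral_map (by fun_prop) hφ]; rfl
    · exact Measurable.lintegral_prod_right' (f := fun p : E × E => F (p.1 + p.2)) (by fun_prop)

omit [MeasurableSpace E] in
/-- Exit probability of a random walk from a time-dependent domain, controlled by a Lyapunov
function and by the probability of a bad increment. -/
theorem walkStep_iterate_indicator_le {ρ : Measure V} [IsProbabilityMeasure ρ]
    {φ : V → E} (S : ℕ → Set E) (W : ℕ → E → ENNReal) (n : ℕ) (e T : ENNReal) (hT0 : T ≠ 0)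
    (hT : T ≠ ⊤)
    (hstep : ∀ k < n, ∀ A ∈ S k, ∃ (bad : Set V) (U : V → ENNReal), MeasurableSet bad ∧
      Measurable U ∧ ρ bad ≤ e ∧
      (∀ v ∉ bad, A + φ v ∈ S (k + 1) ∨ T ≤ W (k + 1) (A + φ v)) ∧
      (∀ v ∉ bad, W (k + 1) (A + φ v) ≤ U v) ∧ ∫⁻ v, U v ∂ρ ≤ W k A)
    (A : E) (hA : A ∈ S 0) :
    (walkStep ρ φ)^[n] ((S n)ᶜ.indicator 1) A ≤ n * (e + W 0 A / T) := by
  have hle1 : ∀ j B, (walkStep ρ φ)^[j] ((S n)ᶜ.indicator 1) B ≤ 1 := by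
    intro j
    induction j with
    | zero => intro B; exact Set.indicator_le_self' (by simp) B
    | succ j ih =>
      intro B
      rw [Function.iterate_succ_apply']
      unfold walkStep
      calc _ ≤ ∫⁻ _, 1 ∂ρ := lintegral_mono fun v => ih _
        _ = 1 := by simp
  -- Induction on the number j of remaining steps. A good increment that leaves the domain has W ≥
  -- T, so the trivial bound 1 is at most U/T; this is Markov's inequality. The factor j in front of
  -- W/T is wasteful but harmless.
  have main : ∀ j ≤ n, ∀ B ∈ S (n - j), (walkStep ρ φ)^[j] ((S n)ᶜ.indicator 1) B
      ≤ j * (e + W (n - j) B / T) := by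
    intro j
    induction j with
    | zero =>
      intro _ B hB
      simp only [Nat.sub_zero] at hB
      simp [hB]
    | succ j ih =>
      intro hj B hB
      obtain ⟨bad, U, hbm, hU, hbad, hdich, hWU, hint⟩ := hstep (n - (j + 1)) (by omega) B hB
      have ek : n - (j + 1) + 1 = n - j := by omega
      rw [ek] at hdich hWU
      rw [Function.iterate_succ_apply']
      have pt : ∀ v, (walkStep ρ φ)^[j] ((S n)ᶜ.indicator 1) (B + φ v)
          ≤ bad.indicator 1 v + (j * e + (j + 1) * (U v / T)) := by
        intro v
        by_cases hv : v ∈ bad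
        · refine (hle1 _ _).trans ?_
          simp [hv]
        · have hW : W (n - j) (B + φ v) / T ≤ U v / T := ENNReal.div_le_div_right (hWU v hv) T
          simp only [hv, not_false_eq_true, Set.indicator_of_notMem, zero_add]
          rcases hdich v hv with h | h
          · refine (ih (by omega) _ h).trans ?_
            rw [mul_add]
            gcongr
            exact le_self_add
          · refine (hle1 _ _).trans ?_
            have : 1 ≤ U v / T := by
              refine le_trans ?_ hW
              rw [ENNReal.le_div_iff_mul_le (Or.inl hT0) (Or.inl hT), one_mul]
              exact h
            calc (1 : ENNReal) ≤ U v / T := this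
              _ = 1 * (U v / T) := (one_mul _).symm
              _ ≤ (j + 1) * (U v / T) := by gcongr; exact le_add_self
              _ ≤ _ := le_add_self
      unfold walkStep at pt ⊢
      refine (lintegral_mono pt).trans ?_
      rw [lintegral_add_left (measurable_one.indicator hbm), lintegral_add_left measurable_const,
        lintegral_indicator_one hbm, lintegral_const, measure_univ, mul_one,
        lintegral_const_mul _ (hU.div_const T)]
      simp_rw [div_eq_mul_inv]
      rw [lintegral_mul_const _ hU]
      calc _ ≤ e + (j * e + (j + 1) * (W (n - (j + 1)) B * T⁻¹)) := by gcongr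
        _ = _ := by push_cast; ring
  have := main n le_rfl A (by simpa using hA)
  simpa using this

end Chain

/-! ### Quadratic forms of a random column: concentration and mean -/

section Columns

variable {ν : Measure ℝ} [IsProbabilityMeasure ν] {c : NNReal}

/-- A standardised sub-Gaussian law on the real line. -/
structure IsStdSubgaussian (ν : Measure ℝ) (c : NNReal) : Prop where
  subg : HasSubgaussianMGF (fun x : ℝ => x) c ν
  mean : ∫ x, x ∂ν = 0
  var : ∫ x, x ^ 2 ∂ν = 1

open Matrix

theorem iIndepFun_eval_pi (n : ℕ) :
    iIndepFun (fun (i : Fin n) (v : Fin n → ℝ) => v i) (Measure.pi fun _ : Fin n => ν) :=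
  iIndepFun_pi (μ := fun _ : Fin n => ν) (X := fun _ x => x) fun _ => aemeasurable_id

theorem integral_comp_eval_pi (n : ℕ) (i : Fin n) {g : ℝ → ℝ} (hg : Measurable g) :
    ∫ v : Fin n → ℝ, g (v i) ∂(Measure.pi fun _ : Fin n => ν) = ∫ x, g x ∂ν := by
  have := (measurePreserving_eval (fun _ : Fin n => ν) i)
  have h := integral_map (μ := Measure.pi fun _ : Fin n => ν) this.measurable.aemeasurable
    (f := g) hg.aestronglyMeasurable
  rw [this.map_eq] at h
  exact h.symm

theorem IsStdSubgaussian.subg_eval (h : IsStdSubgaussian ν c) (n : ℕ) (i : Fin n) :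
    HasSubgaussianMGF (fun v : Fin n → ℝ => v i) c (Measure.pi fun _ : Fin n => ν) := by
  have hp := (measurePreserving_eval (fun _ : Fin n => ν) i)
  refine HasSubgaussianMGF.of_map (X := fun x : ℝ => x) hp.measurable.aemeasurable ?_
  rw [hp.map_eq]; exact h.subg

theorem dotProduct_mulVec_sub_trace_eq {n : ℕ} (B : Matrix (Fin n) (Fin n) ℝ) (v : Fin n → ℝ) :
    v ⬝ᵥ B *ᵥ v - B.trace =
      centredQuad (fun i j => B i j) (fun i (v : Fin n → ℝ) => v i) Finset.univ v := by
  simp only [centredQuad, dotProduct, mulVec, Finset.mul_sum, trace, diag]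
  congr 1
  exact Finset.sum_congr rfl fun i _ => Finset.sum_congr rfl fun j _ => by ring

/-- Concentration of quadratic forms in vectors with independent standardised sub-Gaussian
coordinates. -/
theorem IsStdSubgaussian.measure_quadForm_le (h : IsStdSubgaussian ν c) {n : ℕ}
    {B : Matrix (Fin n) (Fin n) ℝ} (hB : B.IsSymm) {r : ℕ} (hr : r ≠ 0) {t : ℝ} (ht : 0 < t) :
    (Measure.pi fun _ : Fin n => ν) {v | t ≤ |v ⬝ᵥ B *ᵥ v - B.trace|} ≤
      ENNReal.ofReal ((quadConst c r * ∑ i, ∑ j, B i j ^ 2) ^ r / t ^ (2 * r)) := by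
  set μ := (Measure.pi fun _ : Fin n => ν)
  have hm := integral_pow_centredQuad_le (μ := μ) (B := fun i j => B i j)
    (fun i j => (hB.apply i j).symm) (X := fun (i : Fin n) v => v i) (fun i => by fun_prop)
    (iIndepFun_eval_pi n) (h.subg_eval n)
    (fun i => (integral_comp_eval_pi n i (g := fun x => x) measurable_id).trans h.mean)
    (fun i => (integral_comp_eval_pi n i (g := fun x => x ^ 2) (by fun_prop)).trans h.var) hr
    Finset.univ
  have hI := ((hasAllMoments_centredQuad (μ := μ) (fun i j => B i j) (h.subg_eval n)
    Finset.univ).pow (2 * r)).integrable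
  have hmk := mul_meas_ge_le_integral_of_nonneg
    (ae_of_all _ fun ω => (even_two_mul r).pow_nonneg _) hI (t ^ (2 * r))
  have htp : 0 < t ^ (2 * r) := by positivity
  have hsub : {v | t ≤ |v ⬝ᵥ B *ᵥ v - B.trace|} ⊆ {v | t ^ (2 * r) ≤
      centredQuad (fun i j => B i j) (fun i (v : Fin n → ℝ) => v i) Finset.univ v ^ (2 * r)} := by
    intro v hv
    simp only [Set.mem_ofPred_eq, dotProduct_mulVec_sub_trace_eq] at hv ⊢
    rw [← (even_two_mul r).pow_abs (centredQuad _ _ _ _)]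
    exact pow_le_pow_left₀ ht.le hv _
  refine (measure_mono hsub).trans ?_
  rw [ENNReal.le_ofReal_iff_toReal_le (measure_ne_top _ _) (by
    have := quadConst_nonneg c r
    have : 0 ≤ ∑ i, ∑ j, B i j ^ 2 :=
      Finset.sum_nonneg fun i _ => Finset.sum_nonneg fun j _ => sq_nonneg _
    positivity), le_div_iff₀' htp]
  exact hmk.trans hm

theorem IsStdSubgaussian.integral_quadForm (h : IsStdSubgaussian ν c) {n : ℕ}
    (B : Matrix (Fin n) (Fin n) ℝ) :
    Integrable (fun v => v ⬝ᵥ B *ᵥ v) (Measure.pi fun _ : Fin n => ν) ∧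
    ∫ v, v ⬝ᵥ B *ᵥ v ∂(Measure.pi fun _ : Fin n => ν) = B.trace := by
  set μ := (Measure.pi fun _ : Fin n => ν)
  have ma := fun i => (h.subg_eval n i).hasAllMoments
  have hI : ∀ i j : Fin n, Integrable (fun v : Fin n → ℝ => v i * (B i j * v j)) μ := fun i j =>
    ((ma i).mul ((HasAllMoments.const _).mul (ma j))).integrable
  have hE : ∀ i j : Fin n, ∫ v : Fin n → ℝ, v i * (B i j * v j) ∂μ = if i = j then B i i else 0 := by
    intro i j
    split_ifs with hij
    · subst hij
      have e : ∀ v : Fin n → ℝ, v i * (B i i * v i) = B i i * v i ^ 2 := fun v => by ring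
      simp_rw [e]
      rw [integral_const_mul, integral_comp_eval_pi n i (g := fun x => x ^ 2) (by fun_prop), h.var,
        mul_one]
    · have e : ∀ v : Fin n → ℝ, v i * (B i j * v j) = B i j * (v i * v j) := fun v => by ring
      simp_rw [e]
      rw [integral_const_mul, ((iIndepFun_eval_pi n).indepFun hij).integral_fun_mul_eq_mul_integral
        (ma i).integrable.1 (ma j).integrable.1,
        integral_comp_eval_pi n i (g := fun x => x) measurable_id, h.mean]
      simp
  simp only [dotProduct, mulVec, Finset.mul_sum, trace, diag]
  refine ⟨integrable_finsetSum _ fun i _ => integrable_finsetSum _ fun j _ => hI i j, ?_⟩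
  rw [integral_finsetSum _ fun i _ => integrable_finsetSum _ fun j _ => hI i j]
  refine Finset.sum_congr rfl fun i _ => ?_
  rw [integral_finsetSum _ fun j _ => hI i j]
  simp_rw [hE]
  simp

end Columns

/-! ### Diagonalisation, trace inequalities and rank one updates -/

section LinearAlgebra

open Matrix

variable {n : ℕ}

theorem Matrix.IsHermitian.exists_orthogonal_diagonal {A : Matrix (Fin n) (Fin n) ℝ}
    (hA : A.IsHermitian) : ∃ (U : Matrix (Fin n) (Fin n) ℝ) (l : Fin n → ℝ),
      Uᵀ * U = 1 ∧ U * Uᵀ = 1 ∧ A = U * diagonal l * Uᵀ := by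
  refine ⟨(hA.eigenvectorUnitary : Matrix _ _ ℝ), hA.eigenvalues, ?_, ?_, ?_⟩
  · exact Unitary.coe_star_mul_self hA.eigenvectorUnitary
  · exact Unitary.coe_mul_star_self hA.eigenvectorUnitary
  · conv_lhs => rw [hA.spectral_theorem]
    rw [Unitary.conjStarAlgAut_apply]
    rfl

section Diagonalised

variable {U : Matrix (Fin n) (Fin n) ℝ}

theorem conj_diagonal_pow (h1 : Uᵀ * U = 1) (h2 : U * Uᵀ = 1) (d : Fin n → ℝ) (a : ℕ) :
    (U * diagonal d * Uᵀ) ^ a = U * diagonal (fun i => d i ^ a) * Uᵀ := by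
  induction a with
  | zero => simp [h2]
  | succ a ih =>
    rw [pow_succ, ih]
    calc U * diagonal (fun i => d i ^ a) * Uᵀ * (U * diagonal d * Uᵀ)
        = U * diagonal (fun i => d i ^ a) * (Uᵀ * U) * diagonal d * Uᵀ := by
          simp only [Matrix.mul_assoc]
      _ = _ := by
          rw [h1, Matrix.mul_one, Matrix.mul_assoc U, diagonal_mul_diagonal]
          simp only [pow_succ]

theorem trace_conj_diagonal (h1 : Uᵀ * U = 1) (d : Fin n → ℝ) :
    (U * diagonal d * Uᵀ).trace = ∑ i, d i := by
  rw [Matrix.trace_mul_comm, ← Matrix.mul_assoc, h1, Matrix.one_mul, trace_diagonal]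

theorem quadForm_conj_diagonal (d v : Fin n → ℝ) :
    v ⬝ᵥ (U * diagonal d * Uᵀ) *ᵥ v = ∑ i, d i * (Uᵀ *ᵥ v) i ^ 2 := by
  rw [← mulVec_mulVec, ← mulVec_mulVec, dotProduct_mulVec, ← mulVec_transpose]
  simp only [dotProduct, mulVec_diagonal]
  exact Finset.sum_congr rfl fun i _ => by ring

theorem smul_one_sub_conj_diagonal (h2 : U * Uᵀ = 1) (d : Fin n → ℝ) (u : ℝ) :
    u • (1 : Matrix (Fin n) (Fin n) ℝ) - U * diagonal d * Uᵀ
      = U * diagonal (fun i => u - d i) * Uᵀ := by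
  have : diagonal (fun i => u - d i) = u • (1 : Matrix (Fin n) (Fin n) ℝ) - diagonal d := by
    rw [← diagonal_one, ← diagonal_smul, diagonal_sub]
    simp
  rw [this, Matrix.mul_sub, Matrix.sub_mul]
  simp [h2]

theorem det_conj_diagonal (h2 : U * Uᵀ = 1) (d : Fin n → ℝ) :
    (U * diagonal d * Uᵀ).det = ∏ i, d i := by
  rw [det_mul, det_mul, det_diagonal, mul_right_comm, ← det_mul, h2, det_one, one_mul]

theorem inv_conj_diagonal (h1 : Uᵀ * U = 1) (h2 : U * Uᵀ = 1) {d : Fin n → ℝ}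
    (hd : ∀ i, d i ≠ 0) :
    (U * diagonal d * Uᵀ)⁻¹ = U * diagonal (fun i => (d i)⁻¹) * Uᵀ := by
  apply inv_eq_right_inv
  calc U * diagonal d * Uᵀ * (U * diagonal (fun i => (d i)⁻¹) * Uᵀ)
      = U * diagonal d * (Uᵀ * U) * diagonal (fun i => (d i)⁻¹) * Uᵀ := by
        simp only [Matrix.mul_assoc]
    _ = 1 := by
        rw [h1, Matrix.mul_one, Matrix.mul_assoc U, diagonal_mul_diagonal]
        simp [mul_inv_cancel₀ (hd _), h2]

theorem isHermitian_conj_diagonal (d : Fin n → ℝ) : (U * diagonal d * Uᵀ).IsHermitian := by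
  rw [IsHermitian, conjTranspose_eq_transpose_of_trivial]
  simp [Matrix.mul_assoc]

theorem posSemidef_conj_diagonal_iff (h2 : U * Uᵀ = 1) (d : Fin n → ℝ) :
    (U * diagonal d * Uᵀ).PosSemidef ↔ ∀ i, 0 ≤ d i := by
  have hu : IsUnit U := IsUnit.of_mul_eq_one Uᵀ h2
  have := hu.posSemidef_star_right_conjugate_iff (x := diagonal d)
  rw [star_eq_conjTranspose, conjTranspose_eq_transpose_of_trivial] at this
  rw [this, posSemidef_diagonal_iff]

theorem posDef_conj_diagonal_iff (h2 : U * Uᵀ = 1) (d : Fin n → ℝ) :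
    (U * diagonal d * Uᵀ).PosDef ↔ ∀ i, 0 < d i := by
  have hu : IsUnit U := IsUnit.of_mul_eq_one Uᵀ h2
  have := hu.posDef_star_right_conjugate_iff (x := diagonal d)
  rw [star_eq_conjTranspose, conjTranspose_eq_transpose_of_trivial] at this
  rw [this, posDef_diagonal_iff]

end Diagonalised

/-- Chebyshev's association inequality: μᵢ^a - μⱼ^a and μᵢ^b - μⱼ^b have the same sign, and the
weighted double sum of their products expands into twice the difference of the two sides. -/
theorem sum_mul_pow_log_convex {ι : Type*} (s : Finset ι) {w μ : ι → ℝ} (hw : ∀ i, 0 ≤ w i)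
    (hμ : ∀ i, 0 ≤ μ i) (a b k : ℕ) :
    (∑ i ∈ s, μ i ^ (a + k) * w i) * (∑ i ∈ s, μ i ^ (b + k) * w i) ≤
      (∑ i ∈ s, μ i ^ k * w i) * (∑ i ∈ s, μ i ^ (a + b + k) * w i) := by
  have key : 0 ≤ ∑ i ∈ s, ∑ j ∈ s, w i * w j * (μ i ^ k * μ j ^ k) *
      ((μ i ^ a - μ j ^ a) * (μ i ^ b - μ j ^ b)) := by
    refine Finset.sum_nonneg fun i _ => Finset.sum_nonneg fun j _ => ?_
    have hi := hw i; have hj := hw j; have hmi := hμ i; have hmj := hμ j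
    refine mul_nonneg (by positivity) ?_
    rcases le_total (μ i) (μ j) with h | h
    · exact mul_nonneg_of_nonpos_of_nonpos (sub_nonpos.2 (by gcongr)) (sub_nonpos.2 (by gcongr))
    · exact mul_nonneg (sub_nonneg.2 (by gcongr)) (sub_nonneg.2 (by gcongr))
  have e : ∀ i j, w i * w j * (μ i ^ k * μ j ^ k) * ((μ i ^ a - μ j ^ a) * (μ i ^ b - μ j ^ b))
      = (μ i ^ (a + b + k) * w i) * (μ j ^ k * w j) + (μ i ^ k * w i) * (μ j ^ (a + b + k) * w j)
        - (μ i ^ (a + k) * w i) * (μ j ^ (b + k) * w j)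
        - (μ i ^ (b + k) * w i) * (μ j ^ (a + k) * w j) := by
    intro i j; simp only [pow_add]; ring
  simp_rw [e, Finset.sum_sub_distrib, Finset.sum_add_distrib, ← Finset.mul_sum,
    ← Finset.sum_mul] at key
  nlinarith [key]

theorem Matrix.PosSemidef.quadForm_pow_log_convex {R : Matrix (Fin n) (Fin n) ℝ}
    (hR : R.PosSemidef) (v : Fin n → ℝ) (a b k : ℕ) :
    (v ⬝ᵥ (R ^ (a + k)) *ᵥ v) * (v ⬝ᵥ (R ^ (b + k)) *ᵥ v) ≤
      (v ⬝ᵥ (R ^ k) *ᵥ v) * (v ⬝ᵥ (R ^ (a + b + k)) *ᵥ v) := by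
  obtain ⟨U, l, h1, h2, rfl⟩ := hR.1.exists_orthogonal_diagonal
  have hl := (posSemidef_conj_diagonal_iff h2 l).1 hR
  simp only [conj_diagonal_pow h1 h2, quadForm_conj_diagonal]
  exact sum_mul_pow_log_convex _ (fun i => sq_nonneg _) hl a b k

theorem Matrix.PosSemidef.quadForm_pow_nonneg {R : Matrix (Fin n) (Fin n) ℝ}
    (hR : R.PosSemidef) (v : Fin n → ℝ) (a : ℕ) : 0 ≤ v ⬝ᵥ (R ^ a) *ᵥ v := by
  simpa using (hR.pow a).dotProduct_mulVec_nonneg v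

section RankOne

variable {C : Matrix (Fin n) (Fin n) ℝ} {v : Fin n → ℝ}

/-- The Sherman–Morrison formula. -/
theorem inv_sub_vecMulVec (hC : IsUnit C.det) (hs : Cᵀ = C) (h : 1 - v ⬝ᵥ C⁻¹ *ᵥ v ≠ 0) :
    (C - vecMulVec v v)⁻¹ =
      C⁻¹ + (1 - v ⬝ᵥ C⁻¹ *ᵥ v)⁻¹ • vecMulVec (C⁻¹ *ᵥ v) (C⁻¹ *ᵥ v) := by
  apply inv_eq_right_inv
  have hi : C * C⁻¹ = 1 := mul_nonsing_inv C hC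
  have hsi : (C⁻¹)ᵀ = C⁻¹ := by rw [transpose_nonsing_inv, hs]
  have hv : v ᵥ* C⁻¹ = C⁻¹ *ᵥ v := by rw [← mulVec_transpose, hsi]
  rw [Matrix.sub_mul, Matrix.mul_add, Matrix.mul_add, hi, Matrix.mul_smul, mul_vecMulVec,
    mulVec_mulVec, hi, one_mulVec, vecMulVec_mul, hv, Matrix.mul_smul, vecMulVec_mul_vecMulVec]
  have : vecMulVec v ((v ⬝ᵥ C⁻¹ *ᵥ v) • (C⁻¹ *ᵥ v)) =
      (v ⬝ᵥ C⁻¹ *ᵥ v) • vecMulVec v (C⁻¹ *ᵥ v) := by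
    ext i j; simp [vecMulVec_apply]; ring
  rw [this, smul_smul]
  have e : ∀ Y : Matrix (Fin n) (Fin n) ℝ, (1 - v ⬝ᵥ C⁻¹ *ᵥ v)⁻¹ • Y - (Y +
      ((1 - v ⬝ᵥ C⁻¹ *ᵥ v)⁻¹ * (v ⬝ᵥ C⁻¹ *ᵥ v)) • Y) = 0 := by
    intro Y
    rw [← sub_sub, sub_right_comm, ← sub_smul]
    nth_rewrite 2 [← one_smul ℝ Y]
    rw [← sub_smul]
    have : (1 - v ⬝ᵥ C⁻¹ *ᵥ v)⁻¹ - (1 - v ⬝ᵥ C⁻¹ *ᵥ v)⁻¹ * (v ⬝ᵥ C⁻¹ *ᵥ v) - 1 = 0 := by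
      field_simp; ring
    rw [this, zero_smul]
  rw [add_sub_assoc, e, add_zero]

theorem quad_vecMulVec (x y a b : Fin n → ℝ) :
    x ⬝ᵥ vecMulVec a b *ᵥ y = (x ⬝ᵥ a) * (b ⬝ᵥ y) := by
  rw [vecMulVec_mulVec]
  simp only [dotProduct, Pi.smul_apply, MulOpposite.smul_eq_mul_unop, MulOpposite.unop_op]
  rw [Finset.sum_mul]
  exact Finset.sum_congr rfl fun i _ => by ring

/-- The matrix determinant lemma. -/
theorem det_sub_vecMulVec (hC : IsUnit C.det) :
    (C - vecMulVec v v).det = C.det * (1 - v ⬝ᵥ C⁻¹ *ᵥ v) := by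
  have hi : C * C⁻¹ = 1 := mul_nonsing_inv C hC
  have e : C - vecMulVec v v = C * (1 + replicateCol Unit (-(C⁻¹ *ᵥ v)) * replicateRow Unit v) := by
    rw [Matrix.mul_add, Matrix.mul_one, ← vecMulVec_eq, mul_vecMulVec, mulVec_neg, mulVec_mulVec,
      hi, one_mulVec, neg_vecMulVec, sub_eq_add_neg]
  rw [e, det_mul, det_one_add_mul_comm]
  congr 1
  rw [det_unique]
  simp [Matrix.mul_apply, replicateRow, replicateCol, dotProduct, sub_eq_add_neg,
    Finset.sum_neg_distrib]

/-- Cauchy–Schwarz in the eigenbasis gives (v·x)² ≤ (vᵀC⁻¹v)(xᵀCx). This is why no eigenvalue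
crosses the barrier as long as vᵀRv < 1. -/
theorem Matrix.PosDef.sub_vecMulVec (hC : C.PosDef) (h : v ⬝ᵥ C⁻¹ *ᵥ v < 1) :
    (C - vecMulVec v v).PosDef := by
  obtain ⟨U, l, h1, h2, rfl⟩ := hC.1.exists_orthogonal_diagonal
  have hl := (posDef_conj_diagonal_iff h2 l).1 hC
  rw [inv_conj_diagonal h1 h2 (fun i => (hl i).ne'), quadForm_conj_diagonal] at h
  refine PosDef.of_dotProduct_mulVec_pos (hC.1.sub ?_) fun {x} hx => ?_
  · ext i j; simp [vecMulVec_apply, mul_comm]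
  have hpos := hC.dotProduct_mulVec_pos hx
  simp only [star_trivial] at hpos ⊢
  rw [Matrix.sub_mulVec, dotProduct_sub, quad_vecMulVec, dotProduct_comm x v, ← sq]
  rw [quadForm_conj_diagonal] at hpos ⊢
  have e2 : v ⬝ᵥ x = (Uᵀ *ᵥ v) ⬝ᵥ (Uᵀ *ᵥ x) := by
    rw [dotProduct_mulVec, ← mulVec_transpose, transpose_transpose, mulVec_mulVec, h2, one_mulVec]
  have cs := Finset.sum_mul_sq_le_sq_mul_sq Finset.univ
    (fun i => (Uᵀ *ᵥ v) i / √(l i)) (fun i => √(l i) * (Uᵀ *ᵥ x) i)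
  have e3 : ∀ i, (Uᵀ *ᵥ v) i / √(l i) * (√(l i) * (Uᵀ *ᵥ x) i) = (Uᵀ *ᵥ v) i * (Uᵀ *ᵥ x) i := by
    intro i
    have := Real.sqrt_pos.2 (hl i)
    field_simp
  have e4 : ∀ i, ((Uᵀ *ᵥ v) i / √(l i)) ^ 2 = (l i)⁻¹ * (Uᵀ *ᵥ v) i ^ 2 := by
    intro i; rw [div_pow, Real.sq_sqrt (hl i).le]; ring
  have e5 : ∀ i, (√(l i) * (Uᵀ *ᵥ x) i) ^ 2 = l i * (Uᵀ *ᵥ x) i ^ 2 := by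
    intro i; rw [mul_pow, Real.sq_sqrt (hl i).le]
  simp_rw [e3, e4, e5] at cs
  rw [e2]
  change _ < _ - (∑ i, (Uᵀ *ᵥ v) i * (Uᵀ *ᵥ x) i) ^ 2
  nlinarith

/-- Growth of trace powers of the inverse under a rank-one perturbation. -/
theorem trace_pow_rankOne_le {R B : Matrix (Fin n) (Fin n) ℝ} (hR : R.PosSemidef) {c : ℝ}
    (hc : 0 ≤ c) (hB : B = R + c • vecMulVec (R *ᵥ v) (R *ᵥ v)) (h1 : v ⬝ᵥ R *ᵥ v ≤ 1) (q : ℕ) :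
    (B ^ q).trace ≤ (R ^ q).trace + c * q * (v ⬝ᵥ (R ^ (q + 1)) *ᵥ v
      + (1 + c) ^ q * ((v ⬝ᵥ (R ^ 2) *ᵥ v) * (v ⬝ᵥ (R ^ q) *ᵥ v))) := by
  set h : ℕ → ℝ := fun a => v ⬝ᵥ (R ^ a) *ᵥ v with hh
  have hh0 : ∀ a, 0 ≤ h a := fun a => hR.quadForm_pow_nonneg v a
  have hRt : Rᵀ = R := by
    have := hR.1; rwa [IsHermitian, conjTranspose_eq_transpose_of_trivial] at this
  -- The power B^q is turned into R^q one factor at a time; the values of t are the corrections left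
  -- by the replacements.
  set t : ℕ → ℕ → ℝ := fun i l => v ⬝ᵥ (R ^ l * B ^ i) *ᵥ (R *ᵥ v) with ht
  have t0 : ∀ l, t 0 l = h (l + 1) := by
    intro l; simp only [ht, hh, pow_zero, Matrix.mul_one, mulVec_mulVec, pow_succ]
  have ts : ∀ i l, t (i + 1) l = t i (l + 1) + c * (h (l + 1) * t i 1) := by
    intro i l
    have e : R ^ l * B ^ (i + 1) = R ^ (l + 1) * B ^ i +
        c • vecMulVec ((R ^ (l + 1)) *ᵥ v) ((R *ᵥ v) ᵥ* (B ^ i)) := by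
      rw [pow_succ' B, hB, Matrix.add_mul, Matrix.mul_add, ← hB, ← Matrix.mul_assoc, ← pow_succ,
        Matrix.smul_mul, Matrix.mul_smul, vecMulVec_mul, mul_vecMulVec, mulVec_mulVec, ← pow_succ]
    simp only [ht]
    rw [e, Matrix.add_mulVec, dotProduct_add, Matrix.smul_mulVec, dotProduct_smul, smul_eq_mul,
      quad_vecMulVec, hh]
    congr 3
    rw [pow_one, dotProduct_mulVec v, ← vecMul_vecMul, ← mulVec_transpose R, hRt]
  have hconv2 : ∀ i l, h (l + 2) * h (i + 2) ≤ h 2 * h (l + i + 2) := fun i l =>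
    hR.quadForm_pow_log_convex v l i 2
  have hconv1 : ∀ i l, h (l + 1) * h (i + 1) ≤ h (l + i + 1) := fun i l => by
    have h3 := hR.quadForm_pow_log_convex v l i 1
    have h4 : h 1 * h (l + i + 1) ≤ 1 * h (l + i + 1) := by
      gcongr
      · exact hh0 _
      · simpa [hh] using h1
    rw [one_mul] at h4
    exact h3.trans h4
  -- Log-convexity and h 1 ≤ 1 bring all nested products to the form h 2 · h(·). The leading term
  -- keeps coefficient one because the motion of the barrier has to pay for it; the rest carries the
  -- factor h 2, which the decrease of the Stieltjes transform will pay for.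
  have tb : ∀ i l, t i (l + 1) ≤ h (l + i + 2) + ((1 + c) ^ i - 1) * (h 2 * h (l + i + 1)) := by
    intro i
    induction i with
    | zero => intro l; rw [t0]; simp
    | succ i ih =>
      intro l
      rw [ts]
      have a1 := ih (l + 1)
      have a2 := ih 0
      have b1 := hconv2 i l
      have b2 := hconv1 i (l + 1)
      have hK : 0 ≤ (1 + c) ^ i - 1 := sub_nonneg.2 (one_le_pow₀ (by linarith))
      have a3 : h (l + 1 + 1) * t i (0 + 1) ≤ h (l + 2) * h (i + 2) +
          ((1 + c) ^ i - 1) * (h 2 * (h (l + 1 + 1) * h (i + 1))) := by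
        refine (mul_le_mul_of_nonneg_left a2 (hh0 _)).trans_eq ?_
        rw [Nat.zero_add]; ring
      have a4 : h (l + 1 + 1) * t i (0 + 1) ≤ h 2 * h (l + i + 2) +
          ((1 + c) ^ i - 1) * (h 2 * h (l + 1 + i + 1)) := by
        refine a3.trans ?_
        have := hh0 2
        gcongr
      have e1 : l + 1 + i + 1 = l + i + 2 := by ring
      have e2 : l + 1 + i + 2 = l + (i + 1) + 2 := by ring
      have e3 : l + (i + 1) + 1 = l + i + 2 := by ring
      rw [e1] at a1 a4
      rw [e2] at a1
      rw [e3]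
      have a5 := mul_le_mul_of_nonneg_left a4 hc
      rw [zero_add] at a5
      rw [pow_succ]
      nlinarith [a5, a1]
  have tr : ∀ i j, (B ^ (i + 1) * R ^ j).trace = (B ^ i * R ^ (j + 1)).trace + c * t i (j + 1) := by
    intro i j
    have e : B ^ (i + 1) * R ^ j = B ^ i * R ^ (j + 1) +
        c • vecMulVec ((B ^ i) *ᵥ (R *ᵥ v)) ((R *ᵥ v) ᵥ* (R ^ j)) := by
      rw [pow_succ B, Matrix.mul_assoc]
      nth_rewrite 2 [hB]
      rw [Matrix.add_mul, Matrix.mul_add, ← pow_succ', Matrix.smul_mul, Matrix.mul_smul,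
        vecMulVec_mul, mul_vecMulVec]
    rw [e, trace_add, trace_smul, trace_vecMulVec, smul_eq_mul, ht]
    congr 2
    change _ = v ⬝ᵥ (R ^ (j + 1) * B ^ i) *ᵥ (R *ᵥ v)
    rw [dotProduct_comm, pow_succ', dotProduct_mulVec v, ← vecMul_vecMul, ← vecMul_vecMul,
      ← mulVec_transpose R v, hRt, dotProduct_mulVec]
  have main : ∀ i ≤ q, (B ^ i * R ^ (q - i)).trace ≤ (R ^ q).trace + c * i * (h (q + 1) +
      (1 + c) ^ q * (h 2 * h q)) := by
    intro i
    induction i with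
    | zero => intro _; simp
    | succ i ih =>
      intro hi
      have e : q - i = q - (i + 1) + 1 := by omega
      rw [tr]
      have a1 := ih (by omega)
      rw [e] at a1
      have a2 := tb i (q - (i + 1))
      have e1 : q - (i + 1) + i + 2 = q + 1 := by omega
      have e2 : q - (i + 1) + i + 1 = q := by omega
      rw [e1, e2] at a2
      have hp : (1 + c) ^ i - 1 ≤ (1 + c) ^ q := by
        have := pow_le_pow_right₀ (a := 1 + c) (by linarith) (show i ≤ q by omega)
        linarith
      have a3 : t i (q - (i + 1) + 1) ≤ h (q + 1) + (1 + c) ^ q * (h 2 * h q) := by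
        refine a2.trans ?_
        have := hh0 2
        have := hh0 q
        gcongr
      have a4 := mul_le_mul_of_nonneg_left a3 hc
      push_cast
      nlinarith
  simpa using main q le_rfl

end RankOne

end LinearAlgebra

/-! ### Resolvent traces and logarithmic determinants under shifts and updates -/

section Resolvent

open Matrix

variable {n : ℕ}

/-- The resolvent of a real matrix. -/
noncomputable def resolv (u : ℝ) (A : Matrix (Fin n) (Fin n) ℝ) : Matrix (Fin n) (Fin n) ℝ :=
  (u • (1 : Matrix (Fin n) (Fin n) ℝ) - A)⁻¹

/-- Traces of powers of the resolvent. -/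
noncomputable def resTrace (u : ℝ) (A : Matrix (Fin n) (Fin n) ℝ) (a : ℕ) : ℝ :=
  ((resolv u A) ^ a).trace

/-- The shifted matrix `u - A` whose inverse is the resolvent. -/
def shiftMat (u : ℝ) (A : Matrix (Fin n) (Fin n) ℝ) : Matrix (Fin n) (Fin n) ℝ :=
  u • (1 : Matrix (Fin n) (Fin n) ℝ) - A

variable {A : Matrix (Fin n) (Fin n) ℝ} {u δ g : ℝ}

theorem shiftMat_isHermitian (hA : A.IsHermitian) (u : ℝ) : (shiftMat u A).IsHermitian := by
  unfold shiftMat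
  exact ((isHermitian_one).smul (by simp [IsSelfAdjoint])).sub hA

/-- Diagonal form of all resolvents of a symmetric matrix. -/
theorem Matrix.IsHermitian.exists_resolvent_diagonal (hA : A.IsHermitian) :
    ∃ (U : Matrix (Fin n) (Fin n) ℝ) (l : Fin n → ℝ), Uᵀ * U = 1 ∧ U * Uᵀ = 1 ∧
      A = U * diagonal l * Uᵀ ∧
      (∀ u, (shiftMat u A).PosDef ↔ ∀ i, l i < u) ∧
      (∀ u, (shiftMat u A).PosSemidef ↔ ∀ i, l i ≤ u) ∧
      (A.PosSemidef ↔ ∀ i, 0 ≤ l i) ∧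
      (∀ u, (shiftMat u A).det = ∏ i, (u - l i)) ∧
      (∀ u, (∀ i, l i < u) → ∀ a, (resolv u A) ^ a =
        U * diagonal (fun i => ((u - l i)⁻¹) ^ a) * Uᵀ) ∧
      (∀ u, (∀ i, l i < u) → ∀ a, resTrace u A a = ∑ i, ((u - l i)⁻¹) ^ a) := by
  obtain ⟨U, l, h1, h2, rfl⟩ := hA.exists_orthogonal_diagonal
  have hp : ∀ u, (∀ i, l i < u) → ∀ a, (resolv u (U * diagonal l * Uᵀ)) ^ a =
        U * diagonal (fun i => ((u - l i)⁻¹) ^ a) * Uᵀ := by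
    intro u hu a
    rw [resolv, smul_one_sub_conj_diagonal h2,
      inv_conj_diagonal h1 h2 (fun i => (sub_pos.2 (hu i)).ne'), conj_diagonal_pow h1 h2]
  refine ⟨U, l, h1, h2, rfl, fun u => ?_, fun u => ?_, posSemidef_conj_diagonal_iff h2 l,
    fun u => ?_, hp, fun u hu a => ?_⟩
  · rw [shiftMat, smul_one_sub_conj_diagonal h2, posDef_conj_diagonal_iff h2]
    simp
  · rw [shiftMat, smul_one_sub_conj_diagonal h2, posSemidef_conj_diagonal_iff h2]
    simp
  · rw [shiftMat, smul_one_sub_conj_diagonal h2, det_conj_diagonal h2]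
  · rw [resTrace, hp u hu a, trace_conj_diagonal h1]

theorem resTrace_nonneg (hA : A.IsHermitian) (hu : (shiftMat u A).PosDef) (a : ℕ) :
    0 ≤ resTrace u A a := by
  obtain ⟨U, l, -, -, -, hpd, -, -, -, -, htr⟩ := hA.exists_resolvent_diagonal
  have hl := (hpd u).1 hu
  rw [htr u hl]
  exact Finset.sum_nonneg fun i _ => by have := sub_pos.2 (hl i); positivity

theorem shiftMat_posDef_of_gap (hA : A.IsHermitian) (hg : 0 < g)
    (h : (shiftMat (u - g) A).PosSemidef) : (shiftMat u A).PosDef := by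
  obtain ⟨U, l, -, -, -, hpd, hps, -, -, -, -⟩ := hA.exists_resolvent_diagonal
  rw [hpd]
  rw [hps] at h
  intro i; linarith [h i]

theorem shiftMat_posSemidef_mono (hA : A.IsHermitian) {u' : ℝ} (h : (shiftMat u A).PosSemidef)
    (huu : u ≤ u') : (shiftMat u' A).PosSemidef := by
  obtain ⟨U, l, -, -, -, hpd, hps, -, -, -, -⟩ := hA.exists_resolvent_diagonal
  rw [hps] at h ⊢
  exact fun i => (h i).trans huu

theorem shiftMat_posDef_mono (hA : A.IsHermitian) {u' : ℝ} (h : (shiftMat u A).PosDef)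
    (huu : u ≤ u') : (shiftMat u' A).PosDef := by
  obtain ⟨U, l, -, -, -, hpd, hps, -, -, -, -⟩ := hA.exists_resolvent_diagonal
  rw [hpd] at h ⊢
  exact fun i => (h i).trans_le huu

theorem resTrace_le_of_gap (hA : A.IsHermitian) (hg : 0 < g)
    (h : (shiftMat (u - g) A).PosSemidef) (a : ℕ) : resTrace u A a ≤ n * g⁻¹ ^ a := by
  obtain ⟨U, l, -, -, -, hpd, hps, -, -, -, htr⟩ := hA.exists_resolvent_diagonal
  rw [hps] at h
  rw [htr u (fun i => by linarith [h i])]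
  calc ∑ i, ((u - l i)⁻¹) ^ a ≤ ∑ _i : Fin n, g⁻¹ ^ a := by
        refine Finset.sum_le_sum fun i _ => ?_
        have : g ≤ u - l i := by linarith [h i]
        have h0 : 0 < u - l i := by linarith
        gcongr
    _ = _ := by simp

theorem le_resTrace_of_posSemidef (hA : A.PosSemidef) (hu : (shiftMat u A).PosDef) (a : ℕ) :
    n * u⁻¹ ^ a ≤ resTrace u A a := by
  obtain ⟨U, l, -, -, -, hpd, hps, hp, -, -, htr⟩ := hA.1.exists_resolvent_diagonal
  have hl := (hpd u).1 hu
  have h0 := hp.1 hA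
  rw [htr u hl]
  calc (n : ℝ) * u⁻¹ ^ a = ∑ _i : Fin n, u⁻¹ ^ a := by simp
    _ ≤ _ := by
        refine Finset.sum_le_sum fun i _ => ?_
        have h1 : 0 < u - l i := by linarith [hl i]
        have h2 : u - l i ≤ u := by linarith [h0 i]
        have h3 : 0 < u := by linarith
        gcongr

theorem inv_pow_shift_le {x δ : ℝ} (hx : 0 < x) (hδ : 0 ≤ δ) (q : ℕ) :
    (x + δ)⁻¹ ^ q + q * δ * (x + δ)⁻¹ ^ (q + 1) ≤ x⁻¹ ^ q := by
  have hxd : 0 < x + δ := by linarith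
  have hb := one_add_mul_le_pow (a := δ / x) (by have : 0 ≤ δ / x := by positivity
                                                 linarith) q
  have h1 : q * δ * (x + δ)⁻¹ ≤ q * (δ / x) := by
    rw [mul_assoc, div_eq_mul_inv]; gcongr; linarith
  have h2 : x⁻¹ ^ q = (x + δ)⁻¹ ^ q * (1 + δ / x) ^ q := by
    rw [← mul_pow]; congr 1; field_simp
  rw [h2, pow_succ]
  have h3 : 0 ≤ (x + δ)⁻¹ ^ q := by positivity
  nlinarith [mul_le_mul_of_nonneg_left (h1.trans (by linarith [hb] : (q : ℝ) * (δ / x) ≤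
    (1 + δ / x) ^ q - 1)) h3]

/-- Bernoulli's inequality for each eigenvalue. The first-order gain is taken at the new point u +
δ, where the rank one update is made. -/
theorem resTrace_shift_le (hA : A.IsHermitian) (hu : (shiftMat u A).PosDef) (hδ : 0 ≤ δ) (q : ℕ) :
    resTrace (u + δ) A q + q * δ * resTrace (u + δ) A (q + 1) ≤ resTrace u A q := by
  obtain ⟨U, l, -, -, -, hpd, -, -, -, -, htr⟩ := hA.exists_resolvent_diagonal
  have hl := (hpd u).1 hu
  rw [htr u hl, htr _ (fun i => by linarith [hl i]), htr _ (fun i => by linarith [hl i]),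
    Finset.mul_sum, ← Finset.sum_add_distrib]
  refine Finset.sum_le_sum fun i _ => ?_
  have := inv_pow_shift_le (x := u - l i) (by linarith [hl i]) hδ q
  rwa [show u - l i + δ = u + δ - l i by ring] at this

/-- The matching bound in the other direction, with second-order error; along a characteristic the
transform must be conserved and not merely bounded. -/
theorem resTrace_sub_shift_le (hA : A.IsHermitian) (hg : 0 < g)
    (h : (shiftMat (u - g) A).PosSemidef) (hδ : 0 ≤ δ) :
    resTrace u A 1 ≤ resTrace (u + δ) A 1 + δ * resTrace (u + δ) A 2 + n * (δ ^ 2 * g⁻¹ ^ 3) := by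
  obtain ⟨U, l, -, -, -, hpd, hps, -, -, -, htr⟩ := hA.exists_resolvent_diagonal
  rw [hps] at h
  rw [htr u (fun i => by linarith [h i]), htr _ (fun i => by linarith [h i]),
    htr _ (fun i => by linarith [h i]), Finset.mul_sum, ← Finset.sum_add_distrib]
  have : (n : ℝ) * (δ ^ 2 * g⁻¹ ^ 3) = ∑ _i : Fin n, δ ^ 2 * g⁻¹ ^ 3 := by simp
  rw [this, ← Finset.sum_add_distrib]
  refine Finset.sum_le_sum fun i _ => ?_
  obtain ⟨x, hx⟩ : ∃ x, x = u - l i := ⟨_, rfl⟩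
  have hgx : g ≤ x := by rw [hx]; linarith [h i]
  have hx0 : 0 < x := by linarith
  rw [← hx, show u + δ - l i = x + δ by rw [hx]; ring]
  have e : x⁻¹ = (x + δ)⁻¹ + δ * (x + δ)⁻¹ ^ 2 + δ ^ 2 * (x⁻¹ * (x + δ)⁻¹ ^ 2) := by
    field_simp; ring
  rw [pow_one, pow_one]
  nth_rewrite 1 [e]
  have h1 : x⁻¹ * (x + δ)⁻¹ ^ 2 ≤ g⁻¹ ^ 3 := by
    rw [pow_succ' g⁻¹]
    have : g ≤ x + δ := by linarith
    gcongr
  gcongr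

theorem sum_sq_resolv_pow (hA : A.IsHermitian) (hu : (shiftMat u A).PosDef) (a : ℕ) :
    ∑ i, ∑ j, ((resolv u A) ^ a) i j ^ 2 = resTrace u A (2 * a) := by
  have hsym : ((resolv u A) ^ a).IsHermitian := by
    obtain ⟨U, l, -, -, -, hpd, -, -, -, hpow, htr⟩ := hA.exists_resolvent_diagonal
    rw [hpow u ((hpd u).1 hu)]
    exact isHermitian_conj_diagonal _
  rw [resTrace, two_mul, pow_add, trace]
  refine Finset.sum_congr rfl fun i _ => ?_
  rw [diag_apply, Matrix.mul_apply]
  refine Finset.sum_congr rfl fun j _ => ?_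
  rw [sq]; congr 1
  simpa using (hsym.apply j i)

theorem resolv_pow_isSymm (hA : A.IsHermitian) (a : ℕ) : ((resolv u A) ^ a).IsSymm := by
  have h := (((shiftMat_isHermitian hA u).inv).pow a)
  rw [IsHermitian, conjTranspose_eq_transpose_of_trivial] at h
  exact h

theorem resolv_posSemidef (hu : (shiftMat u A).PosDef) : (resolv u A).PosSemidef :=
  hu.inv.posSemidef


/-- Logarithm of the determinant of the shifted matrix. -/
noncomputable def logDetShift (u : ℝ) (A : Matrix (Fin n) (Fin n) ℝ) : ℝ :=
  Real.log (shiftMat u A).det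

/-- For each eigenvalue, 1 - 1/x ≤ log x ≤ x - 1 at the ratio x of its distances to u + δ and to u.
-/
theorem logDetShift_add (hA : A.IsHermitian) (hu : (shiftMat u A).PosDef) (hδ : 0 ≤ δ) :
    δ * resTrace (u + δ) A 1 ≤ logDetShift (u + δ) A - logDetShift u A ∧
    logDetShift (u + δ) A - logDetShift u A ≤ δ * resTrace u A 1 := by
  obtain ⟨U, l, -, -, -, hpd, -, -, hdet, -, htr⟩ := hA.exists_resolvent_diagonal
  have hl := (hpd u).1 hu
  have hl' : ∀ i, l i < u + δ := fun i => by linarith [hl i]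
  rw [logDetShift, logDetShift, hdet, hdet, Real.log_prod (fun i _ => by linarith [hl' i]),
    Real.log_prod (fun i _ => by linarith [hl i]), htr u hl, htr _ hl', Finset.mul_sum,
    Finset.mul_sum, ← Finset.sum_sub_distrib]
  have key : ∀ i, Real.log (u + δ - l i) - Real.log (u - l i) = Real.log (1 + δ / (u - l i)) := by
    intro i
    have h1 : 0 < u - l i := by linarith [hl i]
    have h2 : 0 < u + δ - l i := by linarith [hl i]
    rw [← Real.log_div h2.ne' h1.ne']; congr 1; field_simp; ring
  constructor
  · refine Finset.sum_le_sum fun i _ => ?_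
    have h1 : 0 < u - l i := by linarith [hl i]
    have h2 : 0 < u + δ - l i := by linarith [hl i]
    rw [key]
    have := Real.one_sub_inv_le_log_of_pos (x := 1 + δ / (u - l i)) (by positivity)
    refine le_trans (le_of_eq ?_) this
    field_simp; ring
  · refine Finset.sum_le_sum fun i _ => ?_
    have h1 : 0 < u - l i := by linarith [hl i]
    rw [key]
    have := Real.log_le_sub_one_of_pos (x := 1 + δ / (u - l i)) (by positivity)
    refine this.trans (le_of_eq ?_)
    field_simp; ring

section Update

variable {v : Fin n → ℝ}

theorem shiftMat_add (u : ℝ) (A B : Matrix (Fin n) (Fin n) ℝ) :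
    shiftMat u (A + B) = shiftMat u A - B := by
  unfold shiftMat; rw [sub_sub]

theorem resolv_add_vecMulVec (hA : A.IsHermitian) (hu : (shiftMat u A).PosDef)
    (h : v ⬝ᵥ resolv u A *ᵥ v < 1) :
    resolv u (A + vecMulVec v v) = resolv u A +
      (1 - v ⬝ᵥ resolv u A *ᵥ v)⁻¹ • vecMulVec (resolv u A *ᵥ v) (resolv u A *ᵥ v) := by
  have e : resolv u (A + vecMulVec v v) = (shiftMat u A - vecMulVec v v)⁻¹ := by
    rw [← shiftMat_add]; rfl
  rw [e, inv_sub_vecMulVec]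
  · rfl
  · exact hu.det_pos.ne'.isUnit
  · have := shiftMat_isHermitian hA u
    rwa [IsHermitian, conjTranspose_eq_transpose_of_trivial] at this
  · change 1 - v ⬝ᵥ resolv u A *ᵥ v ≠ 0
    linarith

theorem shiftMat_add_vecMulVec_posDef (hu : (shiftMat u A).PosDef)
    (h : v ⬝ᵥ resolv u A *ᵥ v < 1) : (shiftMat u (A + vecMulVec v v)).PosDef := by
  rw [shiftMat_add]; exact hu.sub_vecMulVec h

theorem resTrace_one_add_vecMulVec (hA : A.IsHermitian) (hu : (shiftMat u A).PosDef)
    (h : v ⬝ᵥ resolv u A *ᵥ v < 1) :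
    resTrace u (A + vecMulVec v v) 1 = resTrace u A 1 +
      (1 - v ⬝ᵥ resolv u A *ᵥ v)⁻¹ * (v ⬝ᵥ (resolv u A ^ 2) *ᵥ v) := by
  have hs := resolv_pow_isSymm (u := u) hA 1
  rw [pow_one, IsSymm] at hs
  rw [resTrace, resTrace, pow_one, pow_one, resolv_add_vecMulVec hA hu h, trace_add, trace_smul,
    trace_vecMulVec, smul_eq_mul]
  congr 2
  rw [sq, ← mulVec_mulVec, dotProduct_mulVec v, ← mulVec_transpose, hs]

theorem logDetShift_add_vecMulVec (hu : (shiftMat u A).PosDef)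
    (h : v ⬝ᵥ resolv u A *ᵥ v < 1) :
    logDetShift u (A + vecMulVec v v) =
      logDetShift u A + Real.log (1 - v ⬝ᵥ resolv u A *ᵥ v) := by
  rw [logDetShift, shiftMat_add, det_sub_vecMulVec hu.det_pos.ne'.isUnit, Real.log_mul]
  · rfl
  · exact hu.det_pos.ne'
  · change 1 - v ⬝ᵥ resolv u A *ᵥ v ≠ 0
    linarith

theorem resTrace_pow_add_vecMulVec_le (hA : A.IsHermitian) (hu : (shiftMat u A).PosDef)
    {c : ℝ} (h : v ⬝ᵥ resolv u A *ᵥ v < 1) (hc : (1 - v ⬝ᵥ resolv u A *ᵥ v)⁻¹ ≤ c) (q : ℕ) :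
    resTrace u (A + vecMulVec v v) q ≤ resTrace u A q + c * q *
      (v ⬝ᵥ (resolv u A ^ (q + 1)) *ᵥ v + (1 + c) ^ q *
        ((v ⬝ᵥ (resolv u A ^ 2) *ᵥ v) * (v ⬝ᵥ (resolv u A ^ q) *ᵥ v))) := by
  have hR := resolv_posSemidef hu
  have hc0 : 0 ≤ (1 - v ⬝ᵥ resolv u A *ᵥ v)⁻¹ := inv_nonneg.2 (by linarith)
  have := trace_pow_rankOne_le hR hc0 (resolv_add_vecMulVec hA hu h) h.le q
  refine this.trans ?_
  have h1 := hR.quadForm_pow_nonneg v (q + 1)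
  have h2 := hR.quadForm_pow_nonneg v 2
  have h3 := hR.quadForm_pow_nonneg v q
  have hc1 : 0 ≤ c := hc0.trans hc
  unfold resTrace
  gcongr

end Update

end Resolvent

/-! ### Deterministic effect of one column on the two barriers -/

section Steps

open Matrix

variable {n : ℕ} {A : Matrix (Fin n) (Fin n) ℝ} {N u : ℝ}

/-- The normalised Stieltjes transform along a barrier does not increase. -/
theorem stieltjes_barrier_step {v : Fin n → ℝ} (hA : A.IsHermitian) (hu : (shiftMat u A).PosDef)
    (hN : 0 < N) {cb c₁ ε t' : ℝ} (hcb : 0 ≤ cb)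
    (h1 : v ⬝ᵥ resolv (u + cb / N) A *ᵥ v < 1)
    (h1c : (1 - v ⬝ᵥ resolv (u + cb / N) A *ᵥ v)⁻¹ ≤ c₁)
    (h2 : v ⬝ᵥ (resolv (u + cb / N) A ^ 2) *ᵥ v ≤ (1 + t') * (resTrace (u + cb / N) A 2 / N))
    (hslack : c₁ * (1 + t') + ε ≤ cb) :
    resTrace (u + cb / N) (A + vecMulVec v v) 1 / N ≤
      resTrace u A 1 / N - ε * (resTrace (u + cb / N) A 2 / N) / N := by
  have hδ : 0 ≤ cb / N := by positivity
  have hu' : (shiftMat (u + cb / N) A).PosDef := shiftMat_posDef_mono hA hu (by linarith)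
  rw [resTrace_one_add_vecMulVec hA hu' h1]
  have hs := resTrace_shift_le hA hu hδ 1
  set s := resTrace (u + cb / N) A 2 / N with hs2
  have hs0 : 0 ≤ s := div_nonneg (resTrace_nonneg hA hu' 2) hN.le
  have hq := (resolv_posSemidef hu').quadForm_pow_nonneg v 2
  have e1 : (1 - v ⬝ᵥ resolv (u + cb / N) A *ᵥ v)⁻¹ * (v ⬝ᵥ (resolv (u + cb / N) A ^ 2) *ᵥ v)
      ≤ c₁ * ((1 + t') * s) := by
    have : 0 ≤ (1 - v ⬝ᵥ resolv (u + cb / N) A *ᵥ v)⁻¹ := inv_nonneg.2 (by linarith)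
    gcongr
    exact this.trans h1c
  -- The motion of the barrier gains cb · s and the update loses at most c₁(1 + t') · s; the reserve
  -- ε · s feeds the exponential in the Lyapunov function.
  have e2 : c₁ * ((1 + t') * s) ≤ (cb - ε) * s := by
    rw [← mul_assoc]; gcongr; linarith
  have e3 : (1 : ℕ) * (cb / N) * resTrace (u + cb / N) A (1 + 1) = cb * s := by
    rw [hs2]; push_cast; field_simp
  rw [e3] at hs
  rw [← sub_div]
  gcongr
  linarith

/-- T1 and T2 stand for tr R^q and tr R^(q+1) at the new barrier, T0 for tr R^q at the old one. The
T2 term is paid by the shift, as c₁ ≤ cb. The remaining relative growth is Kεs/N by the choice of K,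
and the exponent falls by exactly that amount. -/
theorem lyapunov_arith {T0 T1 T2 c₁ cb K ε s N M : ℝ} {q : ℕ} (hN : 0 < N)
    (hc : 0 ≤ c₁) (hccb : c₁ ≤ cb) (hs : 0 ≤ s) (hT1 : 0 ≤ T1) (hT2 : 0 ≤ T2)
    (hK : K * ε = 2 * (c₁ * q * (1 + c₁) ^ q))
    (hshift : T1 + q * (cb / N) * T2 ≤ T0) :
    (T1 + c₁ * q * (T2 / N + (1 + c₁) ^ q * (2 * s * (T1 / N)))) *
      Real.exp (K * (M - ε * s / N)) ≤ T0 * Real.exp (K * M) := by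
  have e1 : T1 + c₁ * q * (T2 / N + (1 + c₁) ^ q * (2 * s * (T1 / N)))
      ≤ T0 * (1 + K * ε * s / N) := by
    rw [hK]
    have h3 : c₁ * q * (T2 / N) ≤ q * (cb / N) * T2 := by
      have : c₁ * q * (T2 / N) = q * (c₁ / N) * T2 := by ring
      rw [this]; gcongr
    have h4 : T1 ≤ T0 := by
      have : 0 ≤ q * (cb / N) * T2 := by have := hc.trans hccb; positivity
      linarith
    have h5 : c₁ * q * ((1 + c₁) ^ q * (2 * s * (T1 / N))) =
        T1 * (2 * (c₁ * q * (1 + c₁) ^ q) * s / N) := by ring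
    have h6 : T1 * (2 * (c₁ * q * (1 + c₁) ^ q) * s / N)
        ≤ T0 * (2 * (c₁ * q * (1 + c₁) ^ q) * s / N) := by gcongr
    rw [mul_add (c₁ * q), h5]
    linarith
  have e2 : 1 + K * ε * s / N ≤ Real.exp (K * ε * s / N) := by
    linarith [Real.add_one_le_exp (K * ε * s / N)]
  have hT0 : 0 ≤ T0 := by
    have : 0 ≤ q * (cb / N) * T2 := by have := hc.trans hccb; positivity
    linarith
  calc _ ≤ T0 * Real.exp (K * ε * s / N) * Real.exp (K * (M - ε * s / N)) := by
        gcongr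
        exact e1.trans (by gcongr)
    _ = T0 * Real.exp (K * M) := by
        rw [mul_assoc, ← Real.exp_add]; congr 2; ring

theorem eigenvalue_near_barrier (hA : A.IsHermitian) (hu : (shiftMat u A).PosDef) {g : ℝ}
    (hg : 0 < g) (hng : ¬ (shiftMat (u - g) A).PosSemidef) (q : ℕ) :
    g⁻¹ ^ q ≤ resTrace u A q := by
  obtain ⟨U, l, -, -, -, hpd, hps, -, -, -, htr⟩ := hA.exists_resolvent_diagonal
  have hl := (hpd u).1 hu
  rw [hps] at hng
  push Not at hng
  obtain ⟨i, hi⟩ := hng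
  rw [htr u hl]
  have h1 : 0 < u - l i := by linarith [hl i]
  calc g⁻¹ ^ q ≤ (u - l i)⁻¹ ^ q := by gcongr; linarith
    _ ≤ _ := Finset.single_le_sum (f := fun i => (u - l i)⁻¹ ^ q)
        (fun j _ => by have := sub_pos.2 (hl j); positivity) (Finset.mem_univ i)

theorem abs_log_sub_log_le {x y b : ℝ} (hb : 0 < b) (hx : b ≤ x) (hy : b ≤ y) :
    |Real.log x - Real.log y| ≤ |x - y| / b := by
  have hx0 : 0 < x := by linarith
  have hy0 : 0 < y := by linarith
  have key : ∀ x y : ℝ, b ≤ x → b ≤ y → Real.log x - Real.log y ≤ |x - y| / b := by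
    intro x y hx hy
    have hx0 : 0 < x := by linarith
    have hy0 : 0 < y := by linarith
    rw [← Real.log_div hx0.ne' hy0.ne']
    refine (Real.log_le_sub_one_of_pos (by positivity)).trans ?_
    calc x / y - 1 = (x - y) / y := by field_simp
      _ ≤ |x - y| / y := by gcongr; exact le_abs_self _
      _ ≤ _ := by gcongr
  rw [abs_le]
  constructor
  · have := key y x hy hx
    rw [abs_sub_comm] at this
    linarith
  · exact key x y hx hy

/-- Error constant for one step along a characteristic. -/
noncomputable def charConst (e m : ℝ) : ℝ :=
  2 * (1 - m)⁻¹ + 2 * (1 - m)⁻¹ ^ 2 * e⁻¹ ^ 2 * (1 + (1 - m)⁻¹ * e⁻¹ ^ 2)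
    + (1 - m)⁻¹ ^ 2 * e⁻¹ ^ 3 + (1 - m)⁻¹ * (1 + (1 - m)⁻¹ * e⁻¹ ^ 2)
    + 2 * (1 - m)⁻¹ * (1 + (1 - m)⁻¹ * e⁻¹ ^ 2)

theorem charConst_nonneg {e m : ℝ} (he : 0 < e) (hm1 : m < 1) : 0 ≤ charConst e m := by
  have : 0 < 1 - m := by linarith
  unfold charConst; positivity

set_option maxHeartbeats 1000000 in
/-- One step along a characteristic: the Stieltjes transform is nearly conserved and the
logarithmic determinant grows at a constant rate. -/
theorem characteristic_step {v : Fin n → ℝ} (hA : A.IsHermitian) {e m t τ : ℝ} (he : 0 < e)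
    (hgap : (shiftMat (u - e) A).PosSemidef) (hN : 1 ≤ N) (hnN : (n : ℝ) ≤ N)
    (hm1 : m < 1) (ht : 0 ≤ t) (hτ : |resTrace u A 1 / N - m| ≤ τ)
    (hsmall : charConst e m * (t + τ + 1 / N) ≤ 1 / 2)
    (h1 : |v ⬝ᵥ resolv (u + (1 - m)⁻¹ / N) A *ᵥ v - resTrace (u + (1 - m)⁻¹ / N) A 1 / N| ≤ t)
    (h2 : |v ⬝ᵥ (resolv (u + (1 - m)⁻¹ / N) A ^ 2) *ᵥ v
      - resTrace (u + (1 - m)⁻¹ / N) A 2 / N| ≤ t) :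
    |resTrace (u + (1 - m)⁻¹ / N) (A + vecMulVec v v) 1 / N - m|
      ≤ τ + charConst e m / N * (t + τ + 1 / N) ∧
    |logDetShift (u + (1 - m)⁻¹ / N) (A + vecMulVec v v) / N - logDetShift u A / N
      - (m * (1 - m)⁻¹ + Real.log (1 - m)) / N| ≤ charConst e m / N * (t + τ + 1 / N) := by
  have hN0 : 0 < N := by linarith
  have h1m : 0 < 1 - m := by linarith
  set c := (1 - m)⁻¹ with hc
  have hc0 : 0 < c := by positivity
  set u' := u + c / N with hu'
  have hδ : 0 ≤ c / N := by positivity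
  have huA : (shiftMat u A).PosDef := shiftMat_posDef_of_gap hA he hgap
  have huA' : (shiftMat u' A).PosDef := shiftMat_posDef_mono hA huA (by linarith)
  have hgap' : (shiftMat (u' - e) A).PosSemidef :=
    shiftMat_posSemidef_mono hA hgap (by linarith)
  have hτ0 : 0 ≤ τ := (abs_nonneg _).trans hτ
  set m0 := resTrace u A 1 / N with hm0d
  set m1 := resTrace u' A 1 / N with hm1d
  set s := resTrace u' A 2 / N with hsd
  set x := v ⬝ᵥ resolv u' A *ᵥ v with hx
  set y := v ⬝ᵥ (resolv u' A ^ 2) *ᵥ v with hy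
  have hs0 : 0 ≤ s := div_nonneg (resTrace_nonneg hA huA' 2) hN0.le
  have hsle : s ≤ e⁻¹ ^ 2 := by
    rw [hsd, div_le_iff₀ hN0, mul_comm]
    refine (resTrace_le_of_gap hA he hgap' 2).trans ?_
    gcongr
  have g1 : m1 + c * s / N ≤ m0 := by
    have := resTrace_shift_le hA huA hδ 1
    have h := div_le_div_of_nonneg_right this hN0.le
    rw [add_div, Nat.cast_one, one_mul] at h
    refine le_trans (le_of_eq ?_) h
    rw [hm1d, hsd]; ring
  have g2 : m0 ≤ m1 + c * s / N + c ^ 2 * e⁻¹ ^ 3 / N ^ 2 := by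
    have := resTrace_sub_shift_le hA he hgap hδ
    have h := div_le_div_of_nonneg_right this hN0.le
    refine h.trans ?_
    rw [add_div, add_div]
    have a1 : c / N * resTrace (u + c / N) A 2 / N = c * s / N := by rw [hsd]; ring
    have a2 : (n : ℝ) * ((c / N) ^ 2 * e⁻¹ ^ 3) / N ≤ c ^ 2 * e⁻¹ ^ 3 / N ^ 2 := by
      calc (n : ℝ) * ((c / N) ^ 2 * e⁻¹ ^ 3) / N ≤ N * ((c / N) ^ 2 * e⁻¹ ^ 3) / N := by gcongr
        _ = _ := by field_simp
    rw [a1]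
    linarith
  set D := charConst e m with hD
  have hD0 : 0 ≤ D := charConst_nonneg he hm1
  set w := 1 + c * e⁻¹ ^ 2 with hw
  have hw1 : 1 ≤ w := by rw [hw]; have : 0 ≤ c * e⁻¹ ^ 2 := by positivity
                         linarith
  have hDe : D = 2 * c + 2 * c ^ 2 * e⁻¹ ^ 2 * w + c ^ 2 * e⁻¹ ^ 3 + c * w + 2 * c * w := rfl
  set E := t + τ + 1 / N with hE
  have hE0 : 0 ≤ E := by positivity
  have hN1 : 1 / N ≤ E := by rw [hE]; linarith
  have htE : t ≤ E := by rw [hE]; have : 0 ≤ 1 / N := by positivity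
                         linarith
  have hm10 : |m1 - m0| ≤ c * e⁻¹ ^ 2 * (1 / N) := by
    have a1 : 0 ≤ c * s / N := by positivity
    rw [abs_of_nonpos (by linarith)]
    have g3 : resTrace u A 1 ≤ resTrace u' A 1 + (c / N) * (n * e⁻¹ ^ 2) := by
      obtain ⟨U, l, -, -, -, hpd, hps, -, -, -, htr⟩ := hA.exists_resolvent_diagonal
      rw [hps] at hgap
      have hl : ∀ i, l i < u := fun i => by linarith [hgap i]
      have hl' : ∀ i, l i < u' := fun i => by linarith [hgap i]
      rw [htr u hl, htr u' hl']
      have : (c / N) * ((n : ℝ) * e⁻¹ ^ 2) = ∑ _i : Fin n, (c / N) * e⁻¹ ^ 2 := by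
        simp; ring
      rw [this, ← Finset.sum_add_distrib]
      refine Finset.sum_le_sum fun i _ => ?_
      have b1 : e ≤ u - l i := by linarith [hgap i]
      have b2 : e ≤ u' - l i := by linarith [hgap i]
      have b3 : 0 < u - l i := by linarith
      have b4 : 0 < u' - l i := by linarith
      have : (u - l i)⁻¹ = (u' - l i)⁻¹ + (c / N) * ((u - l i)⁻¹ * (u' - l i)⁻¹) := by
        field_simp; rw [hu']; field_simp; ring
      rw [pow_one, pow_one, this, sq]
      gcongr
    have h := div_le_div_of_nonneg_right g3 hN0.le
    rw [add_div] at h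
    have a2 : c / N * (n * e⁻¹ ^ 2) / N ≤ c * e⁻¹ ^ 2 * (1 / N) := by
      calc c / N * (n * e⁻¹ ^ 2) / N ≤ c / N * (N * e⁻¹ ^ 2) / N := by gcongr
        _ = _ := by field_simp
    linarith
  have hxm : |x - m| ≤ w * E := by
    calc |x - m| = |(x - m1) + (m1 - m0) + (m0 - m)| := by congr 1; ring
      _ ≤ |x - m1| + |m1 - m0| + |m0 - m| := abs_add_three _ _ _
      _ ≤ t + c * e⁻¹ ^ 2 * (1 / N) + τ := by gcongr
      _ ≤ w * E := by
        have b1 : 0 ≤ c * e⁻¹ ^ 2 := by positivity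
        have b2 := mul_le_mul_of_nonneg_left hN1 b1
        have b3 : 0 ≤ 1 / N := by positivity
        rw [hw]; linarith
  have hcw : c * w * E ≤ 1 / 2 := by
    refine le_trans ?_ hsmall
    have h : c * w ≤ D := by
      have : 0 ≤ 2 * c + 2 * c ^ 2 * e⁻¹ ^ 2 * w + c ^ 2 * e⁻¹ ^ 3 + 2 * c * w := by positivity
      linarith
    exact mul_le_mul_of_nonneg_right h hE0
  -- Smallness of the error is used here: x stays at distance at least (1 - m)/2 from the
  -- singularity at 1.
  have hx2 : w * E ≤ (1 - m) / 2 := by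
    have : c * (w * E) ≤ 1 / 2 := by linarith
    have h := mul_le_mul_of_nonneg_left this h1m.le
    rw [← mul_assoc, hc, mul_inv_cancel₀ h1m.ne', one_mul] at h
    linarith
  have hxx : (1 - m) / 2 ≤ 1 - x := by
    have := (abs_le.1 hxm).2
    linarith
  have hxlt : x < 1 := by linarith
  have hxi : (1 - x)⁻¹ ≤ 2 * c := by
    calc (1 - x)⁻¹ ≤ ((1 - m) / 2)⁻¹ := by gcongr
      _ = 2 * c := by rw [hc]; field_simp
  have hxi0 : 0 ≤ (1 - x)⁻¹ := inv_nonneg.2 (by linarith)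
  constructor
  · rw [resTrace_one_add_vecMulVec hA huA' hxlt, add_div]
    -- The update adds (1 - x)⁻¹ y and the shift of u removes about c · s. Their cancellation up to
    -- errors is what fixes the speed c = (1 - m)⁻¹.
    have k1 : |(1 - x)⁻¹ * y - c * s| ≤ (2 * c + 2 * c ^ 2 * e⁻¹ ^ 2 * w) * E := by
      have : (1 - x)⁻¹ * y - c * s = (1 - x)⁻¹ * (y - s) + s * ((1 - x)⁻¹ * c) * (x - m) := by
        have h3 : (1 - x) ≠ 0 := by linarith
        rw [hc]; field_simp; ring
      rw [this]
      refine (abs_add_le _ _).trans ?_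
      rw [abs_mul, abs_mul, abs_mul, abs_mul, abs_of_nonneg hxi0, abs_of_nonneg hs0,
        abs_of_pos hc0]
      calc (1 - x)⁻¹ * |y - s| + s * ((1 - x)⁻¹ * c) * |x - m|
          ≤ 2 * c * E + e⁻¹ ^ 2 * (2 * c * c) * (w * E) := by
            gcongr
            exact h2.trans htE
        _ = _ := by ring
    have k2 : |m1 + (1 - x)⁻¹ * y / N - m0| ≤ (D / N) * E := by
      have : m1 + (1 - x)⁻¹ * y / N - m0 = ((1 - x)⁻¹ * y - c * s) / N + (m1 + c * s / N - m0) := by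
        ring
      rw [this]
      refine (abs_add_le _ _).trans ?_
      rw [abs_div, abs_of_pos hN0]
      have k3 : |m1 + c * s / N - m0| ≤ c ^ 2 * e⁻¹ ^ 3 / N * E := by
        rw [abs_of_nonpos (by linarith)]
        have : c ^ 2 * e⁻¹ ^ 3 / N ^ 2 = c ^ 2 * e⁻¹ ^ 3 / N * (1 / N) := by field_simp
        have k4 : c ^ 2 * e⁻¹ ^ 3 / N * (1 / N) ≤ c ^ 2 * e⁻¹ ^ 3 / N * E := by gcongr
        linarith
      calc |(1 - x)⁻¹ * y - c * s| / N + |m1 + c * s / N - m0|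
          ≤ (2 * c + 2 * c ^ 2 * e⁻¹ ^ 2 * w) * E / N + c ^ 2 * e⁻¹ ^ 3 / N * E := by gcongr
        _ = (2 * c + 2 * c ^ 2 * e⁻¹ ^ 2 * w + c ^ 2 * e⁻¹ ^ 3) / N * E := by ring
        _ ≤ _ := by
          have h : 2 * c + 2 * c ^ 2 * e⁻¹ ^ 2 * w + c ^ 2 * e⁻¹ ^ 3 ≤ D := by
            have : 0 ≤ c * w + 2 * c * w := by positivity
            linarith
          exact mul_le_mul_of_nonneg_right (div_le_div_of_nonneg_right h hN0.le) hE0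
    calc |m1 + (1 - x)⁻¹ * y / N - m| = |(m0 - m) + (m1 + (1 - x)⁻¹ * y / N - m0)| := by
          congr 1; ring
      _ ≤ |m0 - m| + |m1 + (1 - x)⁻¹ * y / N - m0| := abs_add_le _ _
      _ ≤ _ := by gcongr
  · rw [logDetShift_add_vecMulVec huA' hxlt]
    obtain ⟨l1, l2⟩ := logDetShift_add hA huA hδ
    -- The shift contributes between c · m1 and c · m0, and both transforms are close to m.
    have k1 : |(logDetShift u' A - logDetShift u A) - c * m| ≤ c * w * E := by
      have b1 : c * m1 ≤ logDetShift u' A - logDetShift u A := by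
        refine le_trans (le_of_eq ?_) l1
        rw [hm1d]; ring
      have b2 : logDetShift u' A - logDetShift u A ≤ c * m0 := by
        refine l2.trans (le_of_eq ?_)
        rw [hm0d]; ring
      have b3 : |m0 - m| ≤ w * E := by
        refine hτ.trans ?_
        calc τ ≤ E := by rw [hE]; have : 0 ≤ 1 / N := by positivity
                         linarith
          _ = 1 * E := (one_mul _).symm
          _ ≤ w * E := by gcongr
      have b4 : |m1 - m| ≤ w * E := by
        calc |m1 - m| = |(m1 - m0) + (m0 - m)| := by congr 1; ring
          _ ≤ |m1 - m0| + |m0 - m| := abs_add_le _ _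
          _ ≤ c * e⁻¹ ^ 2 * (1 / N) + τ := by gcongr
          _ ≤ c * e⁻¹ ^ 2 * E + E := by
            gcongr
            rw [hE]; have : 0 ≤ 1 / N := by positivity
            linarith
          _ = w * E := by rw [hw]; ring
      have b5 := mul_le_mul_of_nonneg_left (abs_le.1 b3).2 hc0.le
      have b6 := mul_le_mul_of_nonneg_left (abs_le.1 b4).1 hc0.le
      rw [abs_le]
      constructor <;> linarith
    have k2 : |Real.log (1 - x) - Real.log (1 - m)| ≤ 2 * c * w * E := by
      refine (abs_log_sub_log_le (b := (1 - m) / 2) (by linarith) hxx (by linarith)).trans ?_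
      rw [show 1 - x - (1 - m) = -(x - m) by ring, abs_neg]
      calc |x - m| / ((1 - m) / 2) ≤ w * E / ((1 - m) / 2) := by gcongr
        _ = _ := by rw [hc]; field_simp
    have : (logDetShift u' A + Real.log (1 - x)) / N - logDetShift u A / N
        - (m * c + Real.log (1 - m)) / N = (((logDetShift u' A - logDetShift u A) - c * m)
          + (Real.log (1 - x) - Real.log (1 - m))) / N := by ring
    rw [this, abs_div, abs_of_pos hN0]
    calc _ ≤ (c * w * E + 2 * c * w * E) / N := by
          gcongr
          exact (abs_add_le _ _).trans (add_le_add k1 k2)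
      _ = (c * w + 2 * c * w) / N * E := by ring
      _ ≤ _ := by
          have h : c * w + 2 * c * w ≤ D := by
            have : 0 ≤ 2 * c + 2 * c ^ 2 * e⁻¹ ^ 2 * w + c ^ 2 * e⁻¹ ^ 3 := by positivity
            linarith
          exact mul_le_mul_of_nonneg_right (div_le_div_of_nonneg_right h hN0.le) hE0

end Steps

/-! ### Random columns: deviation bounds and the mean of the Lyapunov function -/

section RankOneStep

open Matrix

variable {n : ℕ} {A : Matrix (Fin n) (Fin n) ℝ} {N u g t : ℝ}

theorem quadForm_inv_sqrt_smul (hN : 0 < N) (B : Matrix (Fin n) (Fin n) ℝ) (x : Fin n → ℝ) :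
    ((√N)⁻¹ • x) ⬝ᵥ B *ᵥ ((√N)⁻¹ • x) = x ⬝ᵥ B *ᵥ x / N := by
  rw [mulVec_smul, smul_dotProduct, dotProduct_smul, smul_smul, smul_eq_mul, ← mul_inv,
    Real.mul_self_sqrt hN.le, div_eq_inv_mul]

variable {ν : Measure ℝ} {c : NNReal} [IsProbabilityMeasure ν]

/-- The squared entries of N⁻¹R^a sum to N⁻² tr R^(2a), at most g⁻⁴/N because a ≤ 2 and g ≤ 1. So
the gap may shrink with N, but must stay well above N^(-1/4). -/
theorem IsStdSubgaussian.measure_resolvent_quadForm_le (h : IsStdSubgaussian ν c)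
    (hA : A.IsHermitian) (hN : 1 ≤ N) (hnN : (n : ℝ) ≤ N) (hg : 0 < g) (hg1 : g ≤ 1)
    (hgap : (shiftMat (u - g) A).PosSemidef) {a : ℕ} (ha : a ≤ 2) {r : ℕ} (hr : r ≠ 0)
    (ht : 0 < t) :
    (Measure.pi fun _ : Fin n => ν)
      {x | t ≤ |((√N)⁻¹ • x) ⬝ᵥ (resolv u A ^ a) *ᵥ ((√N)⁻¹ • x) - resTrace u A a / N|} ≤
      ENNReal.ofReal ((quadConst c r * (g⁻¹ ^ 4 / N)) ^ r / t ^ (2 * r)) := by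
  have hN0 : 0 < N := by linarith
  have hs : {x : Fin n → ℝ |
      t ≤ |((√N)⁻¹ • x) ⬝ᵥ (resolv u A ^ a) *ᵥ ((√N)⁻¹ • x) - resTrace u A a / N|} =
      {x | t ≤ |x ⬝ᵥ (N⁻¹ • resolv u A ^ a) *ᵥ x - (N⁻¹ • resolv u A ^ a).trace|} := by
    ext x
    rw [Set.mem_ofPred_eq, Set.mem_ofPred_eq, quadForm_inv_sqrt_smul hN0, smul_mulVec,
      dotProduct_smul, trace_smul, smul_eq_mul, smul_eq_mul, resTrace, div_eq_inv_mul,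
      div_eq_inv_mul]
  rw [hs]
  have hsym : (N⁻¹ • resolv u A ^ a).IsSymm := (resolv_pow_isSymm hA a).smul _
  refine (h.measure_quadForm_le hsym hr ht).trans (ENNReal.ofReal_le_ofReal ?_)
  have hu := shiftMat_posDef_of_gap hA hg hgap
  have hF : ∑ i, ∑ j, (N⁻¹ • resolv u A ^ a) i j ^ 2 = N⁻¹ ^ 2 * resTrace u A (2 * a) := by
    rw [← sum_sq_resolv_pow hA hu a]
    simp [mul_pow, Finset.mul_sum]
  rw [hF]
  have h0 := quadConst_nonneg c r
  have h1 := resTrace_nonneg hA hu (2 * a)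
  have hgi : 1 ≤ g⁻¹ := (one_le_inv₀ hg).2 hg1
  have h2 : N⁻¹ ^ 2 * resTrace u A (2 * a) ≤ g⁻¹ ^ 4 / N := by
    calc N⁻¹ ^ 2 * resTrace u A (2 * a) ≤ N⁻¹ ^ 2 * (N * g⁻¹ ^ 4) := by
          gcongr
          refine (resTrace_le_of_gap hA hg hgap _).trans ?_
          gcongr
          omega
      _ = _ := by field_simp
  gcongr

theorem IsStdSubgaussian.integral_resolvent_quadForm (h : IsStdSubgaussian ν c) (hN : 0 < N)
    (u : ℝ) (A : Matrix (Fin n) (Fin n) ℝ) (a : ℕ) :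
    Integrable (fun x => ((√N)⁻¹ • x) ⬝ᵥ (resolv u A ^ a) *ᵥ ((√N)⁻¹ • x))
      (Measure.pi fun _ : Fin n => ν) ∧
    ∫ x, ((√N)⁻¹ • x) ⬝ᵥ (resolv u A ^ a) *ᵥ ((√N)⁻¹ • x) ∂(Measure.pi fun _ : Fin n => ν) =
      resTrace u A a / N := by
  simp only [quadForm_inv_sqrt_smul hN]
  obtain ⟨h1, h2⟩ := h.integral_quadForm (resolv u A ^ a)
  exact ⟨h1.div_const _, by rw [integral_div, h2, resTrace]⟩

theorem measurable_quadForm (B : Matrix (Fin n) (Fin n) ℝ) (s : ℝ) :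
    Measurable fun x : Fin n → ℝ => (s • x) ⬝ᵥ B *ᵥ (s • x) := by
  simp only [dotProduct, mulVec, Pi.smul_apply, smul_eq_mul]
  fun_prop

theorem measurableSet_quadForm_dev (B : Matrix (Fin n) (Fin n) ℝ) (s b t : ℝ) :
    MeasurableSet {x : Fin n → ℝ | t ≤ |(s • x) ⬝ᵥ B *ᵥ (s • x) - b|} :=
  measurableSet_le measurable_const (continuous_abs.measurable.comp
    ((measurable_quadForm B s).sub_const b))

/-- The Lyapunov function: a high negative moment of the distance of the spectrum to the
barrier, weighted by the exponential of the normalised Stieltjes transform. -/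
noncomputable def lyapunov (u N K : ℝ) (q : ℕ) (A : Matrix (Fin n) (Fin n) ℝ) : ℝ :=
  resTrace u A q * Real.exp (K * (resTrace u A 1 / N))

/-- An upper bound for the Lyapunov function after one step, explicit in the new column. -/
noncomputable def lyapunovMajorant (u N K c₁ ε M : ℝ) (q : ℕ) (A : Matrix (Fin n) (Fin n) ℝ)
    (v : Fin n → ℝ) : ℝ :=
  (resTrace u A q + c₁ * q * (v ⬝ᵥ (resolv u A ^ (q + 1)) *ᵥ v + (1 + c₁) ^ q *
      (2 * (resTrace u A 2 / N) * (v ⬝ᵥ (resolv u A ^ q) *ᵥ v)))) *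
    Real.exp (K * (M - ε * (resTrace u A 2 / N) / N))

/-- For typical v the form vᵀR²v is at most twice tr R²/N. Substituting this leaves a majorant that
is affine in the other quadratic forms, so that it can be integrated exactly over all columns,
typical or not. -/
theorem lyapunov_add_le {v : Fin n → ℝ} (hA : A.IsHermitian) (hu : (shiftMat u A).PosDef)
    (hN : 0 < N) {cb c₁ ε t' K : ℝ} {q : ℕ} (hcb : 0 ≤ cb) (hK : 0 ≤ K) (ht' : t' ≤ 1)
    (h1 : v ⬝ᵥ resolv (u + cb / N) A *ᵥ v < 1)
    (h1c : (1 - v ⬝ᵥ resolv (u + cb / N) A *ᵥ v)⁻¹ ≤ c₁)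
    (h2 : v ⬝ᵥ (resolv (u + cb / N) A ^ 2) *ᵥ v ≤ (1 + t') * (resTrace (u + cb / N) A 2 / N))
    (hslack : c₁ * (1 + t') + ε ≤ cb) :
    lyapunov (u + cb / N) N K q (A + vecMulVec v v) ≤
      lyapunovMajorant (u + cb / N) N K c₁ ε (resTrace u A 1 / N) q A v := by
  have hu' : (shiftMat (u + cb / N) A).PosDef :=
    shiftMat_posDef_mono hA hu (by have : 0 ≤ cb / N := by positivity
                                   linarith)
  have hs0 : 0 ≤ resTrace (u + cb / N) A 2 / N := div_nonneg (resTrace_nonneg hA hu' 2) hN.le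
  have hR := (resolv_posSemidef hu').quadForm_pow_nonneg v
  have hc1 : 0 ≤ c₁ := le_trans (inv_nonneg.2 (by linarith)) h1c
  have hT := resTrace_nonneg hA hu' q
  have hq1 := hR (q + 1)
  have hq := hR q
  unfold lyapunov lyapunovMajorant
  refine mul_le_mul ?_ ?_ (Real.exp_pos _).le (by positivity)
  · refine (resTrace_pow_add_vecMulVec_le hA hu' h1 h1c q).trans ?_
    have h3 : (1 + t') * (resTrace (u + cb / N) A 2 / N) ≤ 2 * (resTrace (u + cb / N) A 2 / N) := by
      gcongr; linarith
    gcongr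
    exact h2.trans h3
  · have := stieltjes_barrier_step hA hu hN hcb h1 h1c h2 hslack
    gcongr

theorem IsStdSubgaussian.lintegral_lyapunovMajorant_le (h : IsStdSubgaussian ν c)
    (hA : A.IsHermitian) (hu : (shiftMat u A).PosDef)
    (hN : 0 < N) {cb c₁ ε K : ℝ} {q : ℕ} (hc₁ : 0 ≤ c₁) (hcb : c₁ ≤ cb)
    (hK : K * ε = 2 * (c₁ * q * (1 + c₁) ^ q)) :
    ∫⁻ x, ENNReal.ofReal (lyapunovMajorant (u + cb / N) N K c₁ ε (resTrace u A 1 / N) q A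
      ((√N)⁻¹ • x)) ∂(Measure.pi fun _ : Fin n => ν) ≤
      ENNReal.ofReal (lyapunov u N K q A) := by
  have hδ : 0 ≤ cb / N := div_nonneg (hc₁.trans hcb) hN.le
  have hu' : (shiftMat (u + cb / N) A).PosDef := shiftMat_posDef_mono hA hu (by linarith)
  obtain ⟨i1, e1⟩ := h.integral_resolvent_quadForm hN (u + cb / N) A (q + 1)
  obtain ⟨i2, e2⟩ := h.integral_resolvent_quadForm hN (u + cb / N) A q
  have hs0 : 0 ≤ resTrace (u + cb / N) A 2 / N := div_nonneg (resTrace_nonneg hA hu' 2) hN.le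
  have hR := fun x : Fin n → ℝ => (resolv_posSemidef hu').quadForm_pow_nonneg ((√N)⁻¹ • x)
  have hT := resTrace_nonneg hA hu' q
  have i3 := ((integrable_const (resTrace (u + cb / N) A q)).add
    ((i1.add ((i2.const_mul (2 * (resTrace (u + cb / N) A 2 / N))).const_mul
    ((1 + c₁) ^ q))).const_mul (c₁ * q))).mul_const
      (Real.exp (K * (resTrace u A 1 / N - ε * (resTrace (u + cb / N) A 2 / N) / N)))
  rw [← ofReal_integral_eq_lintegral_ofReal]
  · refine ENNReal.ofReal_le_ofReal ?_
    unfold lyapunovMajorant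
    rw [integral_mul_const, integral_add (integrable_const _), integral_const_mul, integral_add i1,
      integral_const_mul, integral_const_mul, e1, e2]
    · simp only [integral_const, probReal_univ, one_smul]
      exact lyapunov_arith hN hc₁ hcb hs0 hT (resTrace_nonneg hA hu' (q + 1)) hK
        (resTrace_shift_le hA hu hδ q)
    · exact (i2.const_mul _).const_mul _
    · exact (i1.add ((i2.const_mul _).const_mul _)).const_mul _
  · exact i3
  · refine ae_of_all _ fun x => ?_
    have h1 := hR x (q + 1)
    have h2 := hR x q
    simp only [Pi.zero_apply, lyapunovMajorant]
    positivity

end RankOneStep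

/-! ### Two moving barriers and the set of controlled matrices -/

section Paths

open Matrix

theorem le_lyapunov {n : ℕ} {A : Matrix (Fin n) (Fin n) ℝ} {u g N K : ℝ} (hA : A.IsHermitian)
    (hu : (shiftMat u A).PosDef) (hg : 0 < g) (hng : ¬ (shiftMat (u - g) A).PosSemidef)
    (hN : 0 ≤ N) (hK : 0 ≤ K) (q : ℕ) : g⁻¹ ^ q ≤ lyapunov u N K q A := by
  have h6 := resTrace_nonneg hA hu 1
  have h7 : 1 ≤ Real.exp (K * (resTrace u A 1 / N)) :=
    Real.one_le_exp (mul_nonneg hK (div_nonneg h6 hN))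
  exact (eigenvalue_near_barrier hA hu hg hng q).trans
    (le_mul_of_one_le_right (resTrace_nonneg hA hu q) h7)

theorem resTrace_zero {n : ℕ} {u : ℝ} (hu : 0 < u) (a : ℕ) :
    resTrace u (0 : Matrix (Fin n) (Fin n) ℝ) a = n * u⁻¹ ^ a := by
  have : resolv u (0 : Matrix (Fin n) (Fin n) ℝ) = u⁻¹ • 1 := by
    unfold resolv
    rw [sub_zero]
    refine Matrix.inv_eq_right_inv ?_
    rw [smul_mul_smul_comm, mul_one, mul_inv_cancel₀ hu.ne', one_smul]
  rw [resTrace, this, smul_pow, one_pow, trace_smul, trace_one, Fintype.card_fin, smul_eq_mul,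
    mul_comm]

/-- Data of two moving spectral barriers for a sum of independent rank one matrices: the lower
barrier starts at `u₁` and moves at speed `cb`; the upper one starts at `u₂` and moves along the
characteristic on which the normalised Stieltjes transform equals `m₂`. -/
structure BarrierData where
  n : ℕ
  q : ℕ
  N : ℝ
  u₁ : ℝ
  cb : ℝ
  mb : ℝ
  c₁ : ℝ
  ε : ℝ
  t' : ℝ
  K : ℝ
  g : ℝ
  t : ℝ
  e : ℝ
  u₂ : ℝ
  m₂ : ℝ
  η : ℝ

namespace BarrierData

variable (d : BarrierData)

/-- The lower barrier. -/
noncomputable def bar₁ (k : ℕ) : ℝ := d.u₁ + k * (d.cb / d.N)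

/-- The upper barrier. -/
noncomputable def bar₂ (k : ℕ) : ℝ := d.u₂ + k * ((1 - d.m₂)⁻¹ / d.N)

/-- The error constant of the upper barrier. -/
noncomputable def D : ℝ := charConst d.e d.m₂

/-- The total error along the upper barrier. -/
noncomputable def E : ℝ := (d.η + d.t + 1 / d.N) * Real.exp d.D

/-- The error of the Stieltjes transform after `k` steps. -/
noncomputable def τ (k : ℕ) : ℝ := (d.η + d.t + 1 / d.N) * (1 + d.D / d.N) ^ k - d.t - 1 / d.N

/-- The compatibility conditions on barriers for a sum of `m` matrices. -/
structure Valid (m : ℕ) : Prop where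
  hN : 1 ≤ d.N
  hnN : (d.n : ℝ) ≤ d.N
  hmN : (m : ℝ) ≤ d.N
  hg : 0 < d.g
  hg1 : d.g ≤ 1
  hge : d.g ≤ d.e
  hgu : d.g ≤ d.u₁
  hmb : d.n * d.u₁⁻¹ / d.N ≤ d.mb
  hmbt : d.mb + d.t < 1
  hc₁ : (1 - (d.mb + d.t))⁻¹ ≤ d.c₁
  hε : 0 ≤ d.ε
  ht' : 0 ≤ d.t'
  ht'1 : d.t' ≤ 1
  hslack : d.c₁ * (1 + d.t') + d.ε ≤ d.cb
  hK0 : 0 ≤ d.K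
  hK : d.K * d.ε = 2 * (d.c₁ * d.q * (1 + d.c₁) ^ d.q)
  ht : 0 < d.t
  hts : d.t ≤ d.t' * (d.n * (d.u₁ + d.cb)⁻¹ ^ 2 / d.N)
  hm₂ : d.m₂ < 1
  hsep : ∀ k ≤ m, d.bar₁ k + d.e ≤ d.bar₂ k
  hη : |d.n * d.u₂⁻¹ / d.N - d.m₂| ≤ d.η
  hsmall : d.D * d.E ≤ 1 / 2

/-- The matrices that are under control after `k` steps. -/
def controlled (k : ℕ) : Set (Fin d.n → Fin d.n → ℝ) :=
  {A | (of A).PosSemidef ∧ (shiftMat (d.bar₁ k - d.g) (of A)).PosSemidef ∧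
    resTrace (d.bar₁ k) (of A) 1 / d.N ≤ d.mb ∧
    |resTrace (d.bar₂ k) (of A) 1 / d.N - d.m₂| ≤ d.τ k ∧
    |logDetShift (d.bar₂ k) (of A) / d.N - d.n / d.N * Real.log d.u₂
      - k * ((d.m₂ * (1 - d.m₂)⁻¹ + Real.log (1 - d.m₂)) / d.N)| ≤ k * (d.D / d.N * d.E)}

theorem bar₁_succ (k : ℕ) : d.bar₁ (k + 1) = d.bar₁ k + d.cb / d.N := by
  simp only [bar₁]; push_cast; ring

theorem bar₂_succ (k : ℕ) : d.bar₂ (k + 1) = d.bar₂ k + (1 - d.m₂)⁻¹ / d.N := by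
  simp only [bar₂]; push_cast; ring

theorem τ_succ (k : ℕ) :
    d.τ (k + 1) = d.τ k + d.D / d.N * (d.t + d.τ k + 1 / d.N) := by
  simp only [τ, pow_succ]; ring

variable {d} {m : ℕ} (hd : d.Valid m)
include hd

theorem Valid.N_pos : 0 < d.N := by linarith [hd.hN]

theorem Valid.c₁_nonneg : 0 ≤ d.c₁ :=
  le_trans (inv_nonneg.2 (by linarith [hd.hmbt])) hd.hc₁

theorem Valid.c₁_le_cb : d.c₁ ≤ d.cb := by
  have h := mul_nonneg hd.c₁_nonneg hd.ht'
  linarith [hd.hslack, hd.hε]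

theorem Valid.D_nonneg : 0 ≤ d.D := charConst_nonneg (hd.hg.trans_le hd.hge) hd.hm₂

theorem Valid.η_nonneg : 0 ≤ d.η := (abs_nonneg _).trans hd.hη

theorem Valid.sum_nonneg : 0 ≤ d.η + d.t + 1 / d.N := by
  have := hd.η_nonneg
  have := hd.ht
  have : 0 ≤ 1 / d.N := div_nonneg zero_le_one hd.N_pos.le
  linarith

/-- Discrete Grönwall: (1 + D/N)^k ≤ e^D for k ≤ N. -/
theorem Valid.τ_le {k : ℕ} (hk : k ≤ m) : d.t + d.τ k + 1 / d.N ≤ d.E := by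
  have h0 := hd.sum_nonneg
  have hD := hd.D_nonneg
  have hN := hd.N_pos
  have : d.t + d.τ k + 1 / d.N = (d.η + d.t + 1 / d.N) * (1 + d.D / d.N) ^ k := by
    simp only [τ]; ring
  rw [this, E]
  gcongr
  calc (1 + d.D / d.N) ^ k ≤ (Real.exp (d.D / d.N)) ^ k := by
        have : 0 ≤ d.D / d.N := by positivity
        gcongr
        linarith [Real.add_one_le_exp (d.D / d.N)]
    _ = Real.exp (k * (d.D / d.N)) := (Real.exp_nat_mul _ _).symm
    _ ≤ Real.exp d.D := by
        gcongr
        have hkN : (k : ℝ) ≤ d.N := le_trans (by exact_mod_cast hk) hd.hmN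
        calc (k : ℝ) * (d.D / d.N) ≤ d.N * (d.D / d.N) := by gcongr
          _ = d.D := by field_simp

theorem Valid.E_nonneg : 0 ≤ d.E := mul_nonneg hd.sum_nonneg (Real.exp_pos _).le

theorem Valid.zero_mem_controlled : (0 : Fin d.n → Fin d.n → ℝ) ∈ d.controlled 0 := by
  have hu1 : 0 < d.u₁ := hd.hg.trans_le hd.hgu
  have hsep := hd.hsep 0 (Nat.zero_le _)
  have hb1 : d.bar₁ 0 = d.u₁ := by simp [bar₁]
  have hb2 : d.bar₂ 0 = d.u₂ := by simp [bar₂]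
  have he : 0 < d.e := hd.hg.trans_le hd.hge
  have hu2 : 0 < d.u₂ := by rw [hb1, hb2] at hsep; linarith
  have hz : (of (0 : Fin d.n → Fin d.n → ℝ)) = (0 : Matrix (Fin d.n) (Fin d.n) ℝ) := rfl
  refine ⟨?_, ?_, ?_, ?_, ?_⟩
  · rw [hz]; exact PosSemidef.zero
  · rw [hz, hb1]
    unfold shiftMat
    rw [sub_zero]
    exact PosSemidef.one.smul (by linarith [hd.hgu])
  · rw [hz, hb1, resTrace_zero hu1, pow_one]; exact hd.hmb
  · rw [hz, hb2, resTrace_zero hu2, pow_one]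
    have : d.τ 0 = d.η := by simp only [τ]; ring
    rw [this]; exact hd.hη
  · rw [hz, hb2]
    simp only [logDetShift, shiftMat, sub_zero, Matrix.det_smul, Fintype.card_fin, det_one, mul_one,
      Real.log_pow, Nat.cast_zero, zero_mul]
    rw [mul_div_right_comm, sub_self, abs_zero]

/-- One step keeps a matrix under control unless the Lyapunov function is large. -/
theorem Valid.controlled_succ {k : ℕ} (hk : k < m) {A : Fin d.n → Fin d.n → ℝ}
    (hA : A ∈ d.controlled k) {v : Fin d.n → ℝ}
    (h1 : |v ⬝ᵥ (resolv (d.bar₁ (k + 1)) (of A) ^ 1) *ᵥ v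
      - resTrace (d.bar₁ (k + 1)) (of A) 1 / d.N| < d.t)
    (h2 : |v ⬝ᵥ (resolv (d.bar₁ (k + 1)) (of A) ^ 2) *ᵥ v
      - resTrace (d.bar₁ (k + 1)) (of A) 2 / d.N| < d.t)
    (h3 : |v ⬝ᵥ (resolv (d.bar₂ (k + 1)) (of A) ^ 1) *ᵥ v
      - resTrace (d.bar₂ (k + 1)) (of A) 1 / d.N| < d.t)
    (h4 : |v ⬝ᵥ (resolv (d.bar₂ (k + 1)) (of A) ^ 2) *ᵥ v
      - resTrace (d.bar₂ (k + 1)) (of A) 2 / d.N| < d.t) :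
    ((A + fun i j => v i * v j) ∈ d.controlled (k + 1) ∨
      d.g⁻¹ ^ d.q ≤ lyapunov (d.bar₁ (k + 1)) d.N d.K d.q (of A + vecMulVec v v)) ∧
    lyapunov (d.bar₁ (k + 1)) d.N d.K d.q (of A + vecMulVec v v) ≤
      lyapunovMajorant (d.bar₁ (k + 1)) d.N d.K d.c₁ d.ε
        (resTrace (d.bar₁ k) (of A) 1 / d.N) d.q (of A) v := by
  obtain ⟨hpsd, hgap, hmb, hτ, hl⟩ := hA
  have hN := hd.N_pos
  have hH := hpsd.isHermitian
  have hu := shiftMat_posDef_of_gap hH hd.hg hgap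
  have hcb := hd.c₁_nonneg.trans hd.c₁_le_cb
  have hδ : 0 ≤ d.cb / d.N := by positivity
  rw [pow_one] at h1 h3
  rw [bar₁_succ] at h1 h2
  have hu' : (shiftMat (d.bar₁ k + d.cb / d.N) (of A)).PosDef :=
    shiftMat_posDef_mono hH hu (by linarith)
  have hmono := resTrace_shift_le hH hu hδ 1
  have hT2 := resTrace_nonneg hH hu' 2
  have hm1 : resTrace (d.bar₁ k + d.cb / d.N) (of A) 1 / d.N ≤ d.mb := by
    refine le_trans ?_ hmb
    gcongr
    have : 0 ≤ ((1 : ℕ) : ℝ) * (d.cb / d.N) * resTrace (d.bar₁ k + d.cb / d.N) (of A) (1 + 1) := by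
      positivity
    linarith
  -- The invariant bound `mb` on the Stieltjes transform at the lower barrier keeps this form below
  -- one, so the update cannot push an eigenvalue across.
  have hh1 : v ⬝ᵥ resolv (d.bar₁ k + d.cb / d.N) (of A) *ᵥ v ≤ d.mb + d.t := by
    linarith [(abs_lt.1 h1).2]
  have hh1' : v ⬝ᵥ resolv (d.bar₁ k + d.cb / d.N) (of A) *ᵥ v < 1 := by linarith [hd.hmbt]
  have hh1c : (1 - v ⬝ᵥ resolv (d.bar₁ k + d.cb / d.N) (of A) *ᵥ v)⁻¹ ≤ d.c₁ := by
    refine le_trans ?_ hd.hc₁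
    have := hd.hmbt
    gcongr
  have hub : d.bar₁ k + d.cb / d.N ≤ d.u₁ + d.cb := by
    rw [← bar₁_succ, bar₁]
    have hkN : ((k + 1 : ℕ) : ℝ) ≤ d.N := le_trans (by exact_mod_cast hk) hd.hmN
    have : ((k + 1 : ℕ) : ℝ) * (d.cb / d.N) ≤ d.N * (d.cb / d.N) := by gcongr
    have h' : d.N * (d.cb / d.N) = d.cb := by field_simp
    linarith
  have hu1 : 0 < d.bar₁ k + d.cb / d.N := by
    have : 0 < d.bar₁ k := by
      rw [bar₁]; have := hd.hg.trans_le hd.hgu; positivity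
    linarith
  have hh2 : v ⬝ᵥ (resolv (d.bar₁ k + d.cb / d.N) (of A) ^ 2) *ᵥ v ≤
      (1 + d.t') * (resTrace (d.bar₁ k + d.cb / d.N) (of A) 2 / d.N) := by
    -- As A ≥ 0 and the barrier stays below u₁ + cb, the trace of R² is bounded below; this turns
    -- the absolute deviation t into the relative deviation t'.
    have e1 : d.t ≤ d.t' * (resTrace (d.bar₁ k + d.cb / d.N) (of A) 2 / d.N) := by
      refine hd.hts.trans ?_
      have := hd.ht'
      gcongr
      refine le_trans ?_ (le_resTrace_of_posSemidef hpsd hu' 2)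
      have := inv_nonneg.2 (hu1.le.trans hub)
      gcongr
    linarith [(abs_lt.1 h2).2]
  have hlyap := lyapunov_add_le (K := d.K) (q := d.q) hH hu hN hcb hd.hK0 hd.ht'1 hh1' hh1c hh2
    hd.hslack
  have hstep := stieltjes_barrier_step hH hu hN hcb hh1' hh1c hh2 hd.hslack
  rw [← bar₁_succ] at hlyap hstep
  refine ⟨?_, hlyap⟩
  have hpsd' : (of A + vecMulVec v v).PosSemidef :=
    hpsd.add (by simpa using posSemidef_vecMulVec_self_star v)
  have hpd' : (shiftMat (d.bar₁ (k + 1)) (of A + vecMulVec v v)).PosDef := by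
    rw [bar₁_succ]; exact shiftMat_add_vecMulVec_posDef hu' hh1'
  have hmb' : resTrace (d.bar₁ (k + 1)) (of A + vecMulVec v v) 1 / d.N ≤ d.mb := by
    refine hstep.trans (le_trans ?_ hmb)
    have hs0 : 0 ≤ resTrace (d.bar₁ (k + 1)) (of A) 2 := by rw [bar₁_succ]; exact hT2
    have := hd.hε
    have : 0 ≤ d.ε * (resTrace (d.bar₁ (k + 1)) (of A) 2 / d.N) / d.N := by positivity
    linarith
  -- Only the gap g can be lost, and then an eigenvalue within g of the barrier makes the Lyapunov
  -- function large. The upper barrier keeps the fixed gap e, since it stays at least e above the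
  -- lower one.
  by_cases hg' : (shiftMat (d.bar₁ (k + 1) - d.g) (of A + vecMulVec v v)).PosSemidef
  · left
    have he : 0 < d.e := hd.hg.trans_le hd.hge
    have hgap2 : (shiftMat (d.bar₂ k - d.e) (of A)).PosSemidef :=
      shiftMat_posSemidef_mono hH hgap (by linarith [hd.hsep k hk.le, hd.hg])
    rw [bar₂_succ] at h3 h4
    have hsm : charConst d.e d.m₂ * (d.t + d.τ k + 1 / d.N) ≤ 1 / 2 :=
      (mul_le_mul_of_nonneg_left (hd.τ_le hk.le) hd.D_nonneg).trans hd.hsmall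
    obtain ⟨c1, c2⟩ := characteristic_step hH he hgap2 hd.hN hd.hnN hd.hm₂ hd.ht.le hτ hsm h3.le
      h4.le
    rw [← bar₂_succ] at c1 c2
    have hof : of (A + fun i j => v i * v j) = of A + vecMulVec v v := rfl
    rw [controlled, Set.mem_ofPred_eq, hof]
    refine ⟨hpsd', hg', hmb', ?_, ?_⟩
    · rw [τ_succ]; exact c1
    · have c3 : charConst d.e d.m₂ / d.N * (d.t + d.τ k + 1 / d.N) ≤ d.D / d.N * d.E :=
        mul_le_mul_of_nonneg_left (hd.τ_le hk.le) (div_nonneg hd.D_nonneg hN.le)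
      have c4 := (abs_add_le _ _).trans (add_le_add (c2.trans c3) hl)
      refine le_trans (le_of_eq ?_) (c4.trans (le_of_eq ?_))
      · congr 1
        push_cast
        ring
      · push_cast; ring
  · right
    exact le_lyapunov hpsd'.isHermitian hpd' hd.hg hg' hN.le hd.hK0 d.q

end BarrierData

end Paths

/-! ### Measurability and the probability of losing control -/

section Control

open Matrix

theorem measurableSet_posSemidef (n : ℕ) :
    MeasurableSet {A : Fin n → Fin n → ℝ | (of A).PosSemidef} := by
  refine IsClosed.measurableSet ?_
  have : {A : Fin n → Fin n → ℝ | (of A).PosSemidef} =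
      {A | ∀ i j, A j i = A i j} ∩ ⋂ x : Fin n → ℝ, {A | 0 ≤ x ⬝ᵥ (of A) *ᵥ x} := by
    ext A
    simp only [Set.mem_ofPred_eq, Set.mem_inter_iff, Set.mem_iInter, posSemidef_iff_dotProduct_mulVec]
    refine and_congr ?_ ?_
    · rw [IsHermitian, ← Matrix.ext_iff]; simp
    · simp
  rw [this]
  refine IsClosed.inter ?_ (isClosed_iInter fun x => ?_)
  · simp only [Set.ofPred_forall]
    exact isClosed_iInter fun i => isClosed_iInter fun j =>
      isClosed_eq (by fun_prop) (by fun_prop)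
  · refine isClosed_le continuous_const ?_
    simp only [dotProduct, mulVec, of_apply]
    fun_prop

theorem continuous_shiftMat_of (n : ℕ) (u : ℝ) :
    Continuous fun A : Fin n → Fin n → ℝ => (shiftMat u (of A) : Fin n → Fin n → ℝ) := by
  refine continuous_pi fun i => continuous_pi fun j => ?_
  simp only [shiftMat, Matrix.sub_apply, of_apply]
  fun_prop

theorem measurableSet_gap (n : ℕ) (u : ℝ) :
    MeasurableSet {A : Fin n → Fin n → ℝ | (shiftMat u (of A)).PosSemidef} := by
  have h : Measurable fun (A : Fin n → Fin n → ℝ) (i j : Fin n) => shiftMat u (of A) i j := by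
    refine measurable_pi_lambda _ fun i => measurable_pi_lambda _ fun j => ?_
    simp only [shiftMat, Matrix.sub_apply, of_apply]
    fun_prop
  exact h (measurableSet_posSemidef n)

theorem measurable_det_shiftMat (n : ℕ) (u : ℝ) :
    Measurable fun A : Fin n → Fin n → ℝ => (shiftMat u (of A)).det := by
  refine Continuous.measurable ?_
  exact Continuous.matrix_det (continuous_shiftMat_of n u)

/-- By Cramer's rule the trace of the inverse is the inverse determinant times the trace of the
adjugate, which is measurable also across singular matrices. -/
theorem measurable_resTrace_one (n : ℕ) (u : ℝ) :
    Measurable fun A : Fin n → Fin n → ℝ => resTrace u (of A) 1 := by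
  have : (fun A : Fin n → Fin n → ℝ => resTrace u (of A) 1) =
      fun A => (shiftMat u (of A)).det⁻¹ * (shiftMat u (of A)).adjugate.trace := by
    ext A
    rw [resTrace, pow_one, resolv, Matrix.inv_def, trace_smul, smul_eq_mul, Ring.inverse_eq_inv']
    rfl
  rw [this]
  refine (measurable_det_shiftMat n u).inv.mul (Continuous.measurable ?_)
  exact (Continuous.matrix_adjugate (continuous_shiftMat_of n u)).matrix_trace

theorem measurable_logDetShift (n : ℕ) (u : ℝ) :
    Measurable fun A : Fin n → Fin n → ℝ => logDetShift u (of A) :=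
  (measurable_det_shiftMat n u).log

namespace BarrierData

variable {d : BarrierData} {m : ℕ}

theorem measurableSet_controlled (k : ℕ) : MeasurableSet (d.controlled k) := by
  refine (measurableSet_posSemidef d.n).inter (MeasurableSet.inter ?_
    (MeasurableSet.inter ?_ (MeasurableSet.inter ?_ ?_)))
  · exact measurableSet_gap d.n _
  · exact measurableSet_le ((measurable_resTrace_one _ _).div_const _) measurable_const
  · exact measurableSet_le (continuous_abs.measurable.comp
      (((measurable_resTrace_one _ _).div_const _).sub_const _)) measurable_const
  · exact measurableSet_le (continuous_abs.measurable.comp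
      ((((measurable_logDetShift _ _).div_const _).sub_const _).sub_const _)) measurable_const

/-- The rank one contribution of a column. -/
noncomputable def rankOne (n : ℕ) (N : ℝ) (x : Fin n → ℝ) : Fin n → Fin n → ℝ :=
  fun i j => ((√N)⁻¹ • x) i * ((√N)⁻¹ • x) j

theorem measurable_rankOne (n : ℕ) (N : ℝ) : Measurable (rankOne n N) := by
  unfold rankOne
  simp only [Pi.smul_apply]
  fun_prop

/-- The probability that one of the four quadratic forms of a column is atypical. -/
noncomputable def devBound (d : BarrierData) (c : NNReal) (r : ℕ) : ENNReal :=
  4 * ENNReal.ofReal ((quadConst c r * (d.g⁻¹ ^ 4 / d.N)) ^ r / d.t ^ (2 * r))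

variable {ν : Measure ℝ} {c : NNReal} [IsProbabilityMeasure ν]

/-- The exit bound applied to the controlled sets: a column is bad if one of the forms vᵀRv, vᵀR²v
at either barrier deviates by t, and the integrable majorant U is `lyapunovMajorant`. -/
theorem Valid.walkStep_le (hd : d.Valid m) (h : IsStdSubgaussian ν c) {r : ℕ} (hr : r ≠ 0) :
    (walkStep (Measure.pi fun _ : Fin d.n => ν) (rankOne d.n d.N))^[m]
      ((d.controlled m)ᶜ.indicator 1) 0 ≤
      m * (devBound d c r + ENNReal.ofReal (lyapunov d.u₁ d.N d.K d.q
        (0 : Matrix (Fin d.n) (Fin d.n) ℝ)) / ENNReal.ofReal (d.g⁻¹ ^ d.q)) := by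
  have hW0 : lyapunov d.u₁ d.N d.K d.q (0 : Matrix (Fin d.n) (Fin d.n) ℝ) =
      lyapunov (d.bar₁ 0) d.N d.K d.q (of (0 : Fin d.n → Fin d.n → ℝ)) := by
    simp [bar₁]
  rw [hW0]
  refine walkStep_iterate_indicator_le d.controlled
    (fun k A => ENNReal.ofReal (lyapunov (d.bar₁ k) d.N d.K d.q (of A))) m (devBound d c r)
    (ENNReal.ofReal (d.g⁻¹ ^ d.q)) ?_ ENNReal.ofReal_ne_top ?_ 0 hd.zero_mem_controlled
  · have := hd.hg
    simp only [ne_eq, ENNReal.ofReal_eq_zero, not_le]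
    positivity
  intro k hk A hA
  let dev (u : ℝ) (a : ℕ) : Set (Fin d.n → ℝ) :=
    {x | d.t ≤ |((√d.N)⁻¹ • x) ⬝ᵥ (resolv u (of A) ^ a) *ᵥ ((√d.N)⁻¹ • x)
      - resTrace u (of A) a / d.N|}
  have hmeas : ∀ u a, MeasurableSet (dev u a) := fun u a => measurableSet_quadForm_dev _ _ _ _
  have hH := hA.1.isHermitian
  have hN := hd.N_pos
  have hu := shiftMat_posDef_of_gap hH hd.hg hA.2.1
  have hcb := hd.c₁_nonneg.trans hd.c₁_le_cb
  have hstep1 : d.bar₁ k ≤ d.bar₁ (k + 1) := by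
    rw [bar₁_succ]; have : 0 ≤ d.cb / d.N := by positivity
    linarith
  have hgap1 : (shiftMat (d.bar₁ (k + 1) - d.g) (of A)).PosSemidef :=
    shiftMat_posSemidef_mono hH hA.2.1 (by linarith)
  have hgap2 : (shiftMat (d.bar₂ (k + 1) - d.g) (of A)).PosSemidef :=
    shiftMat_posSemidef_mono hH hgap1 (by linarith [hd.hsep (k + 1) hk, hd.hge, hd.hg])
  have hdev : ∀ u, (shiftMat (u - d.g) (of A)).PosSemidef → ∀ a ≤ 2,
      (Measure.pi fun _ : Fin d.n => ν) (dev u a) ≤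
        ENNReal.ofReal ((quadConst c r * (d.g⁻¹ ^ 4 / d.N)) ^ r / d.t ^ (2 * r)) :=
    fun u hgap a ha => h.measure_resolvent_quadForm_le hH hd.hN hd.hnN hd.hg hd.hg1 hgap ha hr hd.ht
  refine ⟨(dev (d.bar₁ (k + 1)) 1 ∪ dev (d.bar₁ (k + 1)) 2) ∪
    (dev (d.bar₂ (k + 1)) 1 ∪ dev (d.bar₂ (k + 1)) 2),
    fun x => ENNReal.ofReal (lyapunovMajorant (d.bar₁ (k + 1)) d.N d.K d.c₁ d.ε
        (resTrace (d.bar₁ k) (of A) 1 / d.N) d.q (of A) ((√d.N)⁻¹ • x)),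
    ((hmeas _ _).union (hmeas _ _)).union ((hmeas _ _).union (hmeas _ _)), ?_, ?_, ?_, ?_, ?_⟩
  · refine ENNReal.measurable_ofReal.comp ?_
    unfold lyapunovMajorant
    exact (measurable_const.add (((measurable_quadForm _ _).add
      (((measurable_quadForm _ _).const_mul _).const_mul _)).const_mul _)).mul_const _
  · refine (measure_union_le _ _).trans ((add_le_add (measure_union_le _ _)
      (measure_union_le _ _)).trans ?_)
    refine (add_le_add (add_le_add (hdev _ hgap1 1 one_le_two) (hdev _ hgap1 2 le_rfl))
      (add_le_add (hdev _ hgap2 1 one_le_two) (hdev _ hgap2 2 le_rfl))).trans (le_of_eq ?_)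
    rw [devBound]; ring
  · intro x hx
    simp only [Set.mem_union, not_or, dev, Set.mem_ofPred_eq, not_le] at hx
    obtain ⟨⟨h1, h2⟩, h3, h4⟩ := hx
    rcases (hd.controlled_succ hk hA h1 h2 h3 h4).1 with h5 | h5
    · exact Or.inl h5
    · exact Or.inr (ENNReal.ofReal_le_ofReal h5)
  · intro x hx
    simp only [Set.mem_union, not_or, dev, Set.mem_ofPred_eq, not_le] at hx
    obtain ⟨⟨h1, h2⟩, h3, h4⟩ := hx
    exact ENNReal.ofReal_le_ofReal (hd.controlled_succ hk hA h1 h2 h3 h4).2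
  · simp only [bar₁_succ]
    exact h.lintegral_lyapunovMajorant_le hH hu hN hd.c₁_nonneg hd.c₁_le_cb hd.hK

/-- With high probability the sum of the rank one contributions of independent columns is under
control. -/
theorem Valid.measure_not_controlled_le (hd : d.Valid m) (h : IsStdSubgaussian ν c)
    {Ω : Type*} [MeasurableSpace Ω] {P : Measure Ω} [IsProbabilityMeasure P]
    {X : ℕ → Ω → Fin d.n → ℝ} (hX : ∀ j, Measurable (X j)) (hind : iIndepFun X P)
    (hlaw : ∀ j, P.map (X j) = Measure.pi fun _ : Fin d.n => ν) {r : ℕ} (hr : r ≠ 0) :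
    P {ω | ∑ j ∈ Finset.range m, rankOne d.n d.N (X j ω) ∉ d.controlled m} ≤
      m * (devBound d c r + ENNReal.ofReal (lyapunov d.u₁ d.N d.K d.q
        (0 : Matrix (Fin d.n) (Fin d.n) ℝ)) / ENNReal.ofReal (d.g⁻¹ ^ d.q)) := by
  refine le_trans (le_of_eq ?_) (hd.walkStep_le h hr)
  rw [← lintegral_sum_range_eq_walkStep_iterate (measurable_rankOne _ _) hX hind hlaw
    (measurable_one.indicator (measurableSet_controlled m).compl)]
  have hs : Measurable fun ω => ∑ j ∈ Finset.range m, rankOne d.n d.N (X j ω) :=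
    Finset.measurable_fun_sum _ fun j _ => (measurable_rankOne _ _).comp (hX j)
  exact (lintegral_indicator_one (hs (measurableSet_controlled m).compl)).symm

end BarrierData

end Control

/-! ### Independence of the columns -/

section Columns

variable {Ω : Type*} [MeasurableSpace Ω] {P : Measure Ω} [IsProbabilityMeasure P]
  {ν : Measure ℝ} {ξ : ℕ → ℕ → Ω → ℝ}

/-- The law of a column of an array with independent entries. -/
theorem map_column_eq_pi (hm : ∀ i j, Measurable (ξ i j))
    (hind : iIndepFun (fun (p : ℕ × ℕ) (ω : Ω) => ξ p.1 p.2 ω) P)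
    (hlaw : ∀ i j, P.map (ξ i j) = ν) (n j : ℕ) :
    P.map (fun ω (i : Fin n) => ξ i j ω) = Measure.pi fun _ : Fin n => ν := by
  have h1 : iIndepFun (fun (i : Fin n) ω => ξ i j ω) P :=
    hind.precomp (g := fun i : Fin n => ((i : ℕ), j)) fun a b h => Fin.ext (Prod.ext_iff.1 h).1
  rw [(iIndepFun_iff_map_fun_eq_pi_map fun i : Fin n => (hm i j).aemeasurable).1 h1]
  simp only [hlaw]

/-- The columns of an array with independent entries are independent. -/
theorem iIndepFun_columns (hm : ∀ i j, Measurable (ξ i j))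
    (hind : iIndepFun (fun (p : ℕ × ℕ) (ω : Ω) => ξ p.1 p.2 ω) P) (n : ℕ) :
    iIndepFun (fun (j : ℕ) ω (i : Fin n) => ξ i j ω) P := by
  have hprob : ∀ i j, IsProbabilityMeasure (P.map (ξ i j)) :=
    fun i j => Measure.isProbabilityMeasure_map (hm i j).aemeasurable
  have h1 : iIndepFun (fun (p : (_ : ℕ) × Fin n) ω => ξ p.2 p.1 ω) P :=
    hind.precomp (g := fun p : (_ : ℕ) × Fin n => ((p.2 : ℕ), p.1)) fun a b h => by
      obtain ⟨a1, a2⟩ := a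
      obtain ⟨b1, b2⟩ := b
      simp only [Prod.mk.injEq] at h
      obtain ⟨h1, rfl⟩ := h
      rw [Fin.ext h1]
  have h2 : ∀ j, iIndepFun (fun (i : Fin n) ω => ξ i j ω) P := fun j =>
    hind.precomp (g := fun i : Fin n => ((i : ℕ), j)) fun a b h => Fin.ext (Prod.ext_iff.1 h).1
  have h3 : (MeasurableEquiv.piCurry fun (_ : ℕ) (_ : Fin n) => ℝ) ∘
      (fun ω (p : (_ : ℕ) × Fin n) => ξ p.2 p.1 ω) = fun ω j (i : Fin n) => ξ i j ω := by
    ext; simp [Sigma.curry]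
  rw [iIndepFun_iff_map_fun_eq_infinitePi_map (by fun_prop), ← h3,
    ← Measure.map_map (by fun_prop) (by fun_prop),
    (iIndepFun_iff_map_fun_eq_infinitePi_map (by fun_prop)).1 h1,
    Measure.infinitePi_map_piCurry (fun (j : ℕ) (i : Fin n) => P.map (ξ i j))]
  congr 1
  ext1 j
  exact ((iIndepFun_iff_map_fun_eq_infinitePi_map (by fun_prop)).1 (h2 j)).symm

end Columns

/-! ### Limits of the sizes and the explicit spectral quantities -/

section Limits

/-- Pairs of sizes tending to infinity with the ratio of the first to the total tending to `α`. -/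
noncomputable def sizeFilter (α : ℝ) : Filter (ℕ × ℕ) :=
  (atTop ×ˢ atTop) ⊓ comap (fun p : ℕ × ℕ => (p.1 : ℝ) / ((p.1 : ℝ) + p.2)) (𝓝 α)

theorem tendsto_sizeFilter {α : ℝ} {ι : Type*} {l : Filter ι} {N₁ N₂ : ι → ℕ}
    (h1 : Tendsto N₁ l atTop) (h2 : Tendsto N₂ l atTop)
    (h : Tendsto (fun n => (N₁ n : ℝ) / ((N₁ n : ℝ) + (N₂ n : ℝ))) l (𝓝 α)) :
    Tendsto (fun n => (N₁ n, N₂ n)) l (sizeFilter α) :=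
  tendsto_inf.2 ⟨h1.prodMk h2, tendsto_comap_iff.2 h⟩

variable {α : ℝ}

theorem tendsto_ratio : Tendsto (fun p : ℕ × ℕ => (p.1 : ℝ) / ((p.1 : ℝ) + p.2)) (sizeFilter α)
    (𝓝 α) := tendsto_comap.mono_left inf_le_right

theorem tendsto_fst_sizeFilter : Tendsto (fun p : ℕ × ℕ => (p.1 : ℝ)) (sizeFilter α) atTop :=
  tendsto_natCast_atTop_atTop.comp (tendsto_fst.mono_left inf_le_left)

theorem tendsto_snd_sizeFilter : Tendsto (fun p : ℕ × ℕ => (p.2 : ℝ)) (sizeFilter α) atTop :=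
  tendsto_natCast_atTop_atTop.comp (tendsto_snd.mono_left inf_le_left)

theorem tendsto_size : Tendsto (fun p : ℕ × ℕ => (p.1 : ℝ) + p.2) (sizeFilter α) atTop :=
  tendsto_fst_sizeFilter.atTop_add_atTop tendsto_snd_sizeFilter

theorem tendsto_ratio' : Tendsto (fun p : ℕ × ℕ => (p.2 : ℝ) / ((p.1 : ℝ) + p.2)) (sizeFilter α)
    (𝓝 (1 - α)) := by
  refine (tendsto_ratio.const_sub 1).congr' ?_
  filter_upwards [tendsto_size.eventually_gt_atTop 0] with p hp
  field_simp
  ring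

/-- The point to which the characteristic started at `α + w` leads. -/
noncomputable def specPoint (α w : ℝ) : ℝ := 1 + w + α * (1 - α) / w

/-- The limit of the normalised Stieltjes transform at `specPoint α w`. -/
noncomputable def limStieltjes (α w : ℝ) : ℝ := α / (α + w)

/-- The limit of the normalised logarithmic determinant at `specPoint α w`. -/
noncomputable def limLogDet (α w : ℝ) : ℝ :=
  α * Real.log (α + w) + (1 - α) * (limStieltjes α w * (1 - limStieltjes α w)⁻¹
    + Real.log (1 - limStieltjes α w))

theorem one_sub_limStieltjes {w : ℝ} (h : α + w ≠ 0) : 1 - limStieltjes α w = w / (α + w) := by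
  rw [limStieltjes]; field_simp; ring

theorem inv_one_sub_limStieltjes {w : ℝ} (h : α + w ≠ 0) (hw : w ≠ 0) :
    (1 - limStieltjes α w)⁻¹ = 1 + α / w := by
  rw [one_sub_limStieltjes h]; field_simp; ring

/-- The endpoint of the characteristic: it starts at α + w and runs for time 1 - α, the limit of
N₂/N, at speed (1 - m)⁻¹. -/
theorem specPoint_eq {w : ℝ} (h : α + w ≠ 0) (hw : w ≠ 0) :
    specPoint α w = α + w + (1 - α) * (1 - limStieltjes α w)⁻¹ := by
  rw [inv_one_sub_limStieltjes h hw, specPoint]; field_simp; ring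

/-- The derivative 1 - α(1-α)/w² is positive beyond w = √(α(1-α)), the parameter of the spectral
edge; characteristics do not cross there. -/
theorem specPoint_lt {w w' : ℝ} (hw : 0 < w) (hw2 : α * (1 - α) < w ^ 2) (h : w < w') :
    specPoint α w < specPoint α w' := by
  have hw' : 0 < w' := hw.trans h
  have h1 : specPoint α w' - specPoint α w = (w' - w) * (w * w' - α * (1 - α)) / (w * w') := by
    rw [specPoint, specPoint]; field_simp; ring
  have h2 : 0 < (w' - w) * (w * w' - α * (1 - α)) / (w * w') := by
    have h3 : 0 < w' - w := by linarith
    have h4 : 0 < w * w' - α * (1 - α) := by nlinarith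
    positivity
  linarith

/-- A slack for the lower barrier. -/
theorem exists_barrier_slack {a κ : ℝ} (ha : a < 1) (hκ : 0 < κ) :
    ∃ δ : ℝ, 0 < δ ∧ δ ≤ 1 ∧ a + 2 * δ < 1 ∧
      (1 - (a + 2 * δ))⁻¹ * (1 + δ) + δ < (1 - a)⁻¹ + κ := by
  have h1 : ∀ᶠ δ : ℝ in 𝓝 0, a + 2 * δ < 1 := by
    have : Tendsto (fun δ : ℝ => a + 2 * δ) (𝓝 0) (𝓝 (a + 2 * 0)) := by
      apply Continuous.tendsto; fun_prop
    rw [mul_zero, add_zero] at this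
    exact this.eventually_lt_const ha
  have h2 : ∀ᶠ δ : ℝ in 𝓝 0, (1 - (a + 2 * δ))⁻¹ * (1 + δ) + δ < (1 - a)⁻¹ + κ := by
    have : ContinuousAt (fun δ : ℝ => (1 - (a + 2 * δ))⁻¹ * (1 + δ) + δ) 0 := by
      have : (1 - (a + 2 * (0 : ℝ))) ≠ 0 := by rw [mul_zero]; linarith
      fun_prop (disch := assumption)
    refine this.tendsto.eventually_lt_const ?_
    simp [hκ]
  have h3 : ∀ᶠ δ : ℝ in 𝓝 0, δ < 1 := eventually_lt_nhds one_pos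
  obtain ⟨δ, ⟨⟨h1, h2⟩, h3⟩, h4⟩ := (((h1.and h2).and h3).filter_mono nhdsWithin_le_nhds |>.and
    (self_mem_nhdsWithin (a := (0 : ℝ)) (s := Set.Ioi 0))).exists
  exact ⟨δ, h4, h3.le, h1, h2⟩

end Limits

/-! ### Choice of the barriers -/

section Parameters

open BarrierData

/-- The parameters of the two barriers that do not depend on the sizes. -/
structure BarrierParams (α w : ℝ) where
  u₁ : ℝ
  cb : ℝ
  mb : ℝ
  c₁ : ℝ
  δ : ℝ
  e : ℝ
  u₁_pos : 0 < u₁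
  cb_pos : 0 < cb
  e_pos : 0 < e
  δ_pos : 0 < δ
  δ_le : δ ≤ 1
  c₁_nonneg : 0 ≤ c₁
  start : α * u₁⁻¹ < mb
  mbδ : mb + δ < 1
  hc₁ : (1 - (mb + δ))⁻¹ ≤ c₁
  slack : c₁ * (1 + δ) + δ ≤ cb
  sep_start : u₁ + e < α + w
  sep_end : u₁ + (1 - α) * cb + e < specPoint α w

/-- The lower barrier starts on the characteristic of some w₁ strictly between √(α(1-α)) and w, and
moves slightly faster. Since characteristics do not cross in this range, it ends strictly below
`specPoint α w` if the excess speed is small against the distance of the endpoints. -/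
theorem exists_barrierParams {α w : ℝ} (h0 : 0 < α) (h1 : α < 1) (hw : 0 < w)
    (hw2 : α * (1 - α) < w ^ 2) : Nonempty (BarrierParams α w) := by
  have hs : √(α * (1 - α)) < w := by
    rw [Real.sqrt_lt' hw]; exact hw2
  obtain ⟨w₁, hw1, hw1'⟩ := exists_between hs
  have hs0 := Real.sqrt_nonneg (α * (1 - α))
  have hw10 : 0 < w₁ := by linarith
  have hw12 : α * (1 - α) < w₁ ^ 2 := by rwa [Real.sqrt_lt' hw10] at hw1
  have hlt := specPoint_lt hw10 hw12 hw1'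
  set κ := (specPoint α w - specPoint α w₁) / 3 with hκ
  have hκ0 : 0 < κ := by rw [hκ]; linarith
  have ha : limStieltjes α w₁ < 1 := by
    rw [limStieltjes, div_lt_one (by linarith)]; linarith
  obtain ⟨δ, hδ, hδ1, ha2, hc⟩ := exists_barrier_slack ha hκ0
  have hpos : 0 < (1 - (limStieltjes α w₁ + 2 * δ))⁻¹ := inv_pos.2 (by linarith)
  have hmin : 0 < min κ (w - w₁) := lt_min hκ0 (by linarith)
  refine ⟨⟨α + w₁, (1 - (limStieltjes α w₁ + 2 * δ))⁻¹ * (1 + δ) + δ, limStieltjes α w₁ + δ,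
    (1 - (limStieltjes α w₁ + 2 * δ))⁻¹, δ, min κ (w - w₁) / 2, by linarith, by positivity,
    by positivity, hδ, hδ1, hpos.le, ?_, by linarith, ?_, le_rfl, ?_, ?_⟩⟩
  · rw [limStieltjes, div_eq_mul_inv]; linarith
  · rw [add_assoc, ← two_mul]
  · have := min_le_right κ (w - w₁)
    linarith
  · have h2 := min_le_left κ (w - w₁)
    have h3 := specPoint_eq (α := α) (w := w₁) (by linarith) hw10.ne'
    have h4 : (1 - α) * ((1 - (limStieltjes α w₁ + 2 * δ))⁻¹ * (1 + δ) + δ) ≤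
        (1 - α) * ((1 - limStieltjes α w₁)⁻¹ + κ) := by
      have : 0 ≤ 1 - α := by linarith
      gcongr
    have h5 : (1 - α) * κ ≤ κ := mul_le_of_le_one_left hκ0.le (by linarith)
    linarith

variable {α w : ℝ}

/-- The barriers for an array with `p.1` rows and `p.2` columns, up to the accuracy `ρ`. -/
noncomputable def BarrierParams.toData (b : BarrierParams α w) (t ρ : ℝ) (p : ℕ × ℕ) :
    BarrierData where
  n := p.1
  -- With g⁻¹ = N^(1/8) the threshold g⁻⁴⁸ is N⁶. The Lyapunov function starts at O(N) and there are
  -- at most N steps, so the failure probability is O(N⁻⁴).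
  q := 48
  N := (p.1 : ℝ) + p.2
  u₁ := b.u₁
  cb := b.cb
  mb := b.mb
  c₁ := b.c₁
  ε := b.δ
  t' := b.δ
  K := 2 * (b.c₁ * (48 : ℕ) * (1 + b.c₁) ^ 48) / b.δ
  g := (((p.1 : ℝ) + p.2) ^ (1 / 8 : ℝ))⁻¹
  t := t
  e := b.e
  -- Traced back from the endpoint, so that the upper barrier ends exactly at `specPoint α w`; only
  -- the start depends on the sizes, and it tends to α + w.
  u₂ := specPoint α w - p.2 * ((1 - limStieltjes α w)⁻¹ / ((p.1 : ℝ) + p.2))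
  m₂ := limStieltjes α w
  η := ρ

theorem tendsto_start (h0 : 0 < α) (hw : 0 < w) :
    Tendsto (fun p : ℕ × ℕ => specPoint α w -
      p.2 * ((1 - limStieltjes α w)⁻¹ / ((p.1 : ℝ) + p.2))) (sizeFilter α) (𝓝 (α + w)) := by
  have h := (tendsto_ratio' (α := α)).mul_const ((1 - limStieltjes α w)⁻¹)
  have h2 := h.const_sub (specPoint α w)
  rw [specPoint_eq (by linarith) hw.ne', add_sub_cancel_right] at h2
  rw [specPoint_eq (by linarith) hw.ne']
  refine h2.congr fun p => ?_
  ring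

theorem BarrierParams.eventually_valid (b : BarrierParams α w) (h0 : 0 < α) (h1 : α < 1)
    (hw : 0 < w) {t ρ : ℝ} (ht : 0 < t) (htδ : t ≤ b.δ)
    (hts : t ≤ b.δ * (α / 2 * (b.u₁ + b.cb)⁻¹ ^ 2)) (hρ : 0 < ρ)
    (hsmall : charConst b.e (limStieltjes α w) *
      ((ρ + t + ρ) * Real.exp (charConst b.e (limStieltjes α w))) ≤ 1 / 2) :
    ∀ᶠ p in sizeFilter α, (b.toData t ρ p).Valid p.2 := by
  have hm2 : limStieltjes α w < 1 := by
    rw [limStieltjes, div_lt_one (by linarith)]; linarith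
  have hg : Tendsto (fun p : ℕ × ℕ => (((p.1 : ℝ) + p.2) ^ (1 / 8 : ℝ))⁻¹) (sizeFilter α)
      (𝓝 0) :=
    tendsto_inv_atTop_zero.comp ((tendsto_rpow_atTop (by norm_num)).comp tendsto_size)
  have hst := tendsto_start (α := α) (w := w) h0 hw
  have hn1 : Tendsto (fun p : ℕ × ℕ => (p.1 : ℝ) * b.u₁⁻¹ / ((p.1 : ℝ) + p.2)) (sizeFilter α)
      (𝓝 (α * b.u₁⁻¹)) := by
    refine (tendsto_ratio.mul_const b.u₁⁻¹).congr fun p => ?_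
    ring
  have hn2 : Tendsto (fun p : ℕ × ℕ => |(p.1 : ℝ) * (specPoint α w -
      p.2 * ((1 - limStieltjes α w)⁻¹ / ((p.1 : ℝ) + p.2)))⁻¹ / ((p.1 : ℝ) + p.2)
        - limStieltjes α w|) (sizeFilter α) (𝓝 0) := by
    have := ((tendsto_ratio.mul (hst.inv₀ (by linarith))).sub_const (limStieltjes α w)).abs
    rw [limStieltjes, ← div_eq_mul_inv, sub_self, abs_zero] at this
    refine this.congr fun p => ?_
    rw [limStieltjes]
    congr 1
    ring
  have he : Tendsto (fun p : ℕ × ℕ => b.u₁ + (p.2 : ℝ) * (b.cb / ((p.1 : ℝ) + p.2)) + b.e)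
      (sizeFilter α) (𝓝 (b.u₁ + (1 - α) * b.cb + b.e)) := by
    refine (((tendsto_ratio'.mul_const b.cb).const_add b.u₁).add_const b.e).congr fun p => ?_
    ring
  filter_upwards [tendsto_size.eventually_ge_atTop 1, tendsto_size.eventually_gt_atTop ρ⁻¹,
    hg.eventually_lt_const one_pos, hg.eventually_lt_const b.e_pos,
    hg.eventually_lt_const b.u₁_pos, hst.eventually_const_lt b.sep_start,
    hn1.eventually_lt_const b.start, hn2.eventually_lt_const hρ, he.eventually_lt_const b.sep_end,
    tendsto_ratio.eventually_const_lt (show α / 2 < α by linarith)] with p q1 q2 q3 q4 q5 q6 q7 q8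
    q9 q10
  have hN : 0 < (p.1 : ℝ) + p.2 := by linarith
  have hmbt : b.mb + t ≤ b.mb + b.δ := by linarith
  have hmbδ := b.mbδ
  have hN1 : 1 / ((p.1 : ℝ) + p.2) ≤ ρ := by
    rw [one_div, inv_le_comm₀ hN hρ]; exact q2.le
  have hD := charConst_nonneg b.e_pos hm2
  have hucb : 0 ≤ (b.u₁ + b.cb)⁻¹ := inv_nonneg.2 (add_pos b.u₁_pos b.cb_pos).le
  refine ⟨q1, ?_, ?_, ?_, q3.le, q4.le, q5.le, q7.le, hmbt.trans_lt hmbδ, ?_, b.δ_pos.le,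
    b.δ_pos.le, b.δ_le, b.slack, ?_, ?_, ht, ?_, hm2, ?_, q8.le, ?_⟩
  · simp [toData]
  · simp [toData]
  · simp only [toData]; positivity
  · refine le_trans ?_ b.hc₁
    simp only [toData]
    have : 0 < 1 - (b.mb + b.δ) := by linarith
    gcongr
  · have := b.c₁_nonneg
    have := b.δ_pos
    simp only [toData]; positivity
  · have := b.δ_pos
    simp only [toData]; field_simp
  · refine hts.trans ?_
    simp only [toData]
    have := b.δ_pos.le
    rw [mul_div_right_comm]
    gcongr
  · intro k hk
    simp only [bar₁, bar₂, toData]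
    have hk' : (k : ℝ) ≤ p.2 := by exact_mod_cast hk
    rcases Nat.eq_zero_or_pos p.2 with h | h
    · have : k = 0 := by omega
      subst this
      simp only [Nat.cast_zero, zero_mul, add_zero]
      exact q6.le
    have h2 : (0 : ℝ) < p.2 := by exact_mod_cast h
    -- Both barriers are affine in k, so separation at the two ends gives separation in between.
    set x := (k : ℝ) / p.2 with hx
    have hx0 : 0 ≤ x := by positivity
    have hx1 : x ≤ 1 := (div_le_one h2).2 hk'
    have hkx : (k : ℝ) = x * p.2 := by rw [hx]; field_simp
    have e1 := mul_le_mul_of_nonneg_left q9.le hx0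
    have e2 := mul_le_mul_of_nonneg_left q6.le (sub_nonneg.2 hx1)
    rw [hkx]
    linarith
  · refine le_trans ?_ hsmall
    simp only [D, E, toData]
    gcongr

end Parameters

/-! ### From controlled matrices to spectral control, with rates -/

section Bounds

open Matrix BarrierData

/-- The spectrum lies below `specPoint α w - e`, and at `specPoint α w` the normalised Stieltjes
transform and logarithmic determinant are within `ε` of their limits. -/
structure SpectralControl (α w e ε N : ℝ) {n : ℕ} (A : Matrix (Fin n) (Fin n) ℝ) : Prop where
  posSemidef : A.PosSemidef
  gap : (shiftMat (specPoint α w - e) A).PosSemidef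
  stieltjes : |resTrace (specPoint α w) A 1 / N - limStieltjes α w| ≤ ε
  logDet : |logDetShift (specPoint α w) A / N - limLogDet α w| ≤ ε

theorem BarrierParams.spectralControl_of_mem {α w : ℝ} (b : BarrierParams α w) {t ρ ε : ℝ}
    {p : ℕ × ℕ} (hd : (b.toData t ρ p).Valid p.2) (hN : ((p.1 : ℝ) + p.2)⁻¹ ≤ ρ)
    (hE : (ρ + t + ρ) * Real.exp (charConst b.e (limStieltjes α w)) ≤ ε)
    (hDE : charConst b.e (limStieltjes α w) *
      ((ρ + t + ρ) * Real.exp (charConst b.e (limStieltjes α w))) ≤ ε / 2)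
    (hlog : |(p.1 : ℝ) / ((p.1 : ℝ) + p.2) * Real.log (specPoint α w -
      p.2 * ((1 - limStieltjes α w)⁻¹ / ((p.1 : ℝ) + p.2)))
      + p.2 / ((p.1 : ℝ) + p.2) * (limStieltjes α w * (1 - limStieltjes α w)⁻¹
      + Real.log (1 - limStieltjes α w)) - limLogDet α w| ≤ ε / 2)
    {A : Fin p.1 → Fin p.1 → ℝ} (hA : A ∈ (b.toData t ρ p).controlled p.2) :
    SpectralControl α w b.e ε ((p.1 : ℝ) + p.2) (of A) := by
  obtain ⟨h1, h2, -, h4, h5⟩ := hA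
  have hN0 : 0 < (p.1 : ℝ) + p.2 := hd.N_pos
  have hEE : (b.toData t ρ p).E ≤
      (ρ + t + ρ) * Real.exp (charConst b.e (limStieltjes α w)) := by
    simp only [E, D, toData, one_div]
    gcongr
  have hb : (b.toData t ρ p).bar₂ p.2 = specPoint α w := by
    simp only [bar₂, toData]; ring
  have hsep := hd.hsep p.2 le_rfl
  have hg := hd.hg
  rw [hb] at h4 h5 hsep
  refine ⟨h1, ?_, ?_, ?_⟩
  · refine shiftMat_posSemidef_mono h1.isHermitian h2 ?_
    have he : (b.toData t ρ p).e = b.e := rfl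
    rw [he] at hsep
    linarith
  · refine h4.trans ?_
    have := hd.τ_le (le_refl p.2)
    have := hd.ht
    have : 0 ≤ 1 / (b.toData t ρ p).N := div_nonneg zero_le_one hN0.le
    linarith
  · have hD0 := hd.D_nonneg
    have h6 : (p.2 : ℝ) * ((b.toData t ρ p).D / (b.toData t ρ p).N * (b.toData t ρ p).E) ≤
        ε / 2 := by
      have hE0 := hd.E_nonneg
      have hNp := hd.N_pos
      calc (p.2 : ℝ) * ((b.toData t ρ p).D / (b.toData t ρ p).N * (b.toData t ρ p).E)
          ≤ (b.toData t ρ p).N * ((b.toData t ρ p).D / (b.toData t ρ p).N *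
            (b.toData t ρ p).E) := by
            gcongr; exact hd.hmN
        _ = (b.toData t ρ p).D * (b.toData t ρ p).E := by field_simp
        _ ≤ (b.toData t ρ p).D *
          ((ρ + t + ρ) * Real.exp (charConst b.e (limStieltjes α w))) := by gcongr
        _ ≤ ε / 2 := hDE
    have h7 := (abs_add_le _ _).trans (add_le_add (h5.trans h6) hlog)
    refine le_trans (le_of_eq ?_) (h7.trans (add_halves ε).le)
    have h8 : ∀ x y z N l q L : ℝ,
        x / N - L = x / N - y / N * z - q * (l / N) + (y / N * z + q / N * l - L) := by
      intros; ring
    exact congrArg abs (h8 _ _ _ _ _ _ _)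

/-- For s = N^(1/8) and moment order r = 12, a deviation has probability O((s⁴/N)¹²) = O(N⁻⁶), and
the Lyapunov term is O(N/s⁴⁸) = O(N⁻⁵). At most N steps give O(N⁻⁴), enough for summability over
pairs. -/
theorem BarrierParams.failure_bound {α w : ℝ} (b : BarrierParams α w) {t ρ : ℝ} (ht : 0 < t)
    (c : NNReal) : ∃ C : ℝ, 0 ≤ C ∧ ∀ p : ℕ × ℕ, (b.toData t ρ p).Valid p.2 →
      (p.2 : ENNReal) * (devBound (b.toData t ρ p) c 12 + ENNReal.ofReal (lyapunov
        (b.toData t ρ p).u₁ (b.toData t ρ p).N (b.toData t ρ p).K (b.toData t ρ p).q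
        (0 : Matrix (Fin p.1) (Fin p.1) ℝ)) /
        ENNReal.ofReal ((b.toData t ρ p).g⁻¹ ^ (b.toData t ρ p).q)) ≤
      ENNReal.ofReal (C / ((p.1 : ℝ) + p.2) ^ 4) := by
  set Q := 4 * (quadConst c 12 ^ 12 / t ^ 24) with hQ
  have hQ0 : 0 ≤ Q := by have := quadConst_nonneg c 12; positivity
  set K := 2 * (b.c₁ * (48 : ℕ) * (1 + b.c₁) ^ 48) / b.δ with hK
  have hK0 : 0 ≤ K := by have := b.c₁_nonneg; have := b.δ_pos; positivity
  set B := b.u₁⁻¹ ^ 48 * Real.exp (K * b.u₁⁻¹) with hB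
  have hu := b.u₁_pos
  have hB0 : 0 ≤ B := by positivity
  refine ⟨Q + B, by positivity, fun p hd => ?_⟩
  have hN1 : 1 ≤ (p.1 : ℝ) + p.2 := hd.hN
  set N := (p.1 : ℝ) + p.2 with hN
  have hN0 : 0 < N := by linarith
  set s := N ^ (1 / 8 : ℝ) with hs
  have hs1 : 1 ≤ s := Real.one_le_rpow hN1 (by norm_num)
  have hs0 : 0 < s := by linarith
  have hs8 : s ^ 8 = N := by
    rw [hs, ← Real.rpow_natCast, ← Real.rpow_mul hN0.le]; norm_num
  have hg : (b.toData t ρ p).g⁻¹ = s := by simp [toData, hs, hN]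
  have hq : (b.toData t ρ p).q = 48 := rfl
  have hL : lyapunov (b.toData t ρ p).u₁ (b.toData t ρ p).N (b.toData t ρ p).K 48
      (0 : Matrix (Fin p.1) (Fin p.1) ℝ) ≤ N * B := by
    have hp : (p.1 : ℝ) ≤ N := hd.hnN
    simp only [lyapunov, toData]
    rw [resTrace_zero hu, resTrace_zero hu, hB, pow_one, mul_assoc]
    have h1 : (p.1 : ℝ) * b.u₁⁻¹ / N ≤ b.u₁⁻¹ := by
      rw [div_le_iff₀ hN0, mul_comm]
      gcongr
    gcongr
  have hdev : devBound (b.toData t ρ p) c 12 = ENNReal.ofReal (Q / s ^ 48) := by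
    rw [devBound, hg, show (4 : ENNReal) = ENNReal.ofReal 4 by norm_num,
      ← ENNReal.ofReal_mul (by norm_num)]
    congr 1
    have : (b.toData t ρ p).N = s ^ 8 := hs8.symm
    rw [this, hQ]
    simp only [toData]
    field_simp
  rw [hdev, hg, hq, ← ENNReal.ofReal_div_of_pos (by positivity),
    ← ENNReal.ofReal_add (by positivity) (by
      refine div_nonneg (mul_nonneg ?_ (Real.exp_pos _).le) (by positivity)
      rw [show (b.toData t ρ p).u₁ = b.u₁ from rfl, resTrace_zero hu]; positivity),
    ← ENNReal.ofReal_natCast, ← ENNReal.ofReal_mul (by positivity)]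
  refine ENNReal.ofReal_le_ofReal ?_
  have hp2 : (p.2 : ℝ) ≤ N := hd.hmN
  calc (p.2 : ℝ) * (Q / s ^ 48 + lyapunov (b.toData t ρ p).u₁ (b.toData t ρ p).N
        (b.toData t ρ p).K 48 (0 : Matrix (Fin p.1) (Fin p.1) ℝ) / s ^ 48)
      ≤ p.2 * (Q / s ^ 48 + N * B / s ^ 48) := by gcongr
    _ ≤ N * (Q / s ^ 48 + N * B / s ^ 48) := by gcongr
    _ = Q / s ^ 40 + B / s ^ 32 := by rw [← hs8]; field_simp
    _ ≤ Q / s ^ 32 + B / s ^ 32 := by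
        gcongr
        norm_num
    _ = (Q + B) / N ^ 4 := by rw [← hs8]; field_simp

end Bounds

/-! ### Borel–Cantelli over all pairs of sizes -/

section AlmostSure

open Matrix BarrierData

variable {Ω : Type*} [MeasurableSpace Ω] {P : Measure Ω} [IsProbabilityMeasure P]
  {ν : Measure ℝ} {c : NNReal} {ξ : ℕ → ℕ → Ω → ℝ}

/-- The sample covariance matrix of the first `n` rows and `m` columns. -/
noncomputable def sampleCov (ξ : ℕ → ℕ → Ω → ℝ) (p : ℕ × ℕ) (ω : Ω) :
    Matrix (Fin p.1) (Fin p.1) ℝ :=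
  of (∑ j ∈ Finset.range p.2,
    rankOne p.1 ((p.1 : ℝ) + p.2) (fun i : Fin p.1 => ξ i j ω))

theorem exists_measure_not_spectralControl_le [IsProbabilityMeasure ν]
    (hν : IsStdSubgaussian ν c) (hm : ∀ i j, Measurable (ξ i j))
    (hind : iIndepFun (fun (p : ℕ × ℕ) (ω : Ω) => ξ p.1 p.2 ω) P)
    (hlaw : ∀ i j, P.map (ξ i j) = ν) {α w : ℝ} (h0 : 0 < α) (h1 : α < 1) (hw : 0 < w)
    (b : BarrierParams α w) {ε : ℝ} (hε : 0 < ε) :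
    ∃ C : ℝ, 0 ≤ C ∧ ∀ᶠ p in sizeFilter α,
      P {ω | ¬ SpectralControl α w b.e ε ((p.1 : ℝ) + p.2) (sampleCov ξ p ω)} ≤
        ENNReal.ofReal (C / ((p.1 : ℝ) + p.2) ^ 4) := by
  have hm2 : limStieltjes α w < 1 := by
    rw [limStieltjes, div_lt_one (by linarith)]; linarith
  set D := charConst b.e (limStieltjes α w) with hD
  have hD0 : 0 ≤ D := charConst_nonneg b.e_pos hm2
  have hmin : 0 < min ε 1 := lt_min hε one_pos
  -- As t ≤ ρ, the total error is at most 3ρe^D = min ε 1 / (2(1 + D)); so the error and D times the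
  -- error are both at most min ε 1 / 2.
  set ρ := min ε 1 / (6 * (1 + D) * Real.exp D) with hρ
  have hρ0 : 0 < ρ := by positivity
  set t := min ρ (min b.δ (b.δ * (α / 2 * (b.u₁ + b.cb)⁻¹ ^ 2))) with ht
  have ht0 : 0 < t := by
    have := b.δ_pos; have := b.u₁_pos; have := b.cb_pos
    refine lt_min hρ0 (lt_min b.δ_pos (by positivity))
  have htρ : t ≤ ρ := min_le_left _ _
  have htδ : t ≤ b.δ := (min_le_right _ _).trans (min_le_left _ _)
  have hts : t ≤ b.δ * (α / 2 * (b.u₁ + b.cb)⁻¹ ^ 2) := (min_le_right _ _).trans (min_le_right _ _)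
  have hE : (ρ + t + ρ) * Real.exp D ≤ min ε 1 / (2 * (1 + D)) := by
    calc (ρ + t + ρ) * Real.exp D ≤ (ρ + ρ + ρ) * Real.exp D := by gcongr
      _ = min ε 1 / (2 * (1 + D)) := by rw [hρ]; field_simp; norm_num
  have hEmin : (ρ + t + ρ) * Real.exp D ≤ min ε 1 / 2 := by
    refine hE.trans ?_
    gcongr
    linarith
  have hDE : D * ((ρ + t + ρ) * Real.exp D) ≤ min ε 1 / 2 := by
    calc D * ((ρ + t + ρ) * Real.exp D) ≤ (1 + D) * (min ε 1 / (2 * (1 + D))) := by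
          gcongr; linarith
      _ = min ε 1 / 2 := by field_simp
  have hε1 := min_le_left ε 1
  have hε2 := min_le_right ε 1
  obtain ⟨C, hC0, hC⟩ := b.failure_bound (t := t) (ρ := ρ) ht0 c
  refine ⟨C, hC0, ?_⟩
  have hlog : Tendsto (fun p : ℕ × ℕ => |(p.1 : ℝ) / ((p.1 : ℝ) + p.2) *
      Real.log (specPoint α w - p.2 * ((1 - limStieltjes α w)⁻¹ / ((p.1 : ℝ) + p.2)))
      + p.2 / ((p.1 : ℝ) + p.2) * (limStieltjes α w * (1 - limStieltjes α w)⁻¹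
      + Real.log (1 - limStieltjes α w)) - limLogDet α w|) (sizeFilter α) (𝓝 0) := by
    have := (((tendsto_ratio.mul ((tendsto_start (α := α) (w := w) h0 hw).log (by linarith))).add
      (tendsto_ratio'.mul_const (limStieltjes α w * (1 - limStieltjes α w)⁻¹
      + Real.log (1 - limStieltjes α w)))).sub_const (limLogDet α w)).abs
    rwa [show α * Real.log (α + w) + (1 - α) * (limStieltjes α w * (1 - limStieltjes α w)⁻¹
      + Real.log (1 - limStieltjes α w)) - limLogDet α w = 0 by rw [limLogDet]; ring,
      abs_zero] at this
  filter_upwards [b.eventually_valid h0 h1 hw ht0 htδ hts hρ0 (by linarith),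
    hlog.eventually_le_const (half_pos hε),
    (tendsto_inv_atTop_zero.comp tendsto_size).eventually_le_const hρ0] with p hd hl hN
  refine le_trans (measure_mono ?_) ((hd.measure_not_controlled_le hν
    (X := fun j ω (i : Fin p.1) => ξ i j ω) (fun j => ?_) (iIndepFun_columns hm hind p.1)
    (fun j => map_column_eq_pi hm hind hlaw p.1 j) (r := 12) (by norm_num)).trans (hC p hd))
  · intro ω hω hmem
    exact hω (b.spectralControl_of_mem hd hN (by linarith) (by linarith) hl hmem)
  · exact measurable_pi_lambda _ fun i => hm _ _

/-- The tail of a family of probabilities indexed by pairs of sizes is summable. -/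
theorem tsum_ofReal_div_pow_ne_top {C : ℝ} (hC : 0 ≤ C) :
    ∑' p : ℕ × ℕ, ENNReal.ofReal (C / ((p.1 : ℝ) + p.2) ^ 4) ≠ ⊤ := by
  have h1 : Summable fun n : ℕ => 1 / (n : ℝ) ^ 2 := Real.summable_one_div_nat_pow.2 one_lt_two
  have h2 : Summable fun p : ℕ × ℕ => (1 / ((p.1 + 1 : ℕ) : ℝ) ^ 2) * (1 / ((p.2 + 1 : ℕ) : ℝ) ^ 2) :=
    ((summable_nat_add_iff 1).2 h1).mul_of_nonneg ((summable_nat_add_iff 1).2 h1)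
      (fun _ => by positivity) (fun _ => by positivity)
  have h3 : Summable fun p : ℕ × ℕ => C / ((p.1 : ℝ) + p.2) ^ 4 := by
    refine Summable.of_nonneg_of_le (fun p => by positivity) (fun p => ?_) (h2.mul_left (16 * C))
    rcases Nat.eq_zero_or_pos (p.1 + p.2) with h | h
    · have : (p.1 : ℝ) + p.2 = 0 := by exact_mod_cast h
      rw [this]; simp; positivity
    have h' : (1 : ℝ) ≤ (p.1 : ℝ) + p.2 := by exact_mod_cast h
    have ha : (0 : ℝ) ≤ p.1 := Nat.cast_nonneg _
    have hb : (0 : ℝ) ≤ p.2 := Nat.cast_nonneg _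
    have h5 : ((p.1 : ℝ) + 1) * (p.2 + 1) ≤ 4 * ((p.1 : ℝ) + p.2) ^ 2 := by nlinarith
    have h6 : (((p.1 : ℝ) + 1) * (p.2 + 1)) ^ 2 ≤ (4 * ((p.1 : ℝ) + p.2) ^ 2) ^ 2 := by gcongr
    rw [div_le_iff₀ (by positivity)]
    have h7 : 16 * C * (1 / ((p.1 + 1 : ℕ) : ℝ) ^ 2 * (1 / ((p.2 + 1 : ℕ) : ℝ) ^ 2)) *
        ((p.1 : ℝ) + p.2) ^ 4 = C * ((4 * ((p.1 : ℝ) + p.2) ^ 2) ^ 2 /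
          (((p.1 : ℝ) + 1) * (p.2 + 1)) ^ 2) := by
      push_cast; field_simp; ring
    rw [h7]
    exact le_mul_of_one_le_right hC ((one_le_div (by positivity)).2 h6)
  exact h3.tsum_ofReal_ne_top

/-- Almost surely the sample covariance matrices are eventually under control. -/
theorem ae_eventually_spectralControl [IsProbabilityMeasure ν]
    (hν : IsStdSubgaussian ν c) (hm : ∀ i j, Measurable (ξ i j))
    (hind : iIndepFun (fun (p : ℕ × ℕ) (ω : Ω) => ξ p.1 p.2 ω) P)
    (hlaw : ∀ i j, P.map (ξ i j) = ν) {α w : ℝ} (h0 : 0 < α) (h1 : α < 1) (hw : 0 < w)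
    (b : BarrierParams α w) {ε : ℝ} (hε : 0 < ε) :
    ∀ᵐ ω ∂P, ∀ᶠ p in sizeFilter α,
      SpectralControl α w b.e ε ((p.1 : ℝ) + p.2) (sampleCov ξ p ω) := by
  classical
  obtain ⟨C, hC, h⟩ := exists_measure_not_spectralControl_le hν hm hind hlaw h0 h1 hw b hε
  set G := {p : ℕ × ℕ |
    P {ω | ¬ SpectralControl α w b.e ε ((p.1 : ℝ) + p.2) (sampleCov ξ p ω)} ≤
        ENNReal.ofReal (C / ((p.1 : ℝ) + p.2) ^ 4)} with hG
  -- The events are emptied where the probability bound is not available, so that the series runs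
  -- over all pairs; one null set then serves every sequence of sizes.
  let s : ℕ × ℕ → Set Ω := fun p => if p ∈ G then
    {ω | ¬ SpectralControl α w b.e ε ((p.1 : ℝ) + p.2) (sampleCov ξ p ω)} else ∅
  have hs : ∑' p, P (s p) ≠ ⊤ := by
    refine ne_top_of_le_ne_top (tsum_ofReal_div_pow_ne_top hC) (ENNReal.tsum_le_tsum fun p => ?_)
    by_cases hp : p ∈ G
    · simp only [s, if_pos hp]; exact hp
    · simp [s, if_neg hp]
  filter_upwards [ae_finite_setOfPred_mem hs] with ω hω
  have hcof : ∀ᶠ p in sizeFilter α, p ∉ {p | ω ∈ s p} := by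
    -- Both sizes tend to infinity along the filter, so a finite set of pairs is eventually avoided.
    have hle : sizeFilter α ≤ cofinite := by
      refine le_cofinite_iff_eventually_ne.2 fun q => ?_
      filter_upwards [(tendsto_fst_sizeFilter (α := α)).eventually_gt_atTop (q.1 : ℝ)] with p hp hpq
      rw [hpq] at hp
      exact lt_irrefl _ hp
    exact hle hω.compl_mem_cofinite
  filter_upwards [h, hcof] with p hp hp'
  have hpG : p ∈ G := hp
  simp only [s, Set.mem_ofPred_eq, if_pos hpG, not_not] at hp'
  exact hp'

end AlmostSure

/-! ### Density of the standard Gaussian vector -/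

section GaussianDensity

/-- The density of the standard Gaussian product measure. -/
theorem pi_gaussianReal_eq_withDensity (n : ℕ) :
    (Measure.pi fun _ : Fin n => gaussianReal 0 1) =
      (volume : Measure (Fin n → ℝ)).withDensity
        fun x => ENNReal.ofReal (((√(2 * Real.pi))⁻¹) ^ n * Real.exp (-(∑ i, x i ^ 2) / 2)) := by
  have hpdf : ∀ x : Fin n → ℝ, ((√(2 * Real.pi))⁻¹) ^ n * Real.exp (-(∑ i, x i ^ 2) / 2) =
      ∏ i, gaussianPDFReal 0 1 (x i) := by
    intro x
    simp only [gaussianPDFReal, Finset.prod_mul_distrib, Finset.prod_const, Finset.card_univ,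
      Fintype.card_fin, ← Real.exp_sum]
    congr 2
    · simp
    · rw [← Finset.sum_div, ← Finset.sum_neg_distrib]; simp
  simp only [hpdf]
  refine Measure.pi_eq fun s hs => ?_
  have hint : ∀ i, Integrable ((s i).indicator (gaussianPDFReal 0 1)) :=
    fun i => (integrable_gaussianPDFReal 0 1).indicator (hs i)
  have h0 : ∀ i x, 0 ≤ (s i).indicator (gaussianPDFReal 0 1) x :=
    fun i x => Set.indicator_nonneg (fun y _ => gaussianPDFReal_nonneg 0 1 y) x
  rw [withDensity_apply _ (MeasurableSet.univ_pi hs), ← lintegral_indicator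
    (MeasurableSet.univ_pi hs)]
  have h1 : ∀ x : Fin n → ℝ, (Set.univ.pi s).indicator
      (fun x => ENNReal.ofReal (∏ i, gaussianPDFReal 0 1 (x i))) x =
      ENNReal.ofReal (∏ i, (s i).indicator (gaussianPDFReal 0 1) (x i)) := by
    intro x
    by_cases hx : x ∈ Set.univ.pi s
    · rw [Set.indicator_of_mem hx]
      congr 1
      exact Finset.prod_congr rfl fun i _ =>
        (Set.indicator_of_mem (hx i (Set.mem_univ i)) _).symm
    · rw [Set.indicator_of_notMem hx]
      simp only [Set.mem_pi, Set.mem_univ, true_imp_iff, not_forall] at hx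
      obtain ⟨i, hi⟩ := hx
      rw [Finset.prod_eq_zero (Finset.mem_univ i) (Set.indicator_of_notMem hi _),
        ENNReal.ofReal_zero]
  simp only [h1]
  have hI : Integrable fun x : Fin n → ℝ => ∏ i, (s i).indicator (gaussianPDFReal 0 1) (x i) :=
    Integrable.fintype_prod_dep hint
  rw [← ofReal_integral_eq_lintegral_ofReal hI
    (ae_of_all _ fun x => Finset.prod_nonneg fun i _ => h0 i _),
    integral_fintype_prod_volume_eq_prod,
    ENNReal.ofReal_prod_of_nonneg fun i _ => integral_nonneg (h0 i)]
  refine Finset.prod_congr rfl fun i _ => ?_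
  rw [integral_indicator (hs i), gaussianReal_apply_eq_integral 0 one_ne_zero]

end GaussianDensity

/-! ### Polar coordinates -/

section Polar

open Set Metric Measure

variable {n : ℕ}

/-- Integration in polar coordinates. -/
theorem lintegral_eq_lintegral_toSphere (hn : 0 < n) {F : EuclideanSpace ℝ (Fin n) → ENNReal}
    (hF : Measurable F) :
    ∫⁻ x, F x = ∫⁻ u : sphere (0 : EuclideanSpace ℝ (Fin n)) 1, ∫⁻ r : Ioi (0 : ℝ),
      F ((r : ℝ) • (u : EuclideanSpace ℝ (Fin n))) ∂(volumeIoiPow (n - 1))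
        ∂((volume : Measure (EuclideanSpace ℝ (Fin n))).toSphere) := by
  have : Nonempty (Fin n) := ⟨⟨0, hn⟩⟩
  have hmp := (volume : Measure
    (EuclideanSpace ℝ (Fin n))).measurePreserving_homeomorphUnitSphereProd
  rw [finrank_euclideanSpace_fin] at hmp
  rw [← lintegral_prod (fun p : sphere (0 : EuclideanSpace ℝ (Fin n)) 1 × Ioi (0 : ℝ) =>
      F ((p.2 : ℝ) • (p.1 : EuclideanSpace ℝ (Fin n)))) (by fun_prop),
    ← hmp.lintegral_comp_emb (Homeomorph.measurableEmbedding _)]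
  have h : ∀ x : ({0}ᶜ : Set (EuclideanSpace ℝ (Fin n))),
      F (((homeomorphUnitSphereProd (EuclideanSpace ℝ (Fin n)) x).2 : ℝ) •
        ((homeomorphUnitSphereProd (EuclideanSpace ℝ (Fin n)) x).1 :
          EuclideanSpace ℝ (Fin n))) = F x := by
    intro x
    congr 1
    have hx : ‖(x : EuclideanSpace ℝ (Fin n))‖ ≠ 0 := norm_ne_zero_iff.2 x.2
    simp [smul_smul, hx]
  simp only [h]
  rw [lintegral_subtype_comap (measurableSet_singleton _).compl F, restrict_compl_singleton]

/-- The radial Gaussian integral. -/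
theorem lintegral_volumeIoiPow_exp (hn : 0 < n) {c : ℝ} (hc : 0 < c) :
    ∫⁻ r : Ioi (0 : ℝ), ENNReal.ofReal (Real.exp (-((r : ℝ) ^ 2 * c) / 2)) ∂(volumeIoiPow (n - 1)) =
      ENNReal.ofReal (c ^ (-(n : ℝ) / 2)) *
        ENNReal.ofReal (2 ^ ((n : ℝ) / 2) * (1 / 2) * Real.Gamma ((n : ℝ) / 2)) := by
  have hn' : ((n - 1 : ℕ) : ℝ) = n - 1 := by rw [Nat.cast_sub hn, Nat.cast_one]
  have hn0 : (0 : ℝ) < n := by exact_mod_cast hn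
  rw [volumeIoiPow, lintegral_withDensity_eq_lintegral_mul _ (by fun_prop) (by fun_prop)]
  simp only [Pi.mul_apply]
  rw [lintegral_subtype_comap measurableSet_Ioi
    (fun r : ℝ => ENNReal.ofReal (r ^ (n - 1)) * ENNReal.ofReal (Real.exp (-(r ^ 2 * c) / 2)))]
  have e1 : ∫⁻ r in Ioi (0 : ℝ),
      ENNReal.ofReal (r ^ (n - 1)) * ENNReal.ofReal (Real.exp (-(r ^ 2 * c) / 2)) =
      ∫⁻ r in Ioi (0 : ℝ), ENNReal.ofReal (r ^ ((n - 1 : ℕ) : ℝ) * Real.exp (-(c / 2) * r ^ (2 : ℝ))) := by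
    refine setLIntegral_congr_fun measurableSet_Ioi fun r hr => ?_
    have hr0 : (0 : ℝ) < r := hr
    rw [← ENNReal.ofReal_mul (by positivity), Real.rpow_natCast, Real.rpow_two]
    congr 3
    ring
  have hq : (-1 : ℝ) < ((n - 1 : ℕ) : ℝ) := by
    have : (0 : ℝ) ≤ ((n - 1 : ℕ) : ℝ) := Nat.cast_nonneg _
    linarith
  rw [e1, ← ofReal_integral_eq_lintegral_ofReal
    (integrableOn_rpow_mul_exp_neg_mul_rpow hq zero_lt_two (by positivity)),
    integral_rpow_mul_exp_neg_mul_rpow two_pos hq (by positivity),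
    ← ENNReal.ofReal_mul (by positivity)]
  · congr 1
    rw [hn', Real.div_rpow hc.le zero_le_two]
    have : -((n : ℝ) - 1 + 1) / 2 = -((n : ℝ) / 2) := by ring
    rw [this, Real.rpow_neg zero_le_two, sub_add_cancel]
    have h2 : -(n : ℝ) / 2 = -((n : ℝ) / 2) := by ring
    rw [h2]
    field_simp
  · refine (ae_restrict_iff' measurableSet_Ioi).2 (ae_of_all _ fun r hr => ?_)
    have hr0 : (0 : ℝ) < r := hr
    simp only [Pi.zero_apply]
    positivity

end Polar

/-! ### Spherical integrals as Gaussian integrals -/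

section SphereGaussian

open Set Metric Measure Matrix WithLp

variable {n : ℕ}

/-- The radial constant. -/
noncomputable def radialConst (n : ℕ) : ENNReal :=
  ENNReal.ofReal (2 ^ ((n : ℝ) / 2) * (1 / 2) * Real.Gamma ((n : ℝ) / 2))

/-- The quadratic form of `(M Mᵀ)⁻¹`. -/
noncomputable def invNormSq (M : Matrix (Fin n) (Fin n) ℝ) (x : Fin n → ℝ) : ℝ :=
  ∑ i, (M⁻¹ *ᵥ x) i ^ 2

theorem continuous_invNormSq (M : Matrix (Fin n) (Fin n) ℝ) : Continuous (invNormSq M) := by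
  unfold invNormSq mulVec dotProduct
  fun_prop

theorem invNormSq_smul (M : Matrix (Fin n) (Fin n) ℝ) (r : ℝ) (x : Fin n → ℝ) :
    invNormSq M (r • x) = r ^ 2 * invNormSq M x := by
  simp [invNormSq, mulVec_smul, mul_pow, Finset.mul_sum]

theorem invNormSq_pos {M : Matrix (Fin n) (Fin n) ℝ} (hM : M.det ≠ 0) {x : Fin n → ℝ}
    (hx : x ≠ 0) : 0 < invNormSq M x := by
  have hne : M⁻¹ *ᵥ x ≠ 0 := by
    intro h
    apply hx
    have := congrArg (M *ᵥ ·) h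
    simpa [mulVec_mulVec, Matrix.mul_nonsing_inv M (isUnit_iff_ne_zero.2 hM)] using this
  obtain ⟨i, hi⟩ := Function.ne_iff.1 hne
  exact Finset.sum_pos' (fun i _ => sq_nonneg _) ⟨i, Finset.mem_univ i, by
    have : (M⁻¹ *ᵥ x) i ≠ 0 := hi
    positivity⟩

theorem invNormSq_mulVec {M : Matrix (Fin n) (Fin n) ℝ} (hM : M.det ≠ 0) (g : Fin n → ℝ) :
    invNormSq M (M *ᵥ g) = ∑ i, g i ^ 2 := by
  simp [invNormSq, mulVec_mulVec, Matrix.nonsing_inv_mul M (isUnit_iff_ne_zero.2 hM)]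

/-- The integral of h(x) exp(-|M⁻¹x|²/2) over ℝⁿ is computed twice: by the substitution x = Mg, and
in polar coordinates, where homogeneity takes h out of the radial integral and the latter yields
|M⁻¹u|^(-n). -/
theorem lintegral_toSphere_mul_radialConst (hn : 0 < n) {M : Matrix (Fin n) (Fin n) ℝ}
    (hM : M.det ≠ 0) {h : (Fin n → ℝ) → ENNReal} (hh : Measurable h)
    (hhom : ∀ r : ℝ, 0 < r → ∀ x, h (r • x) = h x) :
    (∫⁻ u : sphere (0 : EuclideanSpace ℝ (Fin n)) 1, h (ofLp (u : EuclideanSpace ℝ (Fin n))) *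
      ENNReal.ofReal (invNormSq M (ofLp (u : EuclideanSpace ℝ (Fin n))) ^ (-(n : ℝ) / 2))
        ∂((volume : Measure (EuclideanSpace ℝ (Fin n))).toSphere)) * radialConst n =
    ENNReal.ofReal (√(2 * Real.pi) ^ n) * (ENNReal.ofReal |M.det| *
      ∫⁻ g, h (M *ᵥ g) ∂(Measure.pi fun _ : Fin n => gaussianReal 0 1)) := by
  set F : (Fin n → ℝ) → ENNReal := fun x =>
    h x * ENNReal.ofReal (Real.exp (-(invNormSq M x) / 2)) with hF
  have hc := continuous_invNormSq M
  have hFm : Measurable F := by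
    refine hh.mul (ENNReal.measurable_ofReal.comp ?_)
    exact Continuous.measurable (by fun_prop)
  have hMg : Measurable fun g : Fin n → ℝ => M *ᵥ g := by
    refine Continuous.measurable ?_
    unfold mulVec dotProduct
    fun_prop
  have hpi : (0 : ℝ) < √(2 * Real.pi) := Real.sqrt_pos.2 (by positivity)
  have e1 : ∫⁻ g, h (M *ᵥ g) ∂(Measure.pi fun _ : Fin n => gaussianReal 0 1) =
      ENNReal.ofReal ((√(2 * Real.pi))⁻¹ ^ n) * ∫⁻ g, F (M *ᵥ g) := by
    have hd : Measurable fun x : Fin n → ℝ => ENNReal.ofReal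
        (((√(2 * Real.pi))⁻¹) ^ n * Real.exp (-(∑ i, x i ^ 2) / 2)) := by fun_prop
    rw [pi_gaussianReal_eq_withDensity]
    refine (lintegral_withDensity_eq_lintegral_mul _ hd (hh.comp hMg)).trans ?_
    refine Eq.trans ?_ (lintegral_const_mul _ (hFm.comp hMg))
    refine lintegral_congr fun g => ?_
    simp only [Pi.mul_apply, hF, Function.comp_apply]
    rw [invNormSq_mulVec hM, ENNReal.ofReal_mul (by positivity)]
    ring
  have e2 : ENNReal.ofReal |M.det| * ∫⁻ g, F (M *ᵥ g) = ∫⁻ x, F x := by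
    have h1 := lintegral_map (μ := volume) hFm hMg
    have h2 := Real.map_matrix_volume_pi_eq_smul_volume_pi hM
    have h3 : ⇑(toLin' M) = fun g => M *ᵥ g := by ext g; simp
    rw [h3] at h2
    rw [← h1, h2, lintegral_smul_measure, smul_eq_mul, ← mul_assoc, ← ENNReal.ofReal_mul
      (abs_nonneg _), ← abs_mul, mul_inv_cancel₀ hM, abs_one, ENNReal.ofReal_one, one_mul]
  have e3 : ∫⁻ x, F x = ∫⁻ x : EuclideanSpace ℝ (Fin n), F (ofLp x) :=
    ((EuclideanSpace.volume_preserving_symm_measurableEquiv_toLp (Fin n)).lintegral_comp hFm).symm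
  have e4 : ENNReal.ofReal (√(2 * Real.pi) ^ n) * ENNReal.ofReal ((√(2 * Real.pi))⁻¹ ^ n) = 1 := by
    rw [← ENNReal.ofReal_mul (by positivity), ← mul_pow, mul_inv_cancel₀ hpi.ne', one_pow,
      ENNReal.ofReal_one]
  have e5 : ENNReal.ofReal (√(2 * Real.pi) ^ n) * (ENNReal.ofReal |M.det| *
      ∫⁻ g, h (M *ᵥ g) ∂(Measure.pi fun _ : Fin n => gaussianReal 0 1)) = ∫⁻ x, F x := by
    rw [e1, ← e2, mul_left_comm (ENNReal.ofReal |M.det|), ← mul_assoc, e4, one_mul]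
  have hFm' : Measurable fun x : EuclideanSpace ℝ (Fin n) => F (ofLp x) :=
    hFm.comp (EuclideanSpace.volume_preserving_symm_measurableEquiv_toLp (Fin n)).measurable
  rw [e5, e3, lintegral_eq_lintegral_toSphere hn hFm', ← lintegral_mul_const']
  · refine lintegral_congr fun u => ?_
    have hu : ofLp (u : EuclideanSpace ℝ (Fin n)) ≠ 0 := by
      intro h0
      have : (u : EuclideanSpace ℝ (Fin n)) = 0 := by ext i; exact congrFun h0 i
      have h1 : ‖(u : EuclideanSpace ℝ (Fin n))‖ = 1 := norm_eq_of_mem_sphere u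
      rw [this, norm_zero] at h1
      exact zero_ne_one h1
    have hr : ∀ r : Ioi (0 : ℝ), F (ofLp ((r : ℝ) • (u : EuclideanSpace ℝ (Fin n)))) =
        h (ofLp (u : EuclideanSpace ℝ (Fin n))) * ENNReal.ofReal (Real.exp
          (-((r : ℝ) ^ 2 * invNormSq M (ofLp (u : EuclideanSpace ℝ (Fin n)))) / 2)) := by
      intro r
      simp only [hF, ofLp_smul]
      rw [hhom _ r.2, invNormSq_smul]
    simp only [hr]
    rw [lintegral_const_mul _ (by fun_prop), lintegral_volumeIoiPow_exp hn (invNormSq_pos hM hu),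
      radialConst, mul_assoc]
  · exact ENNReal.ofReal_ne_top

/-- The case M = 1, h = 1. Dividing the general identity by this one normalises the measure without
evaluating the area of the sphere. -/
theorem toSphere_univ_mul_radialConst (hn : 0 < n) :
    (volume : Measure (EuclideanSpace ℝ (Fin n))).toSphere univ * radialConst n =
      ENNReal.ofReal (√(2 * Real.pi) ^ n) := by
  have h := lintegral_toSphere_mul_radialConst hn (M := 1) (by simp) (h := fun _ => 1)
    measurable_const fun _ _ _ => rfl
  have h1 : ∀ u : sphere (0 : EuclideanSpace ℝ (Fin n)) 1,
      invNormSq (1 : Matrix (Fin n) (Fin n) ℝ) (ofLp (u : EuclideanSpace ℝ (Fin n))) = 1 := by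
    intro u
    have h2 : ‖(u : EuclideanSpace ℝ (Fin n))‖ = 1 := norm_eq_of_mem_sphere u
    have h3 := EuclideanSpace.norm_sq_eq (u : EuclideanSpace ℝ (Fin n))
    rw [h2] at h3
    simp only [invNormSq, inv_one, one_mulVec]
    simpa using h3.symm
  simp only [h1, Real.one_rpow, ENNReal.ofReal_one, mul_one, lintegral_const, one_mul, det_one,
    abs_one, measure_univ] at h
  exact h

/-- Integrals over the sphere against a projected Gaussian density are Gaussian integrals of
homogeneous functions. -/
theorem lintegral_sphericalPrior_mul (hn : 0 < n) {R : ℝ} (hR : 0 < R)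
    {M : Matrix (Fin n) (Fin n) ℝ}
    (hM : M.det ≠ 0) {h : (Fin n → ℝ) → ENNReal} (hh : Measurable h)
    (hhom : ∀ r : ℝ, 0 < r → ∀ x, h (r • x) = h x) :
    ∫⁻ x, h (ofLp x) * ENNReal.ofReal ((invNormSq M (ofLp x) / (R ^ 2 * n)) ^ (-(n : ℝ) / 2))
      ∂(sphericalPrior n R) =
    ENNReal.ofReal |M.det| *
      ∫⁻ g, h (M *ᵥ g) ∂(Measure.pi fun _ : Fin n => gaussianReal 0 1) := by
  have : Nonempty (Fin n) := ⟨⟨0, hn⟩⟩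
  have hn0 : (0 : ℝ) < n := by exact_mod_cast hn
  have key := lintegral_toSphere_mul_radialConst hn hM hh hhom
  rw [← toSphere_univ_mul_radialConst hn, mul_right_comm] at key
  set S := (volume : Measure (EuclideanSpace ℝ (Fin n))).toSphere with hS
  have hS0 : S univ ≠ 0 := Measure.measure_univ_ne_zero.2 (Measure.toSphere_ne_zero _)
  have hST : S univ ≠ ⊤ := measure_ne_top _ _
  have hJ0 : radialConst n ≠ 0 := by
    intro h0
    have h1 := toSphere_univ_mul_radialConst hn
    rw [h0, mul_zero] at h1
    have hpi : (0 : ℝ) < √(2 * Real.pi) := Real.sqrt_pos.2 (by positivity)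
    exact (ENNReal.ofReal_pos.2 (pow_pos hpi n)).ne h1
  have hJT : radialConst n ≠ ⊤ := ENNReal.ofReal_ne_top
  rw [ENNReal.mul_left_inj hJ0 hJT] at key
  have hofLp : Measurable fun x : EuclideanSpace ℝ (Fin n) => (ofLp x : Fin n → ℝ) :=
    (EuclideanSpace.volume_preserving_symm_measurableEquiv_toLp (Fin n)).measurable
  have hc := (continuous_invNormSq M).measurable
  have hmeas : Measurable fun x : EuclideanSpace ℝ (Fin n) => h (ofLp x) *
      ENNReal.ofReal ((invNormSq M (ofLp x) / (R ^ 2 * n)) ^ (-(n : ℝ) / 2)) :=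
    (hh.comp hofLp).mul (ENNReal.measurable_ofReal.comp
      (((hc.comp hofLp).div_const _).pow_const _))
  rw [sphericalPrior, lintegral_map hmeas (by fun_prop), ProbabilityTheory.cond,
    Measure.restrict_univ, lintegral_smul_measure, smul_eq_mul]
  have hpos : 0 < R * √(n : ℝ) := mul_pos hR (Real.sqrt_pos.2 hn0)
  have e : ∀ u : sphere (0 : EuclideanSpace ℝ (Fin n)) 1,
      h (ofLp ((R * √(n : ℝ)) • (u : EuclideanSpace ℝ (Fin n)))) * ENNReal.ofReal
        ((invNormSq M (ofLp ((R * √(n : ℝ)) • (u : EuclideanSpace ℝ (Fin n)))) / (R ^ 2 * n))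
          ^ (-(n : ℝ) / 2)) =
      h (ofLp (u : EuclideanSpace ℝ (Fin n))) *
      ENNReal.ofReal (invNormSq M (ofLp (u : EuclideanSpace ℝ (Fin n))) ^ (-(n : ℝ) / 2)) := by
    intro u
    rw [ofLp_smul, hhom _ hpos, invNormSq_smul, mul_pow, Real.sq_sqrt hn0.le,
      mul_div_cancel_left₀ _ (by positivity)]
  simp only [e]
  rw [key, ← mul_assoc, ENNReal.inv_mul_cancel hS0 hST, one_mul]

end SphereGaussian

/-! ### Saddle point estimates for the Gaussian integrand -/

section SphereQuad

open Set Matrix WithLp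

variable {n : ℕ}

/-- The Gaussian integrand that represents a spherical integral of the exponential of a quadratic
form with eigenvalues `l`; the weights `d` are arbitrary. -/
noncomputable def sphereIntegrand (K : ℝ) (l d g : Fin n → ℝ) : ℝ :=
  Real.exp (K * n / 2 * ((∑ i, l i * (g i ^ 2 / d i)) / ∑ i, g i ^ 2 / d i)) *
    ((∑ i, g i ^ 2) / ∑ i, g i ^ 2 / d i) ^ ((n : ℝ) / 2)

/-- Change of measure to the direction of a Gaussian vector with variances 1/dᵢ in the eigenbasis.
The determinant of M gives the prefactor; d is free and will be tuned to the saddle point. -/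
theorem lintegral_sphericalPrior_exp_quadForm (hn : 0 < n) {R κ : ℝ} (hR : 0 < R)
    {U : Matrix (Fin n) (Fin n) ℝ} (h1 : Uᵀ * U = 1) (h2 : U * Uᵀ = 1) (l : Fin n → ℝ)
    {d : Fin n → ℝ} (hd : ∀ i, 0 < d i) :
    ∫⁻ x, ENNReal.ofReal (Real.exp (κ / 2 * (ofLp x ⬝ᵥ (U * diagonal l * Uᵀ) *ᵥ ofLp x)))
      ∂(sphericalPrior n R) =
    ENNReal.ofReal (√(∏ i, d i))⁻¹ * ∫⁻ g, ENNReal.ofReal (sphereIntegrand (κ * R ^ 2) l d g)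
      ∂(Measure.pi fun _ : Fin n => gaussianReal 0 1) := by
  have hn0 : (0 : ℝ) < n := by exact_mod_cast hn
  set M := U * diagonal (fun i => (√(d i))⁻¹) with hMdef
  have hdU : |U.det| = 1 := by
    have h := congrArg Matrix.det h1
    rw [det_mul, det_transpose, det_one] at h
    have : |U.det| * |U.det| = 1 := by rw [← abs_mul, h, abs_one]
    nlinarith [abs_nonneg U.det]
  have hdetM : |M.det| = (√(∏ i, d i))⁻¹ := by
    rw [hMdef, det_mul, det_diagonal, abs_mul, hdU, one_mul, Finset.prod_inv_distrib,
      Real.sqrt_prod _ fun i _ => (hd i).le, abs_of_nonneg]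
    exact inv_nonneg.2 (Finset.prod_nonneg fun i _ => Real.sqrt_nonneg _)
  have hM : M.det ≠ 0 := by
    rw [← abs_pos, hdetM]
    exact inv_pos.2 (Real.sqrt_pos.2 (Finset.prod_pos fun i _ => hd i))
  set W := U * diagonal l * Uᵀ with hW
  -- The degree zero extension of the integrand from the sphere x·x = R²n, times the inverse of the
  -- projected Gaussian density.
  set h : (Fin n → ℝ) → ENNReal := fun x => ENNReal.ofReal
    (Real.exp (κ * R ^ 2 * n / 2 * ((x ⬝ᵥ W *ᵥ x) / (x ⬝ᵥ x))) *
      (invNormSq M x / (x ⬝ᵥ x)) ^ ((n : ℝ) / 2)) with hh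
  have hc1 : Measurable fun x : Fin n → ℝ => x ⬝ᵥ W *ᵥ x := by
    refine Continuous.measurable ?_
    simp only [dotProduct, mulVec]; fun_prop
  have hc2 : Measurable fun x : Fin n → ℝ => x ⬝ᵥ x := by
    refine Continuous.measurable ?_
    simp only [dotProduct]; fun_prop
  have hc3 := (continuous_invNormSq M).measurable
  have hmeas : Measurable h := by
    refine ENNReal.measurable_ofReal.comp ?_
    exact (Real.measurable_exp.comp ((hc1.div hc2).const_mul _)).mul ((hc3.div hc2).pow_const _)
  have hhom : ∀ r : ℝ, 0 < r → ∀ x, h (r • x) = h x := by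
    intro r hr x
    have hr2 : r ^ 2 ≠ 0 := by positivity
    have e1 : (r • x) ⬝ᵥ W *ᵥ (r • x) = r ^ 2 * (x ⬝ᵥ W *ᵥ x) := by
      rw [mulVec_smul, smul_dotProduct, dotProduct_smul, smul_smul, smul_eq_mul, sq]
    have e2 : (r • x) ⬝ᵥ (r • x) = r ^ 2 * (x ⬝ᵥ x) := by
      rw [smul_dotProduct, dotProduct_smul, smul_smul, smul_eq_mul, sq]
    simp only [hh]
    rw [e1, e2, invNormSq_smul, mul_div_mul_left _ _ hr2, mul_div_mul_left _ _ hr2]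
  have key := lintegral_sphericalPrior_mul hn hR hM hmeas hhom
  rw [hdetM] at key
  refine Eq.trans (lintegral_congr_ae ?_) (key.trans ?_)
  · filter_upwards [sphericalPrior_norm n R] with x hx
    have hxx : ofLp x ⬝ᵥ ofLp x = R ^ 2 * n := by
      have h3 := EuclideanSpace.norm_sq_eq x
      rw [hx, mul_pow, sq_abs, Real.sq_sqrt hn0.le] at h3
      rw [h3, dotProduct]
      refine Finset.sum_congr rfl fun i _ => ?_
      rw [Real.norm_eq_abs, sq_abs, sq]
    have hx0 : ofLp x ≠ 0 := by
      intro h0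
      rw [h0, zero_dotProduct] at hxx
      have : 0 < R ^ 2 * n := by positivity
      linarith
    have hpos : 0 < invNormSq M (ofLp x) / (R ^ 2 * n) := by
      have := invNormSq_pos hM hx0
      positivity
    simp only [hh]
    rw [hxx, ← ENNReal.ofReal_mul (by positivity), mul_assoc, ← Real.rpow_add hpos,
      show (n : ℝ) / 2 + -(n : ℝ) / 2 = 0 by ring, Real.rpow_zero, mul_one]
    congr 2
    field_simp
  · congr 1
    refine lintegral_congr fun g => ?_
    simp only [hh, sphereIntegrand]
    have e0 : M *ᵥ g = U *ᵥ (fun i => (√(d i))⁻¹ * g i) := by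
      rw [hMdef, ← mulVec_mulVec]
      congr 1
      ext i
      rw [mulVec_diagonal]
    have e1 : Uᵀ *ᵥ (M *ᵥ g) = fun i => (√(d i))⁻¹ * g i := by
      rw [e0, mulVec_mulVec, h1, one_mulVec]
    have hsq : ∀ i, ((√(d i))⁻¹ * g i) ^ 2 = g i ^ 2 / d i := by
      intro i
      rw [mul_pow, inv_pow, Real.sq_sqrt (hd i).le, div_eq_inv_mul]
    have e2 : (M *ᵥ g) ⬝ᵥ (M *ᵥ g) = ∑ i, g i ^ 2 / d i := by
      have : ∀ x : Fin n → ℝ, x ⬝ᵥ x = (Uᵀ *ᵥ x) ⬝ᵥ (Uᵀ *ᵥ x) := fun x => by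
        rw [dotProduct_mulVec, vecMul_transpose, mulVec_mulVec, h2, one_mulVec]
      rw [this, e1, dotProduct]
      refine Finset.sum_congr rfl fun i _ => ?_
      rw [← hsq, sq]
    have e3 : (M *ᵥ g) ⬝ᵥ W *ᵥ (M *ᵥ g) = ∑ i, l i * (g i ^ 2 / d i) := by
      have : ∀ x : Fin n → ℝ, x ⬝ᵥ W *ᵥ x = (Uᵀ *ᵥ x) ⬝ᵥ (diagonal l *ᵥ (Uᵀ *ᵥ x)) := fun x => by
        rw [hW, ← mulVec_mulVec, ← mulVec_mulVec, dotProduct_mulVec x U, ← mulVec_transpose]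
      rw [this, e1, dotProduct]
      refine Finset.sum_congr rfl fun i _ => ?_
      rw [mulVec_diagonal, ← hsq]
      ring
    rw [e2, e3, invNormSq_mulVec hM]

/-- The saddle point bound. -/
theorem sphereIntegrand_le {K s : ℝ} (hn : 0 < n) (hK : 0 < K) {l : Fin n → ℝ}
    (hl : ∀ i, l i < s) (g : Fin n → ℝ) :
    sphereIntegrand K l (fun i => s - l i) g ≤
      Real.exp (n / 2 * (K * s - 1 - Real.log K)) := by
  have hn0 : (0 : ℝ) < n := by exact_mod_cast hn
  set X := ∑ i, g i ^ 2 with hX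
  set Y := ∑ i, g i ^ 2 / (s - l i) with hY
  have hpos : ∀ i, 0 < s - l i := fun i => sub_pos.2 (hl i)
  have e1 : ∑ i, l i * (g i ^ 2 / (s - l i)) = s * Y - X := by
    rw [hX, hY, Finset.mul_sum, ← Finset.sum_sub_distrib]
    refine Finset.sum_congr rfl fun i _ => ?_
    have := (hpos i).ne'
    field_simp
    ring
  rw [sphereIntegrand, e1]
  change Real.exp (K * n / 2 * ((s * Y - X) / Y)) * (X / Y) ^ ((n : ℝ) / 2) ≤ _
  rcases eq_or_ne g 0 with rfl | hg
  · have : X = 0 := by simp [hX]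
    rw [this, zero_div, Real.zero_rpow (by positivity), mul_zero]
    positivity
  obtain ⟨i, hi⟩ := Function.ne_iff.1 hg
  have hi' : g i ≠ 0 := hi
  have hX0 : 0 < X := Finset.sum_pos' (fun i _ => sq_nonneg _) ⟨i, Finset.mem_univ i, by positivity⟩
  have hY0 : 0 < Y := Finset.sum_pos' (fun i _ => div_nonneg (sq_nonneg _) (hpos i).le)
    ⟨i, Finset.mem_univ i, div_pos (by positivity) (hpos i)⟩
  have hz : 0 < X / Y := by positivity
  rw [Real.rpow_def_of_pos hz, ← Real.exp_add, Real.exp_le_exp]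
  have e2 : (s * Y - X) / Y = s - X / Y := by field_simp
  rw [e2]
  -- The exponent depends on z = X/Y only through -Kz + log z, which is largest at z = 1/K.
  have e3 := Real.log_le_sub_one_of_pos (mul_pos hK hz)
  rw [Real.log_mul hK.ne' hz.ne'] at e3
  have e4 : K * n / 2 * (s - X / Y) + Real.log (X / Y) * (n / 2) =
      n / 2 * (K * s - K * (X / Y) + Real.log (X / Y)) := by ring
  rw [e4]
  gcongr
  linarith

/-- A lower bound for the Gaussian integrand at typical points. -/
theorem le_sphereIntegrand {K s r δ Δ : ℝ} (hK : 0 < K) (hr : 0 ≤ r)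
    (hδ : 0 < δ) (hδ1 : δ < 1) (hδK : 3 * δ < K) {l : Fin n → ℝ} (hl : ∀ i, l i < s) (i₀ : Fin n)
    (hΔ : s - l i₀ ≤ Δ) (hn : 0 < n) {g : Fin n → ℝ} (hG : |g i₀ ^ 2 - r| ≤ δ)
    (hX : |(∑ i ∈ Finset.univ.erase i₀, g i ^ 2) / n - 1| ≤ δ)
    (hY : |(∑ i ∈ Finset.univ.erase i₀, g i ^ 2 / (s - l i)) / n - (K - r)| ≤ 2 * δ) :
    Real.exp (n / 2 * (K * s - K * (1 + δ) / (K - 3 * δ) - K * (Δ * (r + δ)) / (K - 3 * δ)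
      + Real.log ((1 - δ) / (K + 3 * δ)))) ≤
    sphereIntegrand K l (Function.update (fun i => s - l i) i₀ (n : ℝ)⁻¹) g := by
  have hn0 : (0 : ℝ) < n := by exact_mod_cast hn
  have hpos : ∀ i, 0 < s - l i := fun i => sub_pos.2 (hl i)
  set X' := ∑ i ∈ Finset.univ.erase i₀, g i ^ 2 with hX'
  set Y' := ∑ i ∈ Finset.univ.erase i₀, g i ^ 2 / (s - l i) with hY'
  set G := g i₀ ^ 2 with hGd
  have hG0 : 0 ≤ G := sq_nonneg _
  have eX : ∑ i, g i ^ 2 = G + X' := (Finset.add_sum_erase _ _ (Finset.mem_univ i₀)).symm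
  -- The weight 1/n makes the single coordinate i₀ macroscopic: with G ≈ r it supplies the mass
  -- missing from the trace, so that Y/n ≈ r + (K - r) = K.
  have eY : ∑ i, g i ^ 2 / Function.update (fun i => s - l i) i₀ (n : ℝ)⁻¹ i = n * G + Y' := by
    rw [← Finset.add_sum_erase _ _ (Finset.mem_univ i₀), Function.update_self, div_inv_eq_mul,
      mul_comm]
    congr 1
    refine Finset.sum_congr rfl fun i hi => ?_
    rw [Function.update_of_ne (Finset.ne_of_mem_erase hi)]
  have eL : ∑ i, l i * (g i ^ 2 / Function.update (fun i => s - l i) i₀ (n : ℝ)⁻¹ i) =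
      s * (n * G + Y') - X' - (s - l i₀) * (n * G) := by
    rw [← Finset.add_sum_erase _ _ (Finset.mem_univ i₀), Function.update_self, div_inv_eq_mul]
    have : ∑ i ∈ Finset.univ.erase i₀,
        l i * (g i ^ 2 / Function.update (fun i => s - l i) i₀ (n : ℝ)⁻¹ i) = s * Y' - X' := by
      rw [hX', hY', Finset.mul_sum, ← Finset.sum_sub_distrib]
      refine Finset.sum_congr rfl fun i hi => ?_
      rw [Function.update_of_ne (Finset.ne_of_mem_erase hi)]
      have := (hpos i).ne'
      field_simp
      ring
    rw [this]
    ring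
  obtain ⟨g1, g2⟩ := abs_le.1 hG
  obtain ⟨x1, x2⟩ := abs_le.1 hX
  obtain ⟨y1, y2⟩ := abs_le.1 hY
  set Y := n * G + Y' with hYd
  have hYn : Y = n * (G + Y' / n) := by rw [hYd]; field_simp
  have hYl : n * (K - 3 * δ) ≤ Y := by
    rw [hYn]; exact mul_le_mul_of_nonneg_left (by linarith) hn0.le
  have hYu : Y ≤ n * (K + 3 * δ) := by
    rw [hYn]; exact mul_le_mul_of_nonneg_left (by linarith) hn0.le
  have hXl : n * (1 - δ) ≤ X' := by
    rw [mul_comm, ← le_div_iff₀ hn0]; linarith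
  have hXu : X' ≤ n * (1 + δ) := by
    rw [mul_comm, ← div_le_iff₀ hn0]; linarith
  have hK3 : 0 < K - 3 * δ := by linarith
  have hY0 : 0 < Y := lt_of_lt_of_le (by positivity) hYl
  have hδ1' : 0 < 1 - δ := by linarith
  have hX0 : 0 < X' := lt_of_lt_of_le (by positivity) hXl
  have hz : 0 < (G + X') / Y := by positivity
  have hΔ0 : 0 ≤ Δ := (hpos i₀).le.trans hΔ
  rw [sphereIntegrand, eX, eY, eL, Real.rpow_def_of_pos hz, ← Real.exp_add, Real.exp_le_exp]
  have e2 : (s * Y - X' - (s - l i₀) * (n * G)) / Y =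
      s - X' / Y - (s - l i₀) * (n * G) / Y := by field_simp
  have b1 : X' / Y ≤ (1 + δ) / (K - 3 * δ) := by
    calc X' / Y ≤ n * (1 + δ) / (n * (K - 3 * δ)) := by gcongr
      _ = _ := mul_div_mul_left _ _ hn0.ne'
  have b2 : (s - l i₀) * (n * G) / Y ≤ Δ * (r + δ) / (K - 3 * δ) := by
    calc (s - l i₀) * (n * G) / Y ≤ Δ * (n * (r + δ)) / (n * (K - 3 * δ)) := by
          gcongr
          linarith
      _ = n * (Δ * (r + δ)) / (n * (K - 3 * δ)) := by ring
      _ = _ := mul_div_mul_left _ _ hn0.ne'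
  have b3 : (1 - δ) / (K + 3 * δ) ≤ (G + X') / Y := by
    calc (1 - δ) / (K + 3 * δ) = n * (1 - δ) / (n * (K + 3 * δ)) :=
          (mul_div_mul_left _ _ hn0.ne').symm
      _ ≤ (G + X') / Y := by
          gcongr
          linarith
  have b4 : Real.log ((1 - δ) / (K + 3 * δ)) ≤ Real.log ((G + X') / Y) :=
    Real.log_le_log (by positivity) b3
  rw [e2]
  have e4 : K * n / 2 * (s - X' / Y - (s - l i₀) * (n * G) / Y) +
      Real.log ((G + X') / Y) * (n / 2) = n / 2 * (K * s - K * (X' / Y)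
        - K * ((s - l i₀) * (n * G) / Y) + Real.log ((G + X') / Y)) := by ring
  rw [e4, mul_div_assoc K, mul_div_assoc K]
  gcongr

end SphereQuad

/-! ### Integrating out the Gaussian layer -/

section PartitionFunction

open Set Matrix WithLp

theorem integral_exp_inner_gaussianPrior (m : ℕ) {θ : ℝ} (hθ : 0 ≤ θ)
    (v : EuclideanSpace ℝ (Fin m)) :
    ∫ y, Real.exp (inner ℝ v y) ∂(gaussianPrior m θ) =
      Real.exp (θ * (ofLp v ⬝ᵥ ofLp v) / 2) := by
  have hg : IsGaussian (gaussianPrior m θ) := by unfold gaussianPrior; infer_instance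
  have hS : (θ • (1 : Matrix (Fin m) (Fin m) ℝ)).PosSemidef := PosSemidef.one.smul hθ
  have hmean : (gaussianPrior m θ)[innerSL ℝ v] = 0 := by
    rw [ContinuousLinearMap.integral_comp_id_comm]
    · simp [gaussianPrior]
    · exact IsGaussian.integrable_id
  have hvar : Var[innerSL ℝ v; gaussianPrior m θ] = θ * (ofLp v ⬝ᵥ ofLp v) := by
    have h1 := covarianceBilin_self (μ := gaussianPrior m θ) IsGaussian.memLp_two_id v
    rw [gaussianPrior, covarianceBilin_multivariateGaussian hS, smul_mulVec, one_mulVec,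
      dotProduct_smul, smul_eq_mul] at h1
    rw [h1]
    rfl
  have hmap := IsGaussian.map_eq_gaussianReal (μ := gaussianPrior m θ) (innerSL ℝ v)
  rw [hmean, hvar] at hmap
  have h2 := mgf_gaussianReal hmap 1
  have hnn : 0 ≤ ofLp v ⬝ᵥ ofLp v := by
    simp only [dotProduct]
    exact Finset.sum_nonneg fun i _ => mul_self_nonneg _
  rw [mgf, Real.coe_toNNReal _ (mul_nonneg hθ hnn)] at h2
  simpa using h2

/-- For fixed x the exponent is linear in y with coefficient vector βN^(-1/2) Ξᵀx, and the Gaussian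
exponential moment is quadratic in that vector. -/
theorem ofReal_rbmPartitionFunction {N₁ N₂ : ℕ} (R : ℝ) {θ : ℝ} (hθ : 0 ≤ θ) (β : ℝ)
    (Ξ : Matrix (Fin N₁) (Fin N₂) ℝ) :
    ENNReal.ofReal (rbmPartitionFunction R θ β Ξ) =
      ∫⁻ x, ENNReal.ofReal (Real.exp (θ * β ^ 2 / 2 *
        (ofLp x ⬝ᵥ (((N₁ : ℝ) + N₂)⁻¹ • (Ξ * Ξᵀ)) *ᵥ ofLp x))) ∂(sphericalPrior N₁ R) := by
  have hfin : IsFiniteMeasure (sphericalPrior N₁ R) := by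
    unfold sphericalPrior; infer_instance
  have hint := integrable_exp_rbmEnergy R θ β Ξ
  set N := (N₁ : ℝ) + N₂ with hN
  have hN0 : 0 ≤ N := by positivity
  have hin : ∀ x : EuclideanSpace ℝ (Fin N₁),
      ∫ y, Real.exp (-β * rbmEnergy Ξ x y) ∂(gaussianPrior N₂ θ) =
      Real.exp (θ * β ^ 2 / 2 * (ofLp x ⬝ᵥ (N⁻¹ • (Ξ * Ξᵀ)) *ᵥ ofLp x)) := by
    intro x
    set v : EuclideanSpace ℝ (Fin N₂) := toLp 2 ((β * (1 / √N)) • (Ξᵀ *ᵥ ofLp x)) with hv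
    have h1 : ∀ y, -β * rbmEnergy Ξ x y = inner ℝ v y := by
      intro y
      rw [PiLp.inner_apply, rbmEnergy, ← hN, ← mul_assoc, neg_mul_neg, Finset.mul_sum]
      refine Finset.sum_congr rfl fun j _ => ?_
      simp only [hv, Pi.smul_apply, smul_eq_mul, mulVec, dotProduct, transpose_apply,
        RCLike.inner_apply, conj_trivial]
      rw [← Finset.sum_mul]
      ring
    simp only [h1]
    rw [integral_exp_inner_gaussianPrior N₂ hθ]
    congr 1
    have h2 : ofLp v ⬝ᵥ ofLp v = β ^ 2 * N⁻¹ * (ofLp x ⬝ᵥ (Ξ * Ξᵀ) *ᵥ ofLp x) := by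
      have h3 : ofLp v = (β * (1 / √N)) • (Ξᵀ *ᵥ ofLp x) := rfl
      rw [h3, smul_dotProduct, dotProduct_smul, smul_smul, ← mulVec_mulVec, dotProduct_mulVec _ Ξ,
        ← mulVec_transpose, smul_eq_mul]
      congr 1
      rw [mul_mul_mul_comm, ← sq, ← sq, div_pow, Real.sq_sqrt hN0]
      ring
    rw [h2, smul_mulVec, dotProduct_smul, smul_eq_mul]
    ring
  have hcont : Continuous fun x : EuclideanSpace ℝ (Fin N₁) => Real.exp (θ * β ^ 2 / 2 *
      (ofLp x ⬝ᵥ (N⁻¹ • (Ξ * Ξᵀ)) *ᵥ ofLp x)) := by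
    simp only [dotProduct, mulVec]
    fun_prop
  have hprod := hint.integral_prod_left
  simp only [hin] at hprod
  rw [rbmPartitionFunction, integral_prod _ hint]
  simp only [hin]
  rw [ofReal_integral_eq_lintegral_ofReal hprod (ae_of_all _ fun x => (Real.exp_pos _).le)]

variable {Ω : Type*}

theorem sampleCov_eq (ξ : ℕ → ℕ → Ω → ℝ) (p : ℕ × ℕ) (ω : Ω) :
    sampleCov ξ p ω = ((p.1 : ℝ) + p.2)⁻¹ •
      ((of fun (i : Fin p.1) (j : Fin p.2) => ξ i j ω) *
        (of fun (i : Fin p.1) (j : Fin p.2) => ξ i j ω)ᵀ) := by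
  ext i k
  simp only [sampleCov, of_apply, Finset.sum_apply, BarrierData.rankOne, Pi.smul_apply,
    Matrix.smul_apply, mul_apply, transpose_apply, smul_eq_mul]
  rw [Finset.sum_range (fun j => (√((p.1 : ℝ) + p.2))⁻¹ * ξ i j ω *
    ((√((p.1 : ℝ) + p.2))⁻¹ * ξ k j ω)), Finset.mul_sum]
  refine Finset.sum_congr rfl fun j _ => ?_
  rw [mul_mul_mul_comm, ← mul_inv, Real.mul_self_sqrt (by positivity)]

end PartitionFunction

/-! ### Typical Gaussian vectors -/

section GaussianEvents

open Matrix

theorem isStdSubgaussian_gaussianReal : IsStdSubgaussian (gaussianReal 0 1) 1 where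
  subg := by
    refine ⟨fun t => ?_, fun t => ?_⟩
    · exact integrable_exp_mul_gaussianReal t
    · rw [mgf_fun_id_gaussianReal]; simp
  mean := by simp
  var := by
    have h := variance_fun_id_gaussianReal (μ := 0) (v := 1)
    rw [variance_eq_integral (by fun_prop)] at h
    simpa using h

variable {n : ℕ}

theorem measure_sum_sq_dev_le (c : Fin n → ℝ) {t : ℝ} (ht : 0 < t) :
    (Measure.pi fun _ : Fin n => gaussianReal 0 1) {g | t ≤ |∑ i, c i * g i ^ 2 - ∑ i, c i|} ≤
      ENNReal.ofReal (quadConst 1 1 * (∑ i, c i ^ 2) / t ^ 2) := by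
  have h := isStdSubgaussian_gaussianReal.measure_quadForm_le (B := diagonal c)
    (isSymm_diagonal c) one_ne_zero ht
  have e1 : ∀ g : Fin n → ℝ, g ⬝ᵥ diagonal c *ᵥ g = ∑ i, c i * g i ^ 2 := by
    intro g
    rw [dotProduct]
    refine Finset.sum_congr rfl fun i _ => ?_
    rw [mulVec_diagonal]; ring
  have e2 : ∑ i, ∑ j, diagonal c i j ^ 2 = ∑ i, c i ^ 2 := by
    refine Finset.sum_congr rfl fun i _ => ?_
    rw [Finset.sum_eq_single i]
    · rw [diagonal_apply_eq]
    · intro j _ hj; rw [diagonal_apply_ne _ hj.symm]; simp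
    · simp
  simpa only [e1, e2, trace_diagonal, pow_one, mul_one] using h

/-- The same deviation bound with one coordinate left out. -/
theorem measure_sum_sq_erase_dev_le (c : Fin n → ℝ) (i₀ : Fin n) {b t : ℝ} (ht : 0 < t)
    (hb : |∑ i, c i - c i₀ - b| ≤ t) :
    (Measure.pi fun _ : Fin n => gaussianReal 0 1)
      {g | 2 * t ≤ |∑ i ∈ Finset.univ.erase i₀, c i * g i ^ 2 - b|} ≤
      ENNReal.ofReal (quadConst 1 1 * (∑ i, c i ^ 2) / t ^ 2) := by
  have hsum : ∀ f : Fin n → ℝ → ℝ, f i₀ 0 = 0 →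
      ∑ i, f i (Function.update c i₀ 0 i) = ∑ i ∈ Finset.univ.erase i₀, f i (c i) := by
    intro f hf
    rw [← Finset.add_sum_erase _ _ (Finset.mem_univ i₀), Function.update_self, hf, zero_add]
    refine Finset.sum_congr rfl fun i hi => ?_
    rw [Function.update_of_ne (Finset.ne_of_mem_erase hi)]
  have h := measure_sum_sq_dev_le (Function.update c i₀ 0) ht
  have h2 : ∑ i, Function.update c i₀ 0 i = ∑ i ∈ Finset.univ.erase i₀, c i :=
    hsum (fun _ x => x) rfl
  have h3 : ∑ i, Function.update c i₀ 0 i ^ 2 = ∑ i ∈ Finset.univ.erase i₀, c i ^ 2 :=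
    hsum (fun _ x => x ^ 2) (by simp)
  refine (measure_mono ?_).trans (h.trans (ENNReal.ofReal_le_ofReal ?_))
  · intro g hg
    have h1 : ∑ i, Function.update c i₀ 0 i * g i ^ 2 =
        ∑ i ∈ Finset.univ.erase i₀, c i * g i ^ 2 := hsum (fun i x => x * g i ^ 2) (by simp)
    rw [Set.mem_ofPred_eq] at hg ⊢
    have h6 : ∑ i ∈ Finset.univ.erase i₀, c i = ∑ i, c i - c i₀ :=
      Finset.sum_erase_eq_sub (Finset.mem_univ i₀)
    rw [h1, h2, h6]
    have h4 := abs_add_le (∑ i ∈ Finset.univ.erase i₀, c i * g i ^ 2 - (∑ i, c i - c i₀))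
      (∑ i, c i - c i₀ - b)
    have h5 : ∑ i ∈ Finset.univ.erase i₀, c i * g i ^ 2 - (∑ i, c i - c i₀) +
      (∑ i, c i - c i₀ - b) = ∑ i ∈ Finset.univ.erase i₀, c i * g i ^ 2 - b := by ring
    rw [h5] at h4
    linarith
  · rw [h3]
    have := quadConst_nonneg 1 1
    gcongr
    exact Finset.erase_subset _ _

/-- The probability that the square of a standard Gaussian variable is near `r`. -/
noncomputable def nearProb (r δ : ℝ) : ℝ := (gaussianReal 0 1).real {x | |x ^ 2 - r| ≤ δ}

theorem nearProb_pos {r δ : ℝ} (hr : 0 ≤ r) (hδ : 0 < δ) : 0 < nearProb r δ := by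
  have ho : IsOpen {x : ℝ | |x ^ 2 - r| < δ} := isOpen_lt (by fun_prop) (by fun_prop)
  have hne : {x : ℝ | |x ^ 2 - r| < δ}.Nonempty := ⟨√r, by
    rw [Set.mem_ofPred_eq, Real.sq_sqrt hr, sub_self, abs_zero]; exact hδ⟩
  have h1 : (gaussianReal 0 1) {x : ℝ | |x ^ 2 - r| < δ} ≠ 0 := fun h0 =>
    (ho.measure_pos volume hne).ne' (gaussianReal_absolutelyContinuous' 0 one_ne_zero h0)
  have h2 : (gaussianReal 0 1) {x : ℝ | |x ^ 2 - r| ≤ δ} ≠ 0 := fun h0 =>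
    h1 (measure_mono_null (fun x (hx : |x ^ 2 - r| < δ) => hx.le) h0)
  exact ENNReal.toReal_pos h2 (measure_ne_top _ _)

/-- With probability bounded below the Gaussian vector is typical. -/
theorem le_measure_typical {K r δ e s : ℝ} (hδ : 0 < δ) (he : 0 < e)
    {l : Fin n → ℝ} (hl : ∀ i, l i ≤ s - e) (i₀ : Fin n)
    (htr : |(∑ i, (s - l i)⁻¹) / n - (K - r)| ≤ δ / 2)
    (hn1 : 1 + e⁻¹ ≤ n * δ / 2)
    (hn2 : quadConst 1 1 * (4 + e⁻¹ ^ 2) / (n * δ ^ 2) ≤ nearProb r δ / 2) :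
    ENNReal.ofReal (nearProb r δ / 2) ≤ (Measure.pi fun _ : Fin n => gaussianReal 0 1)
      {g | |g i₀ ^ 2 - r| ≤ δ ∧ |(∑ i ∈ Finset.univ.erase i₀, g i ^ 2) / n - 1| ≤ δ ∧
        |(∑ i ∈ Finset.univ.erase i₀, g i ^ 2 / (s - l i)) / n - (K - r)| ≤ 2 * δ} := by
  have hei : 0 < e⁻¹ := inv_pos.2 he
  have hn0 : (0 : ℝ) < n := by
    by_contra h
    have : (n : ℝ) = 0 := le_antisymm (not_lt.1 h) (Nat.cast_nonneg n)
    rw [this] at hn1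
    linarith
  set γ := Measure.pi fun _ : Fin n => gaussianReal 0 1 with hγ
  have hQ := quadConst_nonneg 1 1
  set S1 : Set (Fin n → ℝ) := {g | |g i₀ ^ 2 - r| ≤ δ} with hS1
  set T2 : Set (Fin n → ℝ) :=
    {g | 2 * ((n : ℝ) * δ / 2) ≤ |∑ i ∈ Finset.univ.erase i₀, 1 * g i ^ 2 - (n : ℝ)|} with hT2
  set T3 : Set (Fin n → ℝ) := {g | 2 * ((n : ℝ) * δ) ≤
    |∑ i ∈ Finset.univ.erase i₀, (s - l i)⁻¹ * g i ^ 2 - (n : ℝ) * (K - r)|} with hT3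
  set T : Set (Fin n → ℝ) :=
      {g | |g i₀ ^ 2 - r| ≤ δ ∧ |(∑ i ∈ Finset.univ.erase i₀, g i ^ 2) / n - 1| ≤ δ ∧
        |(∑ i ∈ Finset.univ.erase i₀, g i ^ 2 / (s - l i)) / n - (K - r)| ≤ 2 * δ} with hT
  -- The event for i₀ has a probability independent of n, while the two sums fail with probability
  -- O(1/n); a union bound suffices, without independence.
  have hsub : S1 ⊆ T ∪ (T2 ∪ T3) := by
    intro g hg
    by_cases h2 : g ∈ T2
    · exact Or.inr (Or.inl h2)
    by_cases h3 : g ∈ T3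
    · exact Or.inr (Or.inr h3)
    refine Or.inl ⟨hg, ?_, ?_⟩
    · rw [hT2, Set.mem_ofPred_eq, not_le] at h2
      simp only [one_mul] at h2
      rw [div_sub_one hn0.ne', abs_div, abs_of_pos hn0, div_le_iff₀ hn0]
      linarith
    · rw [hT3, Set.mem_ofPred_eq, not_le] at h3
      have : (∑ i ∈ Finset.univ.erase i₀, g i ^ 2 / (s - l i)) / n - (K - r) =
          (∑ i ∈ Finset.univ.erase i₀, (s - l i)⁻¹ * g i ^ 2 - (n : ℝ) * (K - r)) / n := by
        simp only [div_eq_inv_mul]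
        field_simp
      rw [this, abs_div, abs_of_pos hn0, div_le_iff₀ hn0]
      linarith
  have p1 : γ S1 = ENNReal.ofReal (nearProb r δ) := by
    have hms : MeasurableSet {x : ℝ | |x ^ 2 - r| ≤ δ} :=
      measurableSet_le (by fun_prop) measurable_const
    have := (measurePreserving_eval (fun _ : Fin n => gaussianReal 0 1) i₀).measure_preimage
      hms.nullMeasurableSet
    rw [nearProb, ofReal_measureReal]
    exact this
  have p2 : γ T2 ≤ ENNReal.ofReal (quadConst 1 1 * 4 / (n * δ ^ 2)) := by
    refine (measure_sum_sq_erase_dev_le (fun _ => 1) i₀ (by positivity) ?_).trans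
      (ENNReal.ofReal_le_ofReal (le_of_eq ?_))
    · simp only [Finset.sum_const, Finset.card_univ, Fintype.card_fin, nsmul_eq_mul, mul_one]
      rw [sub_right_comm, sub_self, zero_sub, abs_neg, abs_one]
      linarith
    · simp only [one_pow, Finset.sum_const, Finset.card_univ, Fintype.card_fin, nsmul_eq_mul,
        mul_one]
      field_simp
      norm_num
  have hc : ∀ i, 0 ≤ (s - l i)⁻¹ ∧ (s - l i)⁻¹ ≤ e⁻¹ := by
    intro i
    have h1 : e ≤ s - l i := by linarith [hl i]
    exact ⟨inv_nonneg.2 (he.le.trans h1), by gcongr⟩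
  have p3 : γ T3 ≤ ENNReal.ofReal (quadConst 1 1 * e⁻¹ ^ 2 / (n * δ ^ 2)) := by
    refine (measure_sum_sq_erase_dev_le (fun i => (s - l i)⁻¹) i₀ (by positivity) ?_).trans
      (ENNReal.ofReal_le_ofReal ?_)
    · have h1 : ∑ i, (s - l i)⁻¹ - (s - l i₀)⁻¹ - n * (K - r) =
          n * ((∑ i, (s - l i)⁻¹) / n - (K - r)) - (s - l i₀)⁻¹ := by field_simp; ring
      rw [h1]
      refine (abs_sub _ _).trans ?_
      rw [abs_mul, abs_of_pos hn0, abs_of_nonneg (hc i₀).1]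
      have := mul_le_mul_of_nonneg_left htr hn0.le
      linarith [(hc i₀).2]
    · have h2 : ∑ i, (s - l i)⁻¹ ^ 2 ≤ n * e⁻¹ ^ 2 := by
        calc ∑ i, (s - l i)⁻¹ ^ 2 ≤ ∑ _i : Fin n, e⁻¹ ^ 2 :=
              Finset.sum_le_sum fun i _ => pow_le_pow_left₀ (hc i).1 (hc i).2 2
          _ = n * e⁻¹ ^ 2 := by simp
      calc quadConst 1 1 * (∑ i, (s - l i)⁻¹ ^ 2) / (n * δ) ^ 2
          ≤ quadConst 1 1 * (n * e⁻¹ ^ 2) / (n * δ) ^ 2 := by gcongr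
        _ = _ := by field_simp
  have p4 : ENNReal.ofReal (nearProb r δ) ≤ γ T + ENNReal.ofReal (nearProb r δ / 2) := by
    rw [← p1]
    refine (measure_mono hsub).trans ((measure_union_le _ _).trans ?_)
    gcongr
    refine (measure_union_le _ _).trans ((add_le_add p2 p3).trans ?_)
    rw [← ENNReal.ofReal_add (by positivity) (by positivity)]
    refine ENNReal.ofReal_le_ofReal (le_trans (le_of_eq ?_) hn2)
    ring
  have p5 : ENNReal.ofReal (nearProb r δ) =
      ENNReal.ofReal (nearProb r δ / 2) + ENNReal.ofReal (nearProb r δ / 2) := by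
    have : 0 ≤ nearProb r δ := measureReal_nonneg
    rw [← ENNReal.ofReal_add (by positivity) (by positivity), add_halves]
  rw [p5] at p4
  exact (ENNReal.add_le_add_iff_right ENNReal.ofReal_ne_top).1 p4

end GaussianEvents

/-! ### Two-sided bounds for the logarithm of a spherical integral -/

section LogBounds

open Matrix WithLp

variable {n : ℕ} {A : Matrix (Fin n) (Fin n) ℝ} {R κ s Z : ℝ}

theorem log_inv_sqrt_mul {D x : ℝ} (hD : 0 < D) (hx : 0 < x) :
    Real.log ((√D)⁻¹ * x) = Real.log x - Real.log D / 2 := by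
  rw [Real.log_mul (inv_pos.2 (Real.sqrt_pos.2 hD)).ne' hx.ne', Real.log_inv, Real.log_sqrt hD.le]
  ring

/-- Upper bound for a spherical integral of the exponential of a quadratic form. -/
theorem log_le_of_ofReal_eq_lintegral (hn : 0 < n) (hR : 0 < R) (hκ : 0 < κ)
    (hA : A.IsHermitian) (hs : (shiftMat s A).PosDef) (hZ : 0 < Z)
    (h : ENNReal.ofReal Z = ∫⁻ x, ENNReal.ofReal (Real.exp (κ / 2 * (ofLp x ⬝ᵥ A *ᵥ ofLp x)))
      ∂(sphericalPrior n R)) :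
    Real.log Z ≤ n / 2 * (κ * R ^ 2 * s - 1 - Real.log (κ * R ^ 2)) - logDetShift s A / 2 := by
  obtain ⟨U, l, h1, h2, hAU, hpd, -, -, hdet, -, -⟩ := hA.exists_resolvent_diagonal
  have hl := (hpd s).1 hs
  have hpos : ∀ i, 0 < s - l i := fun i => sub_pos.2 (hl i)
  have hK : 0 < κ * R ^ 2 := by positivity
  have hD : 0 < ∏ i, (s - l i) := Finset.prod_pos fun i _ => hpos i
  rw [logDetShift, hdet]
  rw [hAU, lintegral_sphericalPrior_exp_quadForm hn hR h1 h2 l hpos] at h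
  have hle : ∫⁻ g, ENNReal.ofReal (sphereIntegrand (κ * R ^ 2) l (fun i => s - l i) g)
      ∂(Measure.pi fun _ : Fin n => gaussianReal 0 1) ≤
      ENNReal.ofReal (Real.exp (n / 2 * (κ * R ^ 2 * s - 1 - Real.log (κ * R ^ 2)))) := by
    refine (lintegral_mono fun g => ENNReal.ofReal_le_ofReal (sphereIntegrand_le hn hK hl g)).trans
      (le_of_eq ?_)
    rw [lintegral_const, measure_univ, mul_one]
  have h3 : ENNReal.ofReal Z ≤ ENNReal.ofReal ((√(∏ i, (s - l i)))⁻¹ *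
      Real.exp (n / 2 * (κ * R ^ 2 * s - 1 - Real.log (κ * R ^ 2)))) := by
    rw [h, ENNReal.ofReal_mul (by positivity)]
    gcongr
  have h4 := (ENNReal.ofReal_le_ofReal_iff (by positivity)).1 h3
  refine (Real.log_le_log hZ h4).trans (le_of_eq ?_)
  rw [log_inv_sqrt_mul hD (Real.exp_pos _), Real.log_exp]

/-- The exponential rate in the lower bound of a spherical integral. -/
noncomputable def lowerRate (K s r δ Δ : ℝ) : ℝ :=
  K * s - K * (1 + δ) / (K - 3 * δ) - K * (Δ * (r + δ)) / (K - 3 * δ)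
    + Real.log ((1 - δ) / (K + 3 * δ))

theorem tendsto_lowerRate {K : ℝ} (hK : 0 < K) (s r Δ : ℝ) :
    Tendsto (fun δ => lowerRate K s r δ Δ) (𝓝 0) (𝓝 (K * s - 1 - Real.log K - Δ * r)) := by
  have h : ContinuousAt (fun δ => lowerRate K s r δ Δ) 0 := by
    unfold lowerRate
    have h1 : K - 3 * (0 : ℝ) ≠ 0 := by simpa using hK.ne'
    have h2 : K + 3 * (0 : ℝ) ≠ 0 := by simpa using hK.ne'
    have h3 : (1 - (0 : ℝ)) / (K + 3 * 0) ≠ 0 := by simpa using hK.ne'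
    fun_prop (disch := assumption)
  have h0 : lowerRate K s r 0 Δ = K * s - 1 - Real.log K - Δ * r := by
    unfold lowerRate
    simp only [mul_zero, add_zero, sub_zero, mul_one, one_div, Real.log_inv]
    field_simp
    ring
  rw [← h0]
  exact h.tendsto

/-- Lower bound for a spherical integral of the exponential of a quadratic form. -/
theorem le_log_of_ofReal_eq_lintegral {r δ e Δ : ℝ} (hn : 0 < n) (hR : 0 < R) (hκ : 0 < κ)
    (hA : A.IsHermitian) (he : 0 < e) (hs : (shiftMat (s - e) A).PosSemidef)
    (hΔ : ¬ (shiftMat (s - Δ) A).PosDef)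
    (hr : 0 ≤ r) (hδ : 0 < δ) (hδ1 : δ < 1) (hδK : 3 * δ < κ * R ^ 2)
    (htr : |resTrace s A 1 / n - (κ * R ^ 2 - r)| ≤ δ / 2)
    (hn1 : 1 + e⁻¹ ≤ n * δ / 2)
    (hn2 : quadConst 1 1 * (4 + e⁻¹ ^ 2) / (n * δ ^ 2) ≤ nearProb r δ / 2)
    (h : ENNReal.ofReal Z = ∫⁻ x, ENNReal.ofReal (Real.exp (κ / 2 * (ofLp x ⬝ᵥ A *ᵥ ofLp x)))
      ∂(sphericalPrior n R)) :
    n / 2 * lowerRate (κ * R ^ 2) s r δ Δ - logDetShift s A / 2 + Real.log e / 2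
      + Real.log (nearProb r δ / 2) ≤ Real.log Z := by
  obtain ⟨U, l, h1, h2, hAU, hpd, hps, -, hdet, -, htrace⟩ := hA.exists_resolvent_diagonal
  have hle := (hps (s - e)).1 hs
  have hl : ∀ i, l i < s := fun i => by linarith [hle i]
  have hn0 : (1 : ℝ) ≤ n := by exact_mod_cast hn
  rw [hpd] at hΔ
  push Not at hΔ
  obtain ⟨i₀, hi₀⟩ := hΔ
  have hpos : ∀ i, 0 < s - l i := fun i => sub_pos.2 (hl i)
  have hK : 0 < κ * R ^ 2 := by positivity
  have hp := nearProb_pos hr hδ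
  set d := Function.update (fun i => s - l i) i₀ (n : ℝ)⁻¹ with hd
  have hdpos : ∀ i, 0 < d i := by
    intro i
    rcases eq_or_ne i i₀ with rfl | hi
    · rw [hd, Function.update_self]; positivity
    · rw [hd, Function.update_of_ne hi]; exact hpos i
  have hprod : ∏ i, d i = (n : ℝ)⁻¹ * ∏ i ∈ Finset.univ.erase i₀, (s - l i) := by
    rw [← Finset.mul_prod_erase _ _ (Finset.mem_univ i₀), hd, Function.update_self]
    congr 1
    refine Finset.prod_congr rfl fun i hi => ?_
    rw [Function.update_of_ne (Finset.ne_of_mem_erase hi)]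
  have hprod2 : ∏ i, (s - l i) = (s - l i₀) * ∏ i ∈ Finset.univ.erase i₀, (s - l i) :=
    (Finset.mul_prod_erase _ _ (Finset.mem_univ i₀)).symm
  have hE : 0 < ∏ i ∈ Finset.univ.erase i₀, (s - l i) := Finset.prod_pos fun i _ => hpos i
  have hD : 0 < ∏ i, d i := Finset.prod_pos fun i _ => hdpos i
  rw [logDetShift, hdet, hprod2]
  rw [htrace s hl] at htr
  simp only [pow_one] at htr
  rw [hAU, lintegral_sphericalPrior_exp_quadForm hn hR h1 h2 l hdpos] at h
  have htyp := le_measure_typical hδ he hle i₀ htr hn1 hn2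
  have hlow : ENNReal.ofReal (Real.exp (n / 2 * lowerRate (κ * R ^ 2) s r δ Δ)) *
      ENNReal.ofReal (nearProb r δ / 2) ≤
      ∫⁻ g, ENNReal.ofReal (sphereIntegrand (κ * R ^ 2) l d g)
      ∂(Measure.pi fun _ : Fin n => gaussianReal 0 1) := by
    have hms : MeasurableSet {g : Fin n → ℝ | |g i₀ ^ 2 - r| ≤ δ ∧
        |(∑ i ∈ Finset.univ.erase i₀, g i ^ 2) / n - 1| ≤ δ ∧
        |(∑ i ∈ Finset.univ.erase i₀, g i ^ 2 / (s - l i)) / n - (κ * R ^ 2 - r)| ≤ 2 * δ} := by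
      have m1 : Measurable fun g : Fin n → ℝ => |g i₀ ^ 2 - r| := by fun_prop
      have m2 : Measurable fun g : Fin n → ℝ =>
        |(∑ i ∈ Finset.univ.erase i₀, g i ^ 2) / n - 1| := by fun_prop
      have m3 : Measurable fun g : Fin n → ℝ =>
        |(∑ i ∈ Finset.univ.erase i₀, g i ^ 2 / (s - l i)) / n - (κ * R ^ 2 - r)| := by fun_prop
      exact (measurableSet_le m1 measurable_const).inter
        ((measurableSet_le m2 measurable_const).inter (measurableSet_le m3 measurable_const))
    refine (mul_le_mul_right htyp _).trans ?_
    rw [← setLIntegral_const]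
    refine (setLIntegral_mono' hms fun g hg => ENNReal.ofReal_le_ofReal ?_).trans
      (setLIntegral_le_lintegral _ _)
    exact le_sphereIntegrand hK hr hδ hδ1 hδK hl i₀ (by linarith) hn hg.1 hg.2.1 hg.2.2
  have h3 : ENNReal.ofReal ((√(∏ i, d i))⁻¹ * (Real.exp (n / 2 * lowerRate (κ * R ^ 2) s r δ Δ) *
      (nearProb r δ / 2))) ≤ ENNReal.ofReal Z := by
    rw [h, ENNReal.ofReal_mul (by positivity), ENNReal.ofReal_mul (by positivity)]
    gcongr
  have hX : 0 < Real.exp (n / 2 * lowerRate (κ * R ^ 2) s r δ Δ) * (nearProb r δ / 2) := by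
    positivity
  have h4 : (√(∏ i, d i))⁻¹ * (Real.exp (n / 2 * lowerRate (κ * R ^ 2) s r δ Δ) *
      (nearProb r δ / 2)) ≤ Z := by
    rcases le_or_gt 0 Z with hZ | hZ
    · exact (ENNReal.ofReal_le_ofReal_iff hZ).1 h3
    · rw [ENNReal.ofReal_of_nonpos hZ.le, nonpos_iff_eq_zero, ENNReal.ofReal_eq_zero] at h3
      exact absurd h3 (not_le.2 (by positivity))
  refine le_trans ?_ (Real.log_le_log (by positivity) h4)
  rw [log_inv_sqrt_mul hD hX, Real.log_mul (Real.exp_pos _).ne' (by positivity), Real.log_exp,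
    hprod, Real.log_mul (inv_pos.2 (by linarith)).ne' hE.ne', Real.log_mul (hpos i₀).ne' hE.ne',
    Real.log_inv]
  -- The modified weight at i₀ replaces the factor s - l i₀ of the determinant by 1/n. In the
  -- logarithm this adds (log n + log (s - l i₀))/2, at least (log e)/2, a constant that vanishes
  -- after division by the size.
  have h5 : Real.log e ≤ Real.log (s - l i₀) := Real.log_le_log he (by linarith [hle i₀])
  have h6 : 0 ≤ Real.log n := Real.log_nonneg hn0
  linarith

end LogBounds

/-! ### Limits of the free energy at a spectral parameter above the edge -/

section Limit

open Matrix WithLp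

/-- The spectra of a family of matrices are asymptotically under control at `specPoint α w`. -/
structure LimControl (α w : ℝ) (A : ∀ p : ℕ × ℕ, Matrix (Fin p.1) (Fin p.1) ℝ) : Prop where
  gap : ∃ e > 0, ∀ᶠ p in sizeFilter α, (A p).PosSemidef ∧
    (shiftMat (specPoint α w - e) (A p)).PosSemidef
  stieltjes : Tendsto (fun p : ℕ × ℕ => resTrace (specPoint α w) (A p) 1 / ((p.1 : ℝ) + p.2))
    (sizeFilter α) (𝓝 (limStieltjes α w))
  logDet : Tendsto (fun p : ℕ × ℕ => logDetShift (specPoint α w) (A p) / ((p.1 : ℝ) + p.2))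
    (sizeFilter α) (𝓝 (limLogDet α w))

/-- The limiting free energy as a function of the spectral parameter. -/
noncomputable def rateFun (K α w : ℝ) : ℝ :=
  α / 2 * (K * specPoint α w - 1 - Real.log K) - limLogDet α w / 2

theorem sq_lt_of_sqrt_lt {α w : ℝ} (hw : √(α * (1 - α)) < w) : 0 < w ∧ α * (1 - α) < w ^ 2 := by
  have h0 : 0 < w := (Real.sqrt_nonneg _).trans_lt hw
  exact ⟨h0, (Real.sqrt_lt' h0).1 hw⟩

theorem ae_limControl {Ω : Type*} [MeasurableSpace Ω] {P : Measure Ω} [IsProbabilityMeasure P]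
    {ν : Measure ℝ} {c : NNReal} {ξ : ℕ → ℕ → Ω → ℝ} [IsProbabilityMeasure ν]
    (hν : IsStdSubgaussian ν c) (hm : ∀ i j, Measurable (ξ i j))
    (hind : iIndepFun (fun (p : ℕ × ℕ) (ω : Ω) => ξ p.1 p.2 ω) P)
    (hlaw : ∀ i j, P.map (ξ i j) = ν) {α w : ℝ} (h0 : 0 < α) (h1 : α < 1)
    (hw : √(α * (1 - α)) < w) :
    ∀ᵐ ω ∂P, LimControl α w fun p => sampleCov ξ p ω := by
  obtain ⟨hw0, hw2⟩ := sq_lt_of_sqrt_lt hw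
  obtain ⟨b⟩ := exists_barrierParams h0 h1 hw0 hw2
  have h : ∀ᵐ ω ∂P, ∀ k : ℕ, ∀ᶠ p in sizeFilter α,
      SpectralControl α w b.e (1 / ((k : ℝ) + 1)) ((p.1 : ℝ) + p.2) (sampleCov ξ p ω) :=
    ae_all_iff.2 fun k => ae_eventually_spectralControl hν hm hind hlaw h0 h1 hw0 b (by positivity)
  filter_upwards [h] with ω hω
  have htend : ∀ (f : ℕ × ℕ → ℝ) (x : ℝ),
      (∀ k : ℕ, ∀ᶠ p in sizeFilter α, |f p - x| ≤ 1 / ((k : ℝ) + 1)) →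
        Tendsto f (sizeFilter α) (𝓝 x) := by
    intro f x hf
    refine Metric.tendsto_nhds.2 fun ε hε => ?_
    obtain ⟨k, hk⟩ := exists_nat_one_div_lt hε
    filter_upwards [hf k] with p hp
    rw [Real.dist_eq]
    linarith
  refine ⟨⟨b.e, b.e_pos, (hω 0).mono fun p hp => ⟨hp.posSemidef, hp.gap⟩⟩, ?_, ?_⟩
  · exact htend _ _ fun k => (hω k).mono fun p hp => hp.stieltjes
  · exact htend _ _ fun k => (hω k).mono fun p hp => hp.logDet

variable {α w R κ : ℝ} {A : ∀ p : ℕ × ℕ, Matrix (Fin p.1) (Fin p.1) ℝ} {Z : ℕ × ℕ → ℝ}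

/-- The saddle point bound needs only that s lies above the spectrum, so there is no relation
between w and K. -/
theorem LimControl.eventually_le (h : LimControl α w A) (hR : 0 < R) (hκ : 0 < κ)
    (hZ : ∀ p : ℕ × ℕ, 0 < p.1 → 0 < Z p)
    (hZA : ∀ p : ℕ × ℕ, ENNReal.ofReal (Z p) = ∫⁻ x,
      ENNReal.ofReal (Real.exp (κ / 2 * (ofLp x ⬝ᵥ A p *ᵥ ofLp x))) ∂(sphericalPrior p.1 R))
    {η : ℝ} (hη : 0 < η) :
    ∀ᶠ p in sizeFilter α, Real.log (Z p) / ((p.1 : ℝ) + p.2) ≤ rateFun (κ * R ^ 2) α w + η := by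
  obtain ⟨e, he, hgap⟩ := h.gap
  set c := κ * R ^ 2 * specPoint α w - 1 - Real.log (κ * R ^ 2) with hc
  have hlim : Tendsto (fun p : ℕ × ℕ => (p.1 : ℝ) / ((p.1 : ℝ) + p.2) / 2 * c -
      logDetShift (specPoint α w) (A p) / ((p.1 : ℝ) + p.2) / 2) (sizeFilter α)
      (𝓝 (rateFun (κ * R ^ 2) α w)) :=
    ((tendsto_ratio.div_const 2).mul_const c).sub (h.logDet.div_const 2)
  filter_upwards [hgap, hlim.eventually_le_const (lt_add_of_pos_right _ hη),
    tendsto_fst_sizeFilter.eventually_gt_atTop 0] with p hp hl hp1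
  have hp1' : 0 < p.1 := by exact_mod_cast hp1
  have hN : 0 < (p.1 : ℝ) + p.2 := by positivity
  have hA := hp.1.isHermitian
  have hup := log_le_of_ofReal_eq_lintegral hp1' hR hκ hA
    (shiftMat_posDef_of_gap hA he hp.2) (hZ p hp1') (hZA p)
  refine le_trans ?_ hl
  rw [div_le_iff₀ hN]
  refine hup.trans (le_of_eq ?_)
  rw [← hc]
  field_simp

/-- The limit of tr (s - A)⁻¹ / N₁ is (α + w)⁻¹, so r is the defect in the saddle point equation. It
is carried by an eigenvector with eigenvalue at least s - Δ, whence the loss αΔr/2. -/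
theorem LimControl.eventually_ge (h : LimControl α w A) (h0 : 0 < α) (hw : 0 < w)
    (hR : 0 < R) (hκ : 0 < κ)
    (hZA : ∀ p : ℕ × ℕ, ENNReal.ofReal (Z p) = ∫⁻ x,
      ENNReal.ofReal (Real.exp (κ / 2 * (ofLp x ⬝ᵥ A p *ᵥ ofLp x))) ∂(sphericalPrior p.1 R))
    {r Δ : ℝ} (hr0 : 0 ≤ r) (hr : κ * R ^ 2 - r = (α + w)⁻¹)
    (hΔ : ∀ᶠ p in sizeFilter α, ¬ (shiftMat (specPoint α w - Δ) (A p)).PosDef)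
    {η : ℝ} (hη : 0 < η) :
    ∀ᶠ p in sizeFilter α, rateFun (κ * R ^ 2) α w - α / 2 * (Δ * r) - η ≤
      Real.log (Z p) / ((p.1 : ℝ) + p.2) := by
  obtain ⟨e, he, hgap⟩ := h.gap
  have hK : 0 < κ * R ^ 2 := by positivity
  set K := κ * R ^ 2 with hKd
  set s := specPoint α w with hs
  set c := K * s - 1 - Real.log K - Δ * r with hc
  obtain ⟨δ, ⟨⟨hδc, hδ1⟩, hδK⟩, hδ⟩ : ∃ δ : ℝ, ((c - η / α < lowerRate K s r δ Δ ∧ δ < 1) ∧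
      δ < K / 3) ∧ δ ∈ Set.Ioi (0 : ℝ) := by
    refine Eventually.exists (f := 𝓝[>] (0 : ℝ)) ?_
    refine Eventually.and (Eventually.filter_mono nhdsWithin_le_nhds ?_) self_mem_nhdsWithin
    have hηα : 0 < η / α := by positivity
    refine (((tendsto_lowerRate hK s r Δ).eventually_const_lt (by linarith)).and
      (eventually_lt_nhds one_pos)).and (eventually_lt_nhds (by positivity))
  have hδ0 : 0 < δ := hδ
  set a := Real.log e / 2 + Real.log (nearProb r δ / 2) with ha
  have hlim : Tendsto (fun p : ℕ × ℕ => (p.1 : ℝ) / ((p.1 : ℝ) + p.2) / 2 * lowerRate K s r δ Δ -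
      logDetShift s (A p) / ((p.1 : ℝ) + p.2) / 2 + a / ((p.1 : ℝ) + p.2)) (sizeFilter α)
      (𝓝 (α / 2 * lowerRate K s r δ Δ - limLogDet α w / 2 + 0)) :=
    (((tendsto_ratio.div_const 2).mul_const _).sub (h.logDet.div_const 2)).add
      (tendsto_const_nhds.div_atTop tendsto_size)
  have hlow : rateFun K α w - α / 2 * (Δ * r) - η <
      α / 2 * lowerRate K s r δ Δ - limLogDet α w / 2 + 0 := by
    have h2 := mul_lt_mul_of_pos_left hδc (half_pos h0)
    have h3 : α / 2 * (c - η / α) = α / 2 * c - η / 2 := by field_simp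
    rw [h3, hc] at h2
    rw [rateFun, ← hs]
    linarith
  have htr : Tendsto (fun p : ℕ × ℕ => |resTrace s (A p) 1 / p.1 - (K - r)|) (sizeFilter α)
      (𝓝 0) := by
    have h2 := ((h.stieltjes.div tendsto_ratio h0.ne').sub_const (K - r)).abs
    have h3 : limStieltjes α w / α - (K - r) = 0 := by
      rw [hr, limStieltjes]; field_simp; ring
    rw [h3, abs_zero] at h2
    refine h2.congr' ?_
    filter_upwards [tendsto_size.eventually_gt_atTop 0] with p hp
    rw [Pi.div_apply, div_div_div_cancel_right₀ hp.ne']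
  have hq : Tendsto (fun p : ℕ × ℕ => quadConst 1 1 * (4 + e⁻¹ ^ 2) / ((p.1 : ℝ) * δ ^ 2))
      (sizeFilter α) (𝓝 0) :=
    tendsto_const_nhds.div_atTop (tendsto_fst_sizeFilter.atTop_mul_const (by positivity))
  filter_upwards [hgap, hΔ, hlim.eventually_const_le hlow,
    tendsto_fst_sizeFilter.eventually_gt_atTop 0, htr.eventually_le_const (half_pos hδ0),
    hq.eventually_le_const (half_pos (nearProb_pos hr0 hδ0)),
    ((tendsto_fst_sizeFilter.atTop_mul_const hδ0).atTop_div_const two_pos).eventually_ge_atTop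
      (1 + e⁻¹)] with p hp hpd hl hp1 ht hq hn1
  have hp1' : 0 < p.1 := by exact_mod_cast hp1
  have hN : 0 < (p.1 : ℝ) + p.2 := by positivity
  have hlo := le_log_of_ofReal_eq_lintegral hp1' hR hκ hp.1.isHermitian he hp.2 hpd hr0 hδ0 hδ1
    (by linarith) ht hn1 hq (hZA p)
  refine hl.trans ?_
  rw [le_div_iff₀ hN]
  refine le_trans (le_of_eq ?_) hlo
  rw [ha]
  field_simp
  ring

/-- The largest eigenvalue is close to the spectral edge. -/
theorem LimControl.eventually_not_posDef {w₁ w₂ Δ : ℝ} (h1 : LimControl α w₁ A)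
    (h2 : LimControl α w₂ A) (h0 : 0 < α) (hw1 : 0 < w₁) (hsq : α * (1 - α) < w₁ ^ 2)
    (hw : w₁ < w₂) (hΔ : (α + w₁) * (1 - α * (1 - α) / (w₁ * w₂)) < Δ) :
    ∀ᶠ p in sizeFilter α, ¬ (shiftMat (specPoint α w₁ - Δ) (A p)).PosDef := by
  have hw2 : 0 < w₂ := hw1.trans hw
  have hlt := specPoint_lt hw1 hsq hw
  obtain ⟨e, he, hgap⟩ := h1.gap
  have hΔ0 : 0 < Δ := by
    refine lt_of_le_of_lt (mul_nonneg (by linarith) ?_) hΔ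
    rw [sub_nonneg, div_le_one (by positivity)]
    nlinarith
  set s₁ := specPoint α w₁ with hs1
  set s₂ := specPoint α w₂ with hs2
  have hlim : Tendsto (fun p : ℕ × ℕ => resTrace s₁ (A p) 1 / ((p.1 : ℝ) + p.2) -
      (1 + (s₂ - s₁) / Δ) * (resTrace s₂ (A p) 1 / ((p.1 : ℝ) + p.2))) (sizeFilter α)
      (𝓝 (limStieltjes α w₁ - (1 + (s₂ - s₁) / Δ) * limStieltjes α w₂)) :=
    h1.stieltjes.sub (h2.stieltjes.const_mul _)
  -- The assumed lower bound on Δ is exactly the condition for this sign.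
  have hpos : 0 < limStieltjes α w₁ - (1 + (s₂ - s₁) / Δ) * limStieltjes α w₂ := by
    have e1 : limStieltjes α w₁ - limStieltjes α w₂ =
        α * (w₂ - w₁) / ((α + w₁) * (α + w₂)) := by
      have : α + w₁ ≠ 0 := by positivity
      have : α + w₂ ≠ 0 := by positivity
      rw [limStieltjes, limStieltjes]; field_simp; ring
    have e2 : s₂ - s₁ = (w₂ - w₁) * (1 - α * (1 - α) / (w₁ * w₂)) := by
      rw [hs1, hs2, specPoint, specPoint]; field_simp; ring
    have e3 : limStieltjes α w₁ - (1 + (s₂ - s₁) / Δ) * limStieltjes α w₂ =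
        α * (w₂ - w₁) / ((α + w₁) * (α + w₂)) *
          ((Δ - (α + w₁) * (1 - α * (1 - α) / (w₁ * w₂))) / Δ) := by
      have h3 : limStieltjes α w₁ - (1 + (s₂ - s₁) / Δ) * limStieltjes α w₂ =
        (limStieltjes α w₁ - limStieltjes α w₂) - (s₂ - s₁) / Δ * limStieltjes α w₂ := by ring
      have : α + w₁ ≠ 0 := by positivity
      have : α + w₂ ≠ 0 := by positivity
      rw [h3, e1, e2, limStieltjes]
      generalize 1 - α * (1 - α) / (w₁ * w₂) = y
      field_simp
    rw [e3]
    have : 0 < w₂ - w₁ := by linarith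
    have : 0 < Δ - (α + w₁) * (1 - α * (1 - α) / (w₁ * w₂)) := by linarith
    positivity
  filter_upwards [hgap, hlim.eventually_const_lt hpos, tendsto_size.eventually_gt_atTop 0]
    with p hp hl hN hcon
  obtain ⟨U, l, -, -, -, hpd, -, -, -, -, htr⟩ := hp.1.isHermitian.exists_resolvent_diagonal
  have hlΔ := (hpd _).1 hcon
  have hl1 : ∀ i, l i < s₁ := fun i => by linarith [hlΔ i]
  have hl2 : ∀ i, l i < s₂ := fun i => by linarith [hl1 i]
  -- If all eigenvalues lay Δ below s₁, the trace would grow too slowly between s₂ and s₁ to match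
  -- the limits.
  have hkey : resTrace s₁ (A p) 1 ≤ (1 + (s₂ - s₁) / Δ) * resTrace s₂ (A p) 1 := by
    rw [htr _ hl1, htr _ hl2, Finset.mul_sum]
    refine Finset.sum_le_sum fun i _ => ?_
    have b1 : 0 < s₁ - l i := sub_pos.2 (hl1 i)
    have b2 : 0 < s₂ - l i := sub_pos.2 (hl2 i)
    have b3 : Δ ≤ s₁ - l i := by linarith [hlΔ i]
    have b4 : (s₁ - l i)⁻¹ = (1 + (s₂ - s₁) / (s₁ - l i)) * (s₂ - l i)⁻¹ := by
      field_simp; ring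
    rw [pow_one, pow_one, b4]
    have : 0 ≤ s₂ - s₁ := by linarith
    gcongr
  have h3 := div_le_div_of_nonneg_right hkey hN.le
  rw [mul_div_assoc] at h3
  linarith

/-- The trivial choice of Δ: since A ≥ 0, the matrix 0 - A is not positive definite. It suffices
when r = 0, because Δ enters only through Δr. -/
theorem eventually_not_posDef_zero (h : LimControl α w A) :
    ∀ᶠ p in sizeFilter α, ¬ (shiftMat (specPoint α w - specPoint α w) (A p)).PosDef := by
  obtain ⟨e, he, hgap⟩ := h.gap
  filter_upwards [hgap, tendsto_fst_sizeFilter.eventually_gt_atTop 0] with p hp hp1 hcon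
  have hp1' : 0 < p.1 := by exact_mod_cast hp1
  obtain ⟨U, l, -, -, -, hpd, -, hps, -, -, -⟩ := hp.1.isHermitian.exists_resolvent_diagonal
  have h1 := (hpd _).1 hcon ⟨0, hp1'⟩
  have h2 := hps.1 hp.1 ⟨0, hp1'⟩
  linarith

end Limit

/-! ### The two phases and the theorem -/

section Main

open Matrix WithLp

/-- The spectral parameter of the saddle point. -/
noncomputable def saddleParam (K α : ℝ) : ℝ := max √(α * (1 - α)) (K⁻¹ - α)

theorem continuousAt_rateFun {K α w : ℝ} (h0 : 0 < α) (hw : 0 < w) :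
    ContinuousAt (rateFun K α) w := by
  have h1 : w ≠ 0 := hw.ne'
  have h2 : α + w ≠ 0 := by positivity
  have h3 : 1 - α / (α + w) ≠ 0 := by
    have := one_sub_limStieltjes h2
    rw [limStieltjes] at this
    rw [this]; positivity
  unfold rateFun specPoint limLogDet limStieltjes
  fun_prop (disch := assumption)

variable {α R κ : ℝ} {A : ∀ p : ℕ × ℕ, Matrix (Fin p.1) (Fin p.1) ℝ} {Z : ℕ × ℕ → ℝ}

/-- The point near the edge at which the spectra are examined. -/
noncomputable def edgeSeq (α : ℝ) (k : ℕ) : ℝ := √(α * (1 - α)) + 1 / ((k : ℝ) + 1)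

theorem edgeSeq_gt (α : ℝ) (k : ℕ) : √(α * (1 - α)) < edgeSeq α k := by
  unfold edgeSeq
  have : 0 < 1 / ((k : ℝ) + 1) := by positivity
  linarith

theorem tendsto_edgeSeq (α : ℝ) : Tendsto (edgeSeq α) atTop (𝓝 √(α * (1 - α))) := by
  have := (tendsto_one_div_add_atTop_nhds_zero_nat (𝕜 := ℝ)).const_add √(α * (1 - α))
  rw [add_zero] at this
  exact this

/-- If 1/K - α lies above √(α(1-α)), the saddle point equation has a solution, and both bounds at
that point agree. Otherwise both bounds are taken at points decreasing to the edge: the upper one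
converges by continuity of `rateFun`, and the loss in the lower one vanishes because the largest
eigenvalue approaches the edge. -/
theorem tendsto_log_div_of_limControl (h0 : 0 < α) (h1 : α < 1) (hR : 0 < R) (hκ : 0 < κ)
    (hZ : ∀ p : ℕ × ℕ, 0 < p.1 → 0 < Z p)
    (hZA : ∀ p : ℕ × ℕ, ENNReal.ofReal (Z p) = ∫⁻ x,
      ENNReal.ofReal (Real.exp (κ / 2 * (ofLp x ⬝ᵥ A p *ᵥ ofLp x))) ∂(sphericalPrior p.1 R))
    (hsad : √(α * (1 - α)) < saddleParam (κ * R ^ 2) α →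
      LimControl α (saddleParam (κ * R ^ 2) α) A)
    (hedge : ∀ k, LimControl α (edgeSeq α k) A) :
    Tendsto (fun p : ℕ × ℕ => Real.log (Z p) / ((p.1 : ℝ) + p.2)) (sizeFilter α)
      (𝓝 (rateFun (κ * R ^ 2) α (saddleParam (κ * R ^ 2) α))) := by
  have hK : 0 < κ * R ^ 2 := by positivity
  set K := κ * R ^ 2 with hKd
  set w₀ := saddleParam K α with hw₀
  have hs0 : 0 < √(α * (1 - α)) := Real.sqrt_pos.2 (mul_pos h0 (by linarith))
  have hsq : √(α * (1 - α)) ^ 2 = α * (1 - α) := Real.sq_sqrt (mul_pos h0 (by linarith)).le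
  suffices h : ∀ η > 0, (∀ᶠ p in sizeFilter α,
      Real.log (Z p) / ((p.1 : ℝ) + p.2) ≤ rateFun K α w₀ + η) ∧ ∀ᶠ p in sizeFilter α,
      rateFun K α w₀ - η ≤ Real.log (Z p) / ((p.1 : ℝ) + p.2) by
    refine Metric.tendsto_nhds.2 fun ε hε => ?_
    filter_upwards [(h (ε / 2) (half_pos hε)).1, (h (ε / 2) (half_pos hε)).2] with p hp1 hp2
    rw [Real.dist_eq, abs_lt]
    constructor <;> linarith
  intro η hη
  rcases lt_or_ge √(α * (1 - α)) w₀ with hlt | hge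
  · have hc := hsad hlt
    have hw0 : 0 < w₀ := hs0.trans hlt
    refine ⟨hc.eventually_le hR hκ hZ hZA hη, ?_⟩
    have hr : K - 0 = (α + w₀)⁻¹ := by
      have : w₀ = K⁻¹ - α := by
        rcases max_choice √(α * (1 - α)) (K⁻¹ - α) with h | h
        · rw [hw₀, saddleParam, h] at hlt
          exact absurd hlt (lt_irrefl _)
        · rw [hw₀, saddleParam, h]
      rw [this, sub_zero, add_sub_cancel, inv_inv]
    have := hc.eventually_ge h0 hw0 hR hκ hZA le_rfl hr (eventually_not_posDef_zero hc) hη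
    simpa using this
  · have hw : w₀ = √(α * (1 - α)) := le_antisymm hge (le_max_left _ _)
    have hKw : K⁻¹ ≤ α + √(α * (1 - α)) := by
      have : K⁻¹ - α ≤ w₀ := le_max_right _ _
      linarith
    rw [hw]
    have hcont : Tendsto (fun k => rateFun K α (edgeSeq α k)) atTop
        (𝓝 (rateFun K α √(α * (1 - α)))) :=
      (continuousAt_rateFun h0 hs0).tendsto.comp (tendsto_edgeSeq α)
    -- The threshold of `LimControl.eventually_not_posDef` at two consecutive points, plus 1/(k+1)
    -- for strictness. It tends to zero because the product of the two parameters tends to α(1-α).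
    set Δ : ℕ → ℝ := fun k => (α + edgeSeq α (k + 1)) *
      (1 - α * (1 - α) / (edgeSeq α (k + 1) * edgeSeq α k)) + 1 / ((k : ℝ) + 1) with hΔ
    have hΔ0 : Tendsto Δ atTop (𝓝 0) := by
      have e1 := (tendsto_add_atTop_iff_nat 1).2 (tendsto_edgeSeq α)
      have e2 := tendsto_edgeSeq α
      have e3 := ((e1.const_add α).mul ((tendsto_const_nhds (x := α * (1 - α))).div (e1.mul e2)
        (by positivity) |>.const_sub 1)).add (tendsto_one_div_add_atTop_nhds_zero_nat (𝕜 := ℝ))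
      have e4 : (α + √(α * (1 - α))) * (1 - α * (1 - α) / (√(α * (1 - α)) * √(α * (1 - α)))) + 0
          = 0 := by
        have : α * (1 - α) ≠ 0 := (mul_pos h0 (by linarith)).ne'
        rw [← sq, hsq, div_self this, sub_self, mul_zero, add_zero]
      rw [e4] at e3
      exact e3
    have hloss : Tendsto (fun k => rateFun K α (edgeSeq α (k + 1)) - α / 2 * (Δ k * K)) atTop
        (𝓝 (rateFun K α √(α * (1 - α)))) := by
      have := ((tendsto_add_atTop_iff_nat 1).2 hcont).sub ((hΔ0.mul_const K).const_mul (α / 2))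
      rwa [zero_mul, mul_zero, sub_zero] at this
    constructor
    · obtain ⟨k, hk⟩ := (hcont.eventually_lt_const (lt_add_of_pos_right _ (half_pos hη))).exists
      filter_upwards [(hedge k).eventually_le hR hκ hZ hZA (half_pos hη)] with p hp
      linarith
    · obtain ⟨k, hk⟩ := (hloss.eventually_const_lt (sub_lt_self _ (half_pos hη))).exists
      have hgt := edgeSeq_gt α (k + 1)
      obtain ⟨hw1, hsq1⟩ := sq_lt_of_sqrt_lt hgt
      have hlt : edgeSeq α (k + 1) < edgeSeq α k := by
        unfold edgeSeq
        push_cast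
        have : 1 / ((k : ℝ) + 1 + 1) < 1 / ((k : ℝ) + 1) := by
          gcongr
          linarith
        linarith
      have hΔlt : (α + edgeSeq α (k + 1)) *
          (1 - α * (1 - α) / (edgeSeq α (k + 1) * edgeSeq α k)) < Δ k :=
        lt_add_of_pos_right _ (by positivity)
      have hΔpos : 0 ≤ Δ k := by
        refine add_nonneg (mul_nonneg (by linarith) ?_) (by positivity)
        rw [sub_nonneg, div_le_one (mul_pos hw1 (hw1.trans hlt))]
        nlinarith
      have hnpd := (hedge (k + 1)).eventually_not_posDef (hedge k) h0 hw1 hsq1 hlt hΔlt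
      have hinv : (α + edgeSeq α (k + 1))⁻¹ ≤ K := by
        rw [inv_le_comm₀ (by positivity) hK]
        linarith
      have hinv0 : 0 < (α + edgeSeq α (k + 1))⁻¹ := by positivity
      filter_upwards [(hedge (k + 1)).eventually_ge h0 hw1 hR hκ hZA
        (r := K - (α + edgeSeq α (k + 1))⁻¹) (sub_nonneg.2 hinv) (sub_sub_cancel _ _) hnpd
        (half_pos hη)] with p hp
      have h3 : α / 2 * (Δ k * (K - (α + edgeSeq α (k + 1))⁻¹)) ≤ α / 2 * (Δ k * K) := by
        gcongr
        linarith
      linarith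

/-- Almost sure convergence of the free energy for measurable weights. -/
theorem ae_tendsto_rbmFreeEnergy {Ω : Type*} [MeasurableSpace Ω] {P : Measure Ω}
    [IsProbabilityMeasure P] {ν : Measure ℝ} {c : NNReal} {ξ : ℕ → ℕ → Ω → ℝ}
    [IsProbabilityMeasure ν]
    (hν : IsStdSubgaussian ν c) (hm : ∀ i j, Measurable (ξ i j))
    (hind : iIndepFun (fun (p : ℕ × ℕ) (ω : Ω) => ξ p.1 p.2 ω) P)
    (hlaw : ∀ i j, P.map (ξ i j) = ν) {θ β : ℝ} (h0 : 0 < α) (h1 : α < 1) (hR : 0 < R)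
    (hθ : 0 < θ) (hβ : 0 < β) :
    ∀ᵐ ω ∂P, Tendsto (fun p : ℕ × ℕ => rbmFreeEnergy R θ β
        (Matrix.of fun (i : Fin p.1) (j : Fin p.2) => ξ i j ω)) (sizeFilter α)
      (𝓝 (rateFun (θ * β ^ 2 * R ^ 2) α (saddleParam (θ * β ^ 2 * R ^ 2) α))) := by
  have hedge : ∀ᵐ ω ∂P, ∀ k, LimControl α (edgeSeq α k) fun p => sampleCov ξ p ω :=
    ae_all_iff.2 fun k => ae_limControl hν hm hind hlaw h0 h1 (edgeSeq_gt α k)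
  have hsad : ∀ᵐ ω ∂P, √(α * (1 - α)) < saddleParam (θ * β ^ 2 * R ^ 2) α →
      LimControl α (saddleParam (θ * β ^ 2 * R ^ 2) α) fun p => sampleCov ξ p ω := by
    by_cases h : √(α * (1 - α)) < saddleParam (θ * β ^ 2 * R ^ 2) α
    · filter_upwards [ae_limControl hν hm hind hlaw h0 h1 h] with ω hω _ using hω
    · exact ae_of_all _ fun ω h' => absurd h' h
  filter_upwards [hedge, hsad] with ω h2 h3
  have key := tendsto_log_div_of_limControl (Z := fun p => rbmPartitionFunction R θ β
    (Matrix.of fun (i : Fin p.1) (j : Fin p.2) => ξ i j ω)) h0 h1 hR (by positivity : 0 < θ * β ^ 2)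
    (fun p hp => rbmPartitionFunction_pos hp R θ β _)
    (fun p => by rw [ofReal_rbmPartitionFunction R hθ.le, sampleCov_eq]) h3 h2
  refine key.congr fun p => ?_
  rw [rbmFreeEnergy, one_div_mul_eq_div]

theorem mainTheorem4
    (α β R θ : ℝ) (hα : α ∈ Set.Ioo (0 : ℝ) 1) (hβ : 0 < β) (hR : 0 < R) (hθ : 0 < θ) :
    ∃ A : ℝ, ∀ (Ω : Type*) [MeasurableSpace Ω] (P : Measure Ω) [IsProbabilityMeasure P]
      (ξ : ℕ → ℕ → Ω → ℝ),
      iIndepFun (fun (p : ℕ × ℕ) (ω : Ω) => ξ p.1 p.2 ω) P →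
      (∀ i j, IdentDistrib (ξ i j) (ξ 0 0) P P) →
      (∃ c, HasSubgaussianMGF (ξ 0 0) c P) →
      ∫ ω, ξ 0 0 ω ∂P = 0 →
      ∫ ω, ξ 0 0 ω ^ 2 ∂P = 1 →
      ∀ N₁ N₂ : ℕ → ℕ,
        Tendsto N₁ atTop atTop →
        Tendsto N₂ atTop atTop →
        Tendsto (fun n => (N₁ n : ℝ) / ((N₁ n : ℝ) + (N₂ n : ℝ))) atTop (𝓝 α) →
        ∀ᵐ ω ∂P,
          Tendsto
            (fun n => rbmFreeEnergy R θ β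
              (Matrix.of fun (i : Fin (N₁ n)) (j : Fin (N₂ n)) => ξ i j ω))
            atTop (𝓝 A) := by
  refine ⟨rateFun (θ * β ^ 2 * R ^ 2) α (saddleParam (θ * β ^ 2 * R ^ 2) α), ?_⟩
  intro Ω _ P _ ξ hind hid ⟨c, hc⟩ hmean hvar N₁ N₂ hN₁ hN₂ hN
  have hae : ∀ i j, AEMeasurable (ξ i j) P := fun i j => (hid i j).aemeasurable_fst
  -- Identical distribution gives only almost everywhere measurability. The measurable versions have
  -- the same laws and independence, and agree with all of the countably many weights off one null
  -- set.
  set ξ' : ℕ → ℕ → Ω → ℝ := fun i j => (hae i j).mk (ξ i j) with hξ'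
  have heq : ∀ i j, ξ i j =ᵐ[P] ξ' i j := fun i j => (hae i j).ae_eq_mk
  have hm : ∀ i j, Measurable (ξ' i j) := fun i j => (hae i j).measurable_mk
  have hind' : iIndepFun (fun (p : ℕ × ℕ) (ω : Ω) => ξ' p.1 p.2 ω) P :=
    hind.congr fun p => heq p.1 p.2
  set ν := P.map (ξ 0 0) with hν
  have hνp : IsProbabilityMeasure ν := Measure.isProbabilityMeasure_map (hae 0 0)
  have hlaw : ∀ i j, P.map (ξ' i j) = ν := fun i j => by
    rw [← Measure.map_congr (heq i j)]
    exact (hid i j).map_eq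
  have hstd : IsStdSubgaussian ν c := by
    refine ⟨?_, ?_, ?_⟩
    · refine ⟨fun t => ?_, fun t => ?_⟩
      · rw [hν, integrable_map_measure (by fun_prop) (hae 0 0)]
        exact hc.integrable_exp_mul t
      · have := mgf_map (hae 0 0) (X := fun x : ℝ => x) (t := t) (by fun_prop)
        rw [hν, this]
        exact hc.mgf_le t
    · rw [hν, integral_map (hae 0 0) (by fun_prop)]
      exact hmean
    · rw [hν, integral_map (hae 0 0) (by fun_prop)]
      exact hvar
  have hall : ∀ᵐ ω ∂P, ∀ i j, ξ i j ω = ξ' i j ω :=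
    ae_all_iff.2 fun i => ae_all_iff.2 fun j => heq i j
  filter_upwards [ae_tendsto_rbmFreeEnergy hstd hm hind' hlaw hα.1 hα.2 hR hθ hβ, hall] with ω h1 h2
  have h3 := h1.comp (tendsto_sizeFilter hN₁ hN₂ hN)
  simp only [h2]
  exact h3

end Main
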